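/- **Conventions.** Hilbert spaces are complex and separable (of finite or infinite dimension), $\log$ is the natural logarithm, $\|\cdot\|_1$ is the trace norm, and $\mathfrak S(\mathcal H)$ is the set of states (positive trace-class operators of unit trace) on $\mathcal H$. A Hamiltonian $H$ is a positive self-adjoint, possibly unbounded, operator; $E_X(\rho)=\mathrm{Tr}\,H_X\rho\in[0,+\infty]$ is the energy of a state $\rho$ of the system $X$ with Hamiltonian $H_X$. A quantum channel $\Phi:A\to B$ is a completely positive trace-preserving linear map from the trace-class operators on $\mathcal H_A$ to those on $\mathcal H_B$. A generalized ensemble is a Borel probability measure $\mu$ on $\mathfrak S(\mathcal H)$; its average state is $\bar\rho(\mu)=\int\rho\,\mu(d\rho)$, and its Holevo quantity is $\chi(\mu)=\int H(\rho\|\bar\rho(\mu))\,\mu(d\rho)$, where $H(\cdot\|\cdot)$ is the quantum relative entropy. The energy-constrained Holevo capacity is $$C_\chi(\Phi,H_A,E)=\sup\{\chi(\mu\circ\Phi^{-1}) : \mathrm{Tr}\,H_A\bar\rho(\mu)\le E\},$$ the supremum being over generalized ensembles $\mu$ of states of $A$, and $D(\Phi|\sigma)=\frac12\sup_{\rho\in\mathfrak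 S(\mathcal H_A)}\|\Phi(\rho)-\sigma\|_1$. Further, $h_2$ is the binary entropy, $g(p)=(p+1)\log(p+1)-p\log p$, $F_{H}(E)=\sup\{H(\rho):\mathrm{Tr}\,H\rho\le E\}$ with $H(\rho)$ the von Neumann entropy, and $E_0(H)=\inf_{\|\varphi\|=1}\langle\varphi|H|\varphi\rangle$. A function $\widehat F$ on $[0,+\infty)$ is called *admissible for $H$* if it is continuous on $[0,+\infty)$ and twice continuously differentiable on $(0,+\infty)$, if $\widehat F(E)\ge F_H(E)$ for all $E\ge E_0(H)$, and if $\widehat F(E)>0$, $\widehat F'(E)>0$, $\widehat F''(E)\le 0$ for all $E>0$. **Proposition 4.** (i) Let $H_B$ satisfy $\mathrm{Tr}\,e^{-\lambda H_B}<+\infty$ for some $\lambda>0$. Let $\Phi:A\to B$ be a quantum channel, $\sigma\in\mathfrak S(\mathcal H_B)$ a state with finite energy $E_B(\sigma)$, $E\ge 0$, $\varepsilon=D(\Phi|\sigma)>0$, and let $E_*=\sup_{E_A(\rho)\le E}E_B(\Phi(\rho))$ be finite and positive. Then for every function $\widehat F$ admissible for $H_B$ $$C_\chi(\Phi,H_A,E)\le\inf_{t\in(0,a]}\left(\varepsilon\left(\frac{1+\kappa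 t}{1-\varepsilon t}+t\right)\widehat F\left(\frac{E_*}{\varepsilon t}\right)+h_2(\varepsilon t)+g\left(\frac{1+\kappa t}{1-\varepsilon t}\,\varepsilon\right)\right),$$ where $a=\frac1{2\varepsilon}$ and $\kappa=\frac12\left(1+E_B(\sigma)/E_*\right)$. If $\dim\mathcal H_B=\infty$, the infimum is a minimum. (ii) Let $B$ be the $\ell$-mode quantum oscillator, $\ell\ge1$, with Hamiltonian $H_B=\sum_{i=1}^\ell\hbar\omega_i\left(a_i^+a_i+\frac12 I\right)$, $\hbar,\omega_i>0$, and let $$\widehat F_{\ell,\omega}(E)=\ell\log\frac{E+\frac12\sum_i\hbar\omega_i}{\ell\left[\prod_i\hbar\omega_i\right]^{1/\ell}}+\ell .$$ Then $\mathrm{Tr}\,e^{-\lambda H_B}<+\infty$ for some $\lambda>0$, $\widehat F_{\ell,\omega}$ is admissible for $H_B$, and the upper bound in (i) with $\widehat F=\widehat F_{\ell,\omega}$ is tight for large $E$ and optimal choice of $\sigma$, in the following sense. For every state $\sigma$ of finite energy and every $\varepsilon\in(0,1]$ there is a channel $\Phi:A\to B$, where $A=B$ and $H_A=H_B$, such that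 $D(\Phi|\sigma)=\varepsilon$, that $E_*$ is finite for all $E$, that the ratio of $C_\chi(\Phi,H_A,E)$ to the upper bound in (i) tends to $1$ as $E\to+\infty$, and that for every $E_1\ge E_0(H_B)$ $$\sup_{E\ge E_1}\frac{C_\chi(\Phi,H_A,E)}{G(E)}=1,\qquad C_\chi(\Phi,H_A,E)\le G(E)\quad (E\ge E_1),$$ where $G(E)$ is the infimum of the upper bound in (i) over all states $\sigma'$ of $B$ with finite energy and $D(\Phi|\sigma')>0$. -/

import Mathlib

open scoped InnerProductSpace ENNReal NNReal ComplexOrder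
open MeasureTheory Filter Topology

noncomputable section

namespace HolevoBound

section TraceClassOperators

variable {H : Type*} [NormedAddCommGroup H] [InnerProductSpace ℂ H]

/-- The trace norm `‖T‖₁ = Tr |T|` of a bounded operator, with values in `[0, ∞]`, written as the
supremum of `∑ |⟨eᵢ, T fᵢ⟩|` over all pairs of finite orthonormal systems. -/
def traceENorm (T : H →L[ℂ] H) : ℝ≥0∞ :=
  ⨆ (n : ℕ) (e : Fin n → H) (f : Fin n → H) (_ : Orthonormal ℂ e) (_ : Orthonormal ℂ f),
    ∑ i, ‖⟪e i, T (f i)⟫_ℂ‖ₑ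

theorem le_traceENorm (T : H →L[ℂ] H) {n : ℕ} {e f : Fin n → H} (he : Orthonormal ℂ e)
    (hf : Orthonormal ℂ f) : ∑ i, ‖⟪e i, T (f i)⟫_ℂ‖ₑ ≤ traceENorm T :=
  le_iSup_of_le n <| le_iSup_of_le e <| le_iSup_of_le f <| le_iSup_of_le he <|
    le_iSup_of_le hf le_rfl

theorem traceENorm_le {T : H →L[ℂ] H} {c : ℝ≥0∞}
    (h : ∀ (n : ℕ) (e f : Fin n → H), Orthonormal ℂ e → Orthonormal ℂ f →
      ∑ i, ‖⟪e i, T (f i)⟫_ℂ‖ₑ ≤ c) : traceENorm T ≤ c :=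
  iSup_le fun n => iSup_le fun e => iSup_le fun f => iSup_le fun he => iSup_le fun hf =>
    h n e f he hf

theorem traceENorm_zero : traceENorm (0 : H →L[ℂ] H) = 0 := by
  refine le_antisymm (traceENorm_le fun n e f _ _ => ?_) bot_le
  simp

theorem traceENorm_add_le (S T : H →L[ℂ] H) :
    traceENorm (S + T) ≤ traceENorm S + traceENorm T := by
  refine traceENorm_le fun n e f he hf => ?_
  calc ∑ i, ‖⟪e i, (S + T) (f i)⟫_ℂ‖ₑ
      ≤ ∑ i, (‖⟪e i, S (f i)⟫_ℂ‖ₑ + ‖⟪e i, T (f i)⟫_ℂ‖ₑ) := by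
        refine Finset.sum_le_sum fun i _ => ?_
        rw [add_apply, inner_add_right]
        exact enorm_add_le _ _
    _ ≤ traceENorm S + traceENorm T := by
        rw [Finset.sum_add_distrib]
        exact add_le_add (le_traceENorm S he hf) (le_traceENorm T he hf)

theorem traceENorm_smul_le (c : ℂ) (T : H →L[ℂ] H) :
    traceENorm (c • T) ≤ ‖c‖ₑ * traceENorm T := by
  refine traceENorm_le fun n e f he hf => ?_
  simp only [smul_apply, inner_smul_right, enorm_mul, ← Finset.mul_sum]
  gcongr
  exact le_traceENorm T he hf

theorem enorm_le_traceENorm (T : H →L[ℂ] H) : ‖T‖ₑ ≤ traceENorm T := by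
  by_cases htop : traceENorm T = ⊤
  · rw [htop]; exact le_top
  have key : ‖T‖ ≤ (traceENorm T).toReal := by
    refine T.opNorm_le_bound ENNReal.toReal_nonneg fun x => ?_
    by_cases hTx : T x = 0
    · rw [hTx, norm_zero]; positivity
    have hx : x ≠ 0 := fun h => hTx (by rw [h, map_zero])
    have hx' : ‖x‖ ≠ 0 := norm_ne_zero_iff.2 hx
    have hTx' : ‖T x‖ ≠ 0 := norm_ne_zero_iff.2 hTx
    have on : ∀ y : H, y ≠ 0 → Orthonormal ℂ (fun _ : Fin 1 => ((‖y‖⁻¹ : ℝ) : ℂ) • y) := by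
      intro y hy
      refine ⟨fun _ => ?_, fun i j hij => absurd (Subsingleton.elim i j) hij⟩
      simp [norm_smul, norm_ne_zero_iff.2 hy]
    have h := le_traceENorm T (on _ hTx) (on _ hx)
    have h2 := (ENNReal.toReal_le_toReal (ne_top_of_le_ne_top htop h) htop).2 h
    simp only [Fin.sum_univ_one, map_smul, inner_smul_left, inner_smul_right,
      inner_self_eq_norm_sq_to_K, toReal_enorm, norm_mul] at h2
    have e1 : ‖(starRingEnd ℂ) ((‖T x‖⁻¹ : ℝ) : ℂ)‖ = ‖T x‖⁻¹ := by simp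
    have e2 : ‖((‖x‖⁻¹ : ℝ) : ℂ)‖ = ‖x‖⁻¹ := by simp
    rw [e1, e2] at h2
    have e3 : ‖((‖T x‖ : ℂ) ^ 2)‖ = ‖T x‖ ^ 2 := by simp
    have h3 : ‖T x‖⁻¹ * (‖x‖⁻¹ * ‖T x‖ ^ 2) ≤ (traceENorm T).toReal := by
      refine le_trans (le_of_eq ?_) h2
      simp
      ring
    have h4 : ‖T x‖⁻¹ * (‖x‖⁻¹ * ‖T x‖ ^ 2) = ‖T x‖ / ‖x‖ := by
      field_simp
    rw [h4, div_le_iff₀ (by positivity)] at h3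
    exact h3
  rw [← ofReal_norm]
  exact (ENNReal.ofReal_le_ofReal key).trans ENNReal.ofReal_toReal_le

variable (H) in
/-- The subspace of operators with finite trace norm. -/
def traceClassSubmodule : Submodule ℂ (H →L[ℂ] H) where
  carrier := {T | traceENorm T < ⊤}
  add_mem' hS hT := (traceENorm_add_le _ _).trans_lt (ENNReal.add_lt_top.2 ⟨hS, hT⟩)
  zero_mem' := by simp [traceENorm_zero]
  smul_mem' c T hT := (traceENorm_smul_le c T).trans_lt (ENNReal.mul_lt_top enorm_lt_top hT)

variable (H) in
/-- The Banach space of trace-class operators, normed by the trace norm. -/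
def TraceClass : Type _ := traceClassSubmodule H

namespace TraceClass

instance : AddCommGroup (TraceClass H) := inferInstanceAs (AddCommGroup (traceClassSubmodule H))
instance : Module ℂ (TraceClass H) := inferInstanceAs (Module ℂ (traceClassSubmodule H))

/-- The inclusion of trace-class operators into bounded operators. -/
def toCLM : TraceClass H →ₗ[ℂ] (H →L[ℂ] H) := (traceClassSubmodule H).subtype

theorem toCLM_injective : Function.Injective (toCLM : TraceClass H → (H →L[ℂ] H)) :=
  (traceClassSubmodule H).injective_subtype

theorem traceENorm_ne_top (T : TraceClass H) : traceENorm T.toCLM ≠ ⊤ := T.2.ne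

instance : Norm (TraceClass H) := ⟨fun T => (traceENorm T.toCLM).toReal⟩

theorem norm_def (T : TraceClass H) : ‖T‖ = (traceENorm T.toCLM).toReal := rfl

theorem opNorm_le (T : TraceClass H) : ‖T.toCLM‖ ≤ ‖T‖ := by
  have := (ENNReal.toReal_le_toReal enorm_ne_top T.traceENorm_ne_top).2
    (enorm_le_traceENorm T.toCLM)
  simpa [norm_def] using this

theorem norm_smul_le' (c : ℂ) (T : TraceClass H) : ‖c • T‖ ≤ ‖c‖ * ‖T‖ := by
  have h := traceENorm_smul_le c T.toCLM
  have := (ENNReal.toReal_le_toReal (by simpa using (c • T).traceENorm_ne_top)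
    (ENNReal.mul_ne_top enorm_ne_top T.traceENorm_ne_top)).2 h
  simpa [norm_def, ENNReal.toReal_mul] using this

theorem norm_add_le' (S T : TraceClass H) : ‖S + T‖ ≤ ‖S‖ + ‖T‖ := by
  have h := traceENorm_add_le S.toCLM T.toCLM
  have := (ENNReal.toReal_le_toReal (by simpa using (S + T).traceENorm_ne_top)
    (ENNReal.add_ne_top.2 ⟨S.traceENorm_ne_top, T.traceENorm_ne_top⟩)).2 h
  simpa [norm_def, ENNReal.toReal_add S.traceENorm_ne_top T.traceENorm_ne_top] using this

theorem norm_zero' : ‖(0 : TraceClass H)‖ = 0 := by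
  simp [norm_def, traceENorm_zero]

theorem norm_neg' (T : TraceClass H) : ‖-T‖ = ‖T‖ := by
  have h : ∀ S : TraceClass H, ‖-S‖ ≤ ‖S‖ := fun S => by
    simpa using norm_smul_le' (-1) S
  exact le_antisymm (h T) (by simpa using h (-T))

instance : NormedAddCommGroup (TraceClass H) :=
  AddGroupNorm.toNormedAddCommGroup
    { toFun := fun T => ‖T‖
      map_zero' := norm_zero'
      add_le' := norm_add_le'
      neg' := norm_neg'
      eq_zero_of_map_eq_zero' := fun T hT => by
        apply toCLM_injective
        rw [map_zero, ← norm_le_zero_iff]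
        exact (opNorm_le T).trans hT.le }

instance : NormedSpace ℂ (TraceClass H) where
  norm_smul_le := norm_smul_le'

/-- The inclusion into bounded operators is continuous. -/
theorem toCLM_lipschitz : LipschitzWith 1 (toCLM : TraceClass H → (H →L[ℂ] H)) :=
  LipschitzWith.of_dist_le_mul fun S T => by
    rw [dist_eq_norm, dist_eq_norm, ← map_sub, NNReal.coe_one, one_mul]
    exact opNorm_le (S - T)

instance [CompleteSpace H] : CompleteSpace (TraceClass H) := by
  refine Metric.complete_of_cauchySeq_tendsto fun u hu => ?_
  obtain ⟨T, hT⟩ := cauchySeq_tendsto_of_complete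
    (toCLM_lipschitz.uniformContinuous.comp_cauchySeq hu)
  have hin : ∀ x y : H, Tendsto (fun k => ⟪x, (u k).toCLM y⟫_ℂ) atTop (𝓝 ⟪x, T y⟫_ℂ) :=
    fun x y => tendsto_const_nhds.inner
      (((ContinuousLinearMap.apply ℂ H y).continuous.tendsto T).comp hT)
  have bound : ∀ (ε : ℝ) (N : ℕ), (∀ m ≥ N, ∀ k ≥ N, ‖u m - u k‖ ≤ ε) →
      ∀ m ≥ N, traceENorm ((u m).toCLM - T) ≤ ENNReal.ofReal ε := by
    intro ε N hN m hm
    refine traceENorm_le fun n e f he hf => ?_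
    have lim : Tendsto (fun k => ∑ i, ‖⟪e i, ((u m).toCLM - (u k).toCLM) (f i)⟫_ℂ‖ₑ) atTop
        (𝓝 (∑ i, ‖⟪e i, ((u m).toCLM - T) (f i)⟫_ℂ‖ₑ)) := by
      refine tendsto_finsetSum _ fun i _ => ?_
      simp only [sub_apply, inner_sub_right]
      exact (continuous_enorm.tendsto _).comp (tendsto_const_nhds.sub (hin _ _))
    refine le_of_tendsto lim (eventually_atTop.2 ⟨N, fun k hk => ?_⟩)
    calc _ ≤ traceENorm ((u m).toCLM - (u k).toCLM) := le_traceENorm _ he hf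
      _ = ENNReal.ofReal ‖u m - u k‖ := by
        rw [norm_def, ENNReal.ofReal_toReal (traceENorm_ne_top _), map_sub]
      _ ≤ _ := ENNReal.ofReal_le_ofReal (hN m hm k hk)
  have cau : ∀ ε > 0, ∃ N, ∀ m ≥ N, ∀ k ≥ N, ‖u m - u k‖ ≤ ε := fun ε hε => by
    obtain ⟨N, hN⟩ := Metric.cauchySeq_iff.1 hu ε hε
    exact ⟨N, fun m hm k hk => by rw [← dist_eq_norm]; exact (hN m hm k hk).le⟩
  have hmem : T ∈ traceClassSubmodule H := by
    obtain ⟨N, hN⟩ := cau 1 one_pos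
    have h1 : (u N).toCLM - T ∈ traceClassSubmodule H :=
      (bound 1 N hN N le_rfl).trans_lt ENNReal.ofReal_lt_top
    have h2 : (u N).toCLM ∈ traceClassSubmodule H := (u N).2
    simpa using sub_mem h2 h1
  let T' : TraceClass H := ⟨T, hmem⟩
  refine ⟨T', Metric.tendsto_atTop'.2 fun ε hε => ?_⟩
  obtain ⟨N, hN⟩ := cau (ε / 2) (by positivity)
  refine ⟨N, fun m hm => ?_⟩
  rw [dist_eq_norm]
  have h := bound (ε / 2) N hN m hm.le
  have h2 : traceENorm (u m - T').toCLM ≤ ENNReal.ofReal (ε / 2) := by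
    rw [map_sub]; exact h
  have h3 : ‖u m - T'‖ ≤ ε / 2 := by
    rw [norm_def]; exact ENNReal.toReal_le_of_le_ofReal (by positivity) h2
  linarith

end TraceClass

end TraceClassOperators

section States

variable {H : Type*} [NormedAddCommGroup H] [InnerProductSpace ℂ H] [CompleteSpace H]

variable (H) in
/-- A fixed orthonormal basis of `H`; it only serves to write down traces, which do not depend
on it. -/
def stdBasisSet : Set H := (exists_hilbertBasis ℂ H).choose

variable (H) in
def stdBasis : HilbertBasis (stdBasisSet H) ℂ H := (exists_hilbertBasis ℂ H).choose_spec.choose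

/-- `Tr T` for a trace-class operator `T`. -/
def trace (T : H →L[ℂ] H) : ℂ := ∑' i, ⟪stdBasis H i, T (stdBasis H i)⟫_ℂ

/-- `Tr T ∈ [0, ∞]` for a positive bounded operator `T`. -/
def posTrace (T : H →L[ℂ] H) : ℝ≥0∞ :=
  ∑' i, ENNReal.ofReal (⟪stdBasis H i, T (stdBasis H i)⟫_ℂ).re

variable (H) in
/-- Quantum states: positive trace-class operators of unit trace. The topology is that of the
trace norm. -/
def State : Type _ := {T : TraceClass H // T.toCLM.IsPositive ∧ trace T.toCLM = 1}

namespace State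

instance : MetricSpace (State H) :=
  inferInstanceAs (MetricSpace {T : TraceClass H // T.toCLM.IsPositive ∧ trace T.toCLM = 1})

instance : MeasurableSpace (State H) := borel _
instance : BorelSpace (State H) := ⟨rfl⟩

/-- A state as a trace-class operator. -/
def toTC (ρ : State H) : TraceClass H := ρ.1

/-- A state as a bounded operator. -/
def op (ρ : State H) : H →L[ℂ] H := ρ.toTC.toCLM

end State

/-- The von Neumann entropy `Tr η(ρ)`, `η(x) = - x log x`. -/
def entropy (ρ : H →L[ℂ] H) : ℝ≥0∞ := posTrace (cfc Real.negMulLog ρ)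

/-- `w` is an orthonormal basis of eigenvectors of `T`; the eigenvalue of `v ∈ w` is
`⟨v, T v⟩`. -/
def IsEigenbasis (T : H →L[ℂ] H) (w : Set H) : Prop :=
  Orthonormal ℂ ((↑) : w → H) ∧ (Submodule.span ℂ w).topologicalClosure = ⊤ ∧
    ∀ v ∈ w, T v = ⟪v, T v⟫_ℂ • v

/-- `x log x - x log y + y - x` for `x, y ≥ 0`, with value `+∞` if `y = 0 < x`. -/
def relEntropyTerm (x y : ℝ) : ℝ≥0∞ :=
  if y = 0 then (if x = 0 then 0 else ⊤)
  else ENNReal.ofReal (x * Real.log x - x * Real.log y + y - x)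

/-- The quantum relative entropy `∑ᵢ ⟨i| ρ log ρ - ρ log σ |i⟩` of two states, where `|i⟩` runs
over an eigenbasis of `ρ`. The diagonal elements of `log σ` are expanded over an eigenbasis `|j⟩`
of `σ`, and `⟨i| σ - ρ |i⟩`, whose sum over `i` is `Tr σ - Tr ρ = 0`, is added to the `i`-th term,
which makes all terms of the double series nonnegative. A term is `+∞` exactly if `|i⟩` has a
positive eigenvalue and is not orthogonal to a vector `|j⟩` in the kernel of `σ`, that is, if
`supp ρ` is not contained in `supp σ`. The value does not depend on the eigenbases. -/
def relEntropy (ρ σ : H →L[ℂ] H) : ℝ≥0∞ :=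
  ⨅ (e : Set H) (_ : IsEigenbasis ρ e) (f : Set H) (_ : IsEigenbasis σ f),
    ∑' (i : e) (j : f), ‖⟪(i : H), (j : H)⟫_ℂ‖ₑ ^ 2 *
      relEntropyTerm (⟪(i : H), ρ i⟫_ℂ).re (⟪(j : H), σ j⟫_ℂ).re

/-- The average state (barycenter) of a generalized ensemble, a Bochner integral in the space of
trace-class operators. -/
def averageState (μ : Measure (State H)) : TraceClass H := ∫ ρ, ρ.toTC ∂μ

/-- The Holevo quantity of a generalized ensemble. -/
def holevoQuantity (μ : Measure (State H)) : ℝ≥0∞ :=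
  ∫⁻ ρ, relEntropy ρ.op (averageState μ).toCLM ∂μ

end States

section Hamiltonians

variable {H : Type*} [NormedAddCommGroup H] [InnerProductSpace ℂ H] [CompleteSpace H]

variable (H) in
/-- A Hamiltonian: a positive (in general unbounded) self-adjoint operator. Self-adjointness in
the sense `A† = A` includes density of the domain. -/
structure Hamiltonian where
  op : H →ₗ.[ℂ] H
  selfAdjoint : IsSelfAdjoint op
  nonneg : ∀ ψ : op.domain, 0 ≤ (⟪(ψ : H), op ψ⟫_ℂ).re

namespace Hamiltonian

variable (K : Hamiltonian H)

/-- The energy `Tr K ρ ∈ [0, ∞]` of a positive trace-class operator `ρ`: the supremum of `Tr B ρ`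
over the bounded operators `0 ≤ B ≤ K` (it is the limit of `Tr K Pₙ ρ`, where `Pₙ` is the spectral
projector of `K` for `[0, n]`). -/
def energy (ρ : H →L[ℂ] H) : ℝ≥0∞ :=
  ⨆ (B : H →L[ℂ] H) (_ : B.IsPositive)
    (_ : ∀ ψ : K.op.domain, (⟪(ψ : H), B ψ⟫_ℂ).re ≤ (⟪(ψ : H), K.op ψ⟫_ℂ).re),
    ENNReal.ofReal (trace (B ∘L ρ)).re

/-- `E₀ = inf ⟨φ, K φ⟩` over the unit vectors `φ`. -/
def groundEnergy : ℝ :=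
  ⨅ φ : {φ : K.op.domain // ‖(φ : H)‖ = 1}, (⟪((φ : K.op.domain) : H), K.op φ⟫_ℂ).re

/-- `R = (I + K)⁻¹`. -/
def IsInvOneAdd (R : H →L[ℂ] H) : Prop :=
  ∀ x : H, ∃ h : R x ∈ K.op.domain, R x + K.op ⟨R x, h⟩ = x

/-- `exp (-s K)` is the continuous function `x ↦ exp (- s (1/x - 1))` (with value `0` at `x = 0`)
of the bounded operator `R = (I + K)⁻¹`. -/
def expNeg (s : ℝ) (R : H →L[ℂ] H) : H →L[ℂ] H :=
  cfc (fun x : ℝ => if x ≤ 0 then 0 else Real.exp (-s * (x⁻¹ - 1))) R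

/-- `Tr exp (-s K) < ∞` for some `s > 0`. -/
def GibbsCondition : Prop :=
  ∃ s : ℝ, 0 < s ∧ ∃ R : H →L[ℂ] H, K.IsInvOneAdd R ∧ posTrace (expNeg s R) < ⊤

/-- `F_K(E)`, the supremum of the entropy over the states of energy at most `E`. -/
def maxEntropy (E : ℝ≥0) : ℝ≥0∞ :=
  ⨆ (ρ : State H) (_ : K.energy ρ.op ≤ E), entropy ρ.op

/-- `F` is an upper bound for `F_K` on `[E₀, ∞)` that is continuous on `[0, ∞)`, twice continuously
differentiable on `(0, ∞)`, with `F > 0`, `F' > 0`, `F'' ≤ 0` there. -/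
structure IsEntropyBound (F : ℝ → ℝ) : Prop where
  continuousOn : ContinuousOn F (Set.Ici 0)
  contDiffOn : ContDiffOn ℝ 2 F (Set.Ioi 0)
  maxEntropy_le : ∀ E : ℝ≥0, K.groundEnergy ≤ E → K.maxEntropy E ≤ ENNReal.ofReal (F E)
  pos : ∀ E : ℝ, 0 < E → 0 < F E
  deriv_pos : ∀ E : ℝ, 0 < E → 0 < deriv F E
  deriv_deriv_nonpos : ∀ E : ℝ, 0 < E → deriv (deriv F) E ≤ 0

end Hamiltonian

end Hamiltonians

section Channels

variable {HA HB : Type*} [NormedAddCommGroup HA] [InnerProductSpace ℂ HA] [CompleteSpace HA]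
  [NormedAddCommGroup HB] [InnerProductSpace ℂ HB] [CompleteSpace HB]

variable (HA HB) in
/-- A quantum channel: a completely positive trace-preserving linear map between the spaces of
trace-class operators. Complete positivity: a block operator `[Tᵢⱼ]` that is positive on
`HA ⊕ ⋯ ⊕ HA` goes to a positive block operator `[Φ(Tᵢⱼ)]`. -/
structure Channel where
  map : TraceClass HA →ₗ[ℂ] TraceClass HB
  completelyPositive : ∀ (n : ℕ) (T : Fin n → Fin n → TraceClass HA),
    (∀ x : Fin n → HA, 0 ≤ ∑ i, ∑ j, ⟪x i, (T i j).toCLM (x j)⟫_ℂ) →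
    ∀ y : Fin n → HB, 0 ≤ ∑ i, ∑ j, ⟪y i, (map (T i j)).toCLM (y j)⟫_ℂ
  tracePreserving : ∀ T : TraceClass HA, trace (map T).toCLM = trace T.toCLM

namespace Channel

variable (Φ : Channel HA HB)

/-- The action of a channel on states. -/
def onState (ρ : State HA) : State HB :=
  ⟨Φ.map ρ.toTC, by
    have hρ := ρ.2.1
    rw [ContinuousLinearMap.isPositive_iff_complex] at hρ
    rw [ContinuousLinearMap.isPositive_iff_complex]
    have h := Φ.completelyPositive 1 (fun _ _ => ρ.toTC) (fun x => by
      obtain ⟨h1, h2⟩ := hρ (x 0)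
      have h3 : 0 ≤ ⟪ρ.1.toCLM (x 0), x 0⟫_ℂ := by
        rw [← h1]; exact_mod_cast h2
      have h4 : 0 ≤ starRingEnd ℂ _ := star_nonneg_iff.2 h3
      rw [inner_conj_symm] at h4
      simpa [State.toTC] using h4)
    intro y
    have h3 := h (fun _ => y)
    simp only [Fin.sum_univ_one] at h3
    have h4 : 0 ≤ starRingEnd ℂ _ := star_nonneg_iff.2 h3
    rw [inner_conj_symm] at h4
    obtain ⟨h5, h6⟩ := Complex.nonneg_iff.1 h4
    exact ⟨Complex.ext rfl (by simpa using h6), h5⟩,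
  (Φ.tracePreserving _).trans ρ.2.2⟩

/-- The energy-constrained Holevo capacity `C_χ(Φ, K, E)`: the supremum of the Holevo quantity of
the image `Φ(μ)` over the generalized input ensembles `μ` of average energy at most `E`. -/
def capacity (K : Hamiltonian HA) (E : ℝ≥0) : ℝ≥0∞ :=
  ⨆ (μ : Measure (State HA)) (_ : IsProbabilityMeasure μ)
    (_ : K.energy (averageState μ).toCLM ≤ E), holevoQuantity (μ.map Φ.onState)

/-- The output metric divergence `D(Φ|σ) = ½ sup ‖Φ(ρ) - σ‖₁` over the input states `ρ`. -/
def divergence (σ : State HB) : ℝ :=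
  1 / 2 * ⨆ ρ : State HA, ‖(Φ.onState ρ).toTC - σ.toTC‖

/-- `E_*`, the supremum of the output energy over the input states of energy at most `E`. -/
def maxOutputEnergy (KA : Hamiltonian HA) (KB : Hamiltonian HB) (E : ℝ≥0) : ℝ≥0∞ :=
  ⨆ (ρ : State HA) (_ : KA.energy ρ.op ≤ E), KB.energy (Φ.onState ρ).op

end Channel

/-- `g(p) = (p + 1) log (p + 1) - p log p`. -/
def gFun (p : ℝ) : ℝ := (p + 1) * Real.log (p + 1) - p * Real.log p

/-- The bound at the parameter `t`, with `Es = E_*`. -/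
def boundAt (F : ℝ → ℝ) (ε κ Es t : ℝ) : ℝ :=
  ε * ((1 + κ * t) / (1 - ε * t) + t) * F (Es / (ε * t)) + Real.binEntropy (ε * t)
    + gFun ((1 + κ * t) / (1 - ε * t) * ε)

namespace Channel

variable (Φ : Channel HA HB)

/-- The bound at `t` for the channel `Φ`, reference state `σ` and energy `E`:
`ε = D(Φ|σ)`, `κ = ½ (1 + E_B(σ) / E_*)`. -/
def capacityBoundAt (KA : Hamiltonian HA) (KB : Hamiltonian HB) (F : ℝ → ℝ) (σ : State HB)
    (E : ℝ≥0) (t : ℝ) : ℝ :=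
  boundAt F (Φ.divergence σ)
    (1 / 2 * (1 + (KB.energy σ.op).toReal / (Φ.maxOutputEnergy KA KB E).toReal))
    (Φ.maxOutputEnergy KA KB E).toReal t

/-- The infimum of the bound over `t ∈ (0, 1/(2ε)]`. -/
def capacityBound (KA : Hamiltonian HA) (KB : Hamiltonian HB) (F : ℝ → ℝ) (σ : State HB)
    (E : ℝ≥0) : ℝ :=
  sInf (Φ.capacityBoundAt KA KB F σ E '' Set.Ioc 0 (1 / (2 * Φ.divergence σ)))

/-- The bound optimized over the reference states `σ` of finite energy (with `D(Φ|σ) > 0`). -/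
def optimalCapacityBound (KA : Hamiltonian HA) (KB : Hamiltonian HB) (F : ℝ → ℝ) (E : ℝ≥0) : ℝ :=
  sInf ((fun σ => Φ.capacityBound KA KB F σ E) ''
    {σ : State HB | KB.energy σ.op ≠ ⊤ ∧ 0 < Φ.divergence σ})

end Channel

/-- The upper bound `g` for a nonnegative function `f` on `X` is tight: `sup_X f/g = 1`. -/
def IsTightOn {α : Type*} (X : Set α) (f g : α → ℝ) : Prop :=
  (∀ x ∈ X, 0 ≤ f x ∧ f x ≤ g x) ∧ IsLUB ((fun x => f x / g x) '' X) 1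

end Channels

section Oscillator

variable {ℓ : ℕ}

/-- The annihilation operator `aᵢ |n⟩ = √nᵢ |n - eᵢ⟩` on finite combinations of number states. -/
def annihilation (i : Fin ℓ) : ((Fin ℓ → ℕ) →₀ ℂ) →ₗ[ℂ] ((Fin ℓ → ℕ) →₀ ℂ) :=
  Finsupp.lsum ℂ fun n =>
    ((Real.sqrt (n i) : ℝ) : ℂ) • Finsupp.lsingle (n - Pi.single i 1)

/-- The creation operator `aᵢ⁺ |n⟩ = √(nᵢ + 1) |n + eᵢ⟩` on finite combinations of number
states. -/
def creation (i : Fin ℓ) : ((Fin ℓ → ℕ) →₀ ℂ) →ₗ[ℂ] ((Fin ℓ → ℕ) →₀ ℂ) :=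
  Finsupp.lsum ℂ fun n =>
    ((Real.sqrt (n i + 1) : ℝ) : ℂ) • Finsupp.lsingle (n + Pi.single i 1)

/-- `∑ᵢ ħ ωᵢ (aᵢ⁺ aᵢ + ½ I)` on finite combinations of number states. -/
def oscillatorOp (ħ : ℝ) (ω : Fin ℓ → ℝ) : ((Fin ℓ → ℕ) →₀ ℂ) →ₗ[ℂ] ((Fin ℓ → ℕ) →₀ ℂ) :=
  ∑ i, ((ħ * ω i : ℝ) : ℂ) • (creation i ∘ₗ annihilation i + (1 / 2 : ℂ) • LinearMap.id)

/-- `K` is the Hamiltonian `∑ᵢ ħ ωᵢ (aᵢ⁺ aᵢ + ½ I)` of the `ℓ`-mode quantum oscillator: in some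
orthonormal basis `|n⟩`, `n ∈ ℕ^ℓ`, of number states it is the self-adjoint operator that acts in
this way on the finite combinations of the `|n⟩` (these form a core, so `K` is determined). -/
def Hamiltonian.IsOscillator {H : Type*} [NormedAddCommGroup H] [InnerProductSpace ℂ H]
    [CompleteSpace H] (K : Hamiltonian H) (ħ : ℝ) (ω : Fin ℓ → ℝ) : Prop :=
  ∃ b : HilbertBasis (Fin ℓ → ℕ) ℂ H, ∀ x : (Fin ℓ → ℕ) →₀ ℂ,
    ∃ h : Finsupp.linearCombination ℂ b x ∈ K.op.domain,
      K.op ⟨_, h⟩ = Finsupp.linearCombination ℂ b (oscillatorOp ħ ω x)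

/-- `ℓ log ((E + E₀) / (ℓ Ê)) + ℓ` with `E₀ = ½ ∑ ħ ωᵢ` and `Ê = (∏ ħ ωᵢ)^(1/ℓ)`. -/
def oscillatorEntropyBound (ħ : ℝ) (ω : Fin ℓ → ℝ) (E : ℝ) : ℝ :=
  ℓ * Real.log ((E + 1 / 2 * ∑ i, ħ * ω i) / (ℓ * (∏ i, ħ * ω i) ^ (1 / (ℓ : ℝ)))) + ℓ

end Oscillator

end HolevoBound

end

open HolevoBound

noncomputable section

set_option linter.unusedSectionVars false

namespace HolevoBound

/-! ### Trace norm over infinite orthonormal systems, and compactness -/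

section Orthonormal

variable {H : Type*} [NormedAddCommGroup H] [InnerProductSpace ℂ H]

/-! Write H for the von Neumann entropy and η(x) = -x log x. Let ω be the average of an ensemble of
output states, all within trace distance ε of σ (with the factor 1/2). Formally the Holevo quantity
is H(ω) minus the mean output entropy, so one needs lower bounds for the output entropies whose
average cancels most of H(ω).

Cut the spectrum of ω at the energy M = E_*/(εt). The set J of eigenvectors of energy at most M
satisfies log |J| ≤ F(M), because the uniform state on J has energy at most M and entropy log |J|
(`log_card_le`). By Markov's inequality the other eigenvalues have total mass δ ≤ εt. Conditioned on
them, ω has energy at most E_*/δ, so they contribute at most δF(E_*/δ) + η(δ) ≤ εtF(M) + η(δ)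
(`tsum_negMulLog_tail_le`, `mul_div_le`).

The rest happens on the span W of J, of dimension d. Let R be the compression of an output state ρ
to W, with trace r, and S the normalized compression of σ; then Tr (R - rS)_+ ≤ ε
(`exists_reference`). For p > 0 and Ω = S + (p/d) I one has H(ρ) ≥ -Tr R log Ω - ε(log d + log(1+p)
- log p) (`ofReal_entropy_compression_le`, `IsEigen.le_entropy`). The right side is affine in ρ, so
averaging replaces R by the block of ω on W, and Klein's inequality compares the result with the
entropy of this block. With a = 1 - δ and p = ε/a the loss is ε log |J| + a g(ε/a) + η(a)
(`lintegral_relEntropy_le`). Finally η(δ) + η(a) ≤ h₂(εt), and the coefficient (1+κt)/(1-εt) is at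
least 1 and at least 1/(1-εt), which gives the stated bound.

The entropy inequality rests on one fact: adding the same positive C to both arguments does not
increase Tr(A log A - A log B + B - A) (`sum_klKernel_add_le`). This quantity is an integral over s
of suprema over Z of 2 Re Tr Z*(A-B) - Tr Z*AZ - s Tr ZBZ*, where C enters only with a negative
sign. Write R - rS = T - N with T, N ≥ 0 and apply the fact to R + N = T + rS against rΩ = (rp/d) I
+ rS.

The infimum is attained in infinite dimension because F is then unbounded, so the bound dominates a
quantity εF(E_*/(εt)) that diverges as t → 0.

For tightness take the channel ρ ↦ (1-ε)σ + ερ. A uniform ensemble of number states in a box with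
about E^ℓ points has outputs of uniformly bounded entropy, and gives capacity at least εℓ log E -
const (`log_le_capacity_mixChannel`). For fixed t the bound is at most ε((1+κt)/(1-εt) + t)ℓ log E +
const, and the coefficient tends to ε as t → 0. Hence the ratio tends to 1; the bound optimized over
reference states lies between the capacity and the bound for σ. -/

theorem tsum_enorm_inner_le_traceENorm (T : H →L[ℂ] H) {ι : Type*} {e f : ι → H}
    (he : Orthonormal ℂ e) (hf : Orthonormal ℂ f) :
    ∑' i, ‖⟪e i, T (f i)⟫_ℂ‖ₑ ≤ traceENorm T := by
  rw [ENNReal.tsum_eq_iSup_sum]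
  refine iSup_le fun s => ?_
  have g := s.equivFin.symm
  have h := le_traceENorm T (he.comp (fun i => (g i : ι)) (Subtype.val_injective.comp g.injective))
    (hf.comp (fun i => (g i : ι)) (Subtype.val_injective.comp g.injective))
  refine le_trans (le_of_eq ?_) h
  rw [← Finset.sum_coe_sort s]
  exact (Equiv.sum_comp g (fun i : s => ‖⟪e i, T (f i)⟫_ℂ‖ₑ)).symm

theorem orthonormal_option_elim {ι : Type*} {e : ι → H} (he : Orthonormal ℂ e) {x : H}
    (hx : ‖x‖ = 1) (h : ∀ i, ⟪e i, x⟫_ℂ = 0) :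
    Orthonormal ℂ (fun o : Option ι => o.elim x e) := by
  refine ⟨?_, ?_⟩
  · rintro (_ | i)
    · exact hx
    · exact he.1 i
  · rintro (_ | i) (_ | j) hij
    · exact absurd rfl hij
    · exact inner_eq_zero_symm.1 (h j)
    · exact h i
    · exact he.2 fun h' => hij (by rw [h'])

/-- A trace-class operator is compact. -/
theorem TraceClass.isCompactOperator [CompleteSpace H] (T : TraceClass H) :
    IsCompactOperator T.toCLM := by
  have key : ∀ η : ℝ, 0 < η → ∃ S : H →L[ℂ] H, IsCompactOperator S ∧ ‖T.toCLM - S‖ ≤ η := by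
    intro η hη
    by_cases h0 : traceENorm T.toCLM = 0
    · refine ⟨0, isCompactOperator_zero, ?_⟩
      have h1 := enorm_le_traceENorm T.toCLM
      rw [h0, nonpos_iff_eq_zero, enorm_eq_zero] at h1
      simp [h1, hη.le]
    -- Finite systems e, f that exhaust the trace norm up to η leave no room elsewhere: adjoining a
    -- unit vector orthogonal to e and one orthogonal to f shows that the matrix element between
    -- them is at most η.
    have hlt : traceENorm T.toCLM - ENNReal.ofReal η < traceENorm T.toCLM :=
      ENNReal.sub_lt_self T.traceENorm_ne_top h0 (by simpa using hη)
    unfold traceENorm at hlt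
    simp only [lt_iSup_iff] at hlt
    obtain ⟨n, e, f, he, hf, hlt⟩ := hlt
    change traceENorm T.toCLM - ENNReal.ofReal η < _ at hlt
    let U := Submodule.span ℂ (Set.range e)
    let V := Submodule.span ℂ (Set.range f)
    have hU : ∀ x ∈ Uᗮ, ∀ i, ⟪e i, x⟫_ℂ = 0 := fun x hx i =>
      Submodule.inner_right_of_mem_orthogonal (Submodule.subset_span (Set.mem_range_self i)) hx
    have hV : ∀ x ∈ Vᗮ, ∀ i, ⟪f i, x⟫_ℂ = 0 := fun x hx i =>
      Submodule.inner_right_of_mem_orthogonal (Submodule.subset_span (Set.mem_range_self i)) hx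
    have small1 : ∀ x ∈ Uᗮ, ∀ y ∈ Vᗮ, ‖x‖ = 1 → ‖y‖ = 1 → ‖⟪x, T.toCLM y⟫_ℂ‖ ≤ η := by
      intro x hx y hy hx1 hy1
      have h := tsum_enorm_inner_le_traceENorm T.toCLM (orthonormal_option_elim he hx1 (hU x hx))
        (orthonormal_option_elim hf hy1 (hV y hy))
      rw [tsum_fintype, Fintype.sum_option] at h
      simp only [Option.elim] at h
      have h2 : ‖⟪x, T.toCLM y⟫_ℂ‖ₑ + (traceENorm T.toCLM - ENNReal.ofReal η)
          ≤ traceENorm T.toCLM := le_trans (by gcongr) h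
      have h3 : ‖⟪x, T.toCLM y⟫_ℂ‖ₑ ≤ ENNReal.ofReal η := by
        by_contra hc
        push Not at hc
        have : traceENorm T.toCLM < ‖⟪x, T.toCLM y⟫_ℂ‖ₑ +
            (traceENorm T.toCLM - ENNReal.ofReal η) :=
          lt_of_le_of_lt le_add_tsub (ENNReal.add_lt_add_right
            (ENNReal.sub_ne_top T.traceENorm_ne_top) hc)
        exact absurd h2 (not_le.2 this)
      have := ENNReal.toReal_le_of_le_ofReal hη.le h3
      simpa using this
    have small : ∀ x ∈ Uᗮ, ∀ y ∈ Vᗮ, ‖⟪x, T.toCLM y⟫_ℂ‖ ≤ η * ‖x‖ * ‖y‖ := by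
      intro x hx y hy
      by_cases hx0 : x = 0
      · simp [hx0]
      by_cases hy0 : y = 0
      · simp [hy0]
      have hx' := norm_ne_zero_iff.2 hx0
      have hy' := norm_ne_zero_iff.2 hy0
      have h := small1 (((‖x‖⁻¹ : ℝ) : ℂ) • x) (Submodule.smul_mem _ _ hx)
        (((‖y‖⁻¹ : ℝ) : ℂ) • y) (Submodule.smul_mem _ _ hy)
        (by simp [norm_smul, hx']) (by simp [norm_smul, hy'])
      rw [map_smul, inner_smul_left, inner_smul_right, norm_mul, norm_mul] at h
      simp only [Complex.conj_ofReal, Complex.norm_real, norm_inv, norm_norm] at h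
      have h4 : ‖⟪x, T.toCLM y⟫_ℂ‖ = (‖x‖⁻¹ * (‖y‖⁻¹ * ‖⟪x, T.toCLM y⟫_ℂ‖)) * ‖x‖ * ‖y‖ := by
        field_simp
      rw [h4]
      gcongr
    have : FiniteDimensional ℂ U := FiniteDimensional.span_of_finite ℂ (Set.finite_range e)
    have : FiniteDimensional ℂ V := FiniteDimensional.span_of_finite ℂ (Set.finite_range f)
    have cpt : ∀ W : Submodule ℂ H, [FiniteDimensional ℂ W] →
        IsCompactOperator W.starProjection := by
      intro W _
      have hW : ProperSpace W := FiniteDimensional.proper ℂ W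
      have : IsCompactOperator (W.orthogonalProjectionOnto) :=
        isCompactOperator_of_locallyCompactSpace_dom _
      exact this.clm_comp W.subtypeL
    let P := U.starProjection
    let Q := V.starProjection
    -- The difference of T and this finite-rank operator is (1 - P)T(1 - Q), which only sees the
    -- small matrix elements.
    refine ⟨P ∘L T.toCLM + (T.toCLM - P ∘L T.toCLM) ∘L Q, ?_, ?_⟩
    · exact ((cpt U).comp_clm T.toCLM).add ((cpt V).clm_comp (T.toCLM - P ∘L T.toCLM))
    · refine ContinuousLinearMap.opNorm_le_bound _ hη.le fun y => ?_
      set y' := y - Q y with hy'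
      have hy'V : y' ∈ Vᗮ := V.sub_starProjection_mem_orthogonal y
      set x' := T.toCLM y' - P (T.toCLM y') with hx'
      have hx'U : x' ∈ Uᗮ := U.sub_starProjection_mem_orthogonal _
      have e1 : (T.toCLM - (P ∘L T.toCLM + (T.toCLM - P ∘L T.toCLM) ∘L Q)) y = x' := by
        simp only [hx', hy', sub_apply, add_apply, ContinuousLinearMap.comp_apply, map_sub]
        abel
      rw [e1]
      have e2 : ⟪x', T.toCLM y'⟫_ℂ = ⟪x', x'⟫_ℂ := by
        have : ⟪x', P (T.toCLM y')⟫_ℂ = 0 :=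
          Submodule.inner_left_of_mem_orthogonal (U.starProjection_apply_mem _) hx'U
        conv_rhs => rw [hx', inner_sub_right, ← hx', this, sub_zero]
      have h := small x' hx'U y' hy'V
      rw [e2, inner_self_eq_norm_sq_to_K] at h
      have h5 : ‖x'‖ ^ 2 ≤ η * ‖x'‖ * ‖y'‖ := by simpa using h
      have h6 : ‖y'‖ ≤ ‖y‖ := by
        have := Vᗮ.norm_starProjection_apply_le y
        rw [Submodule.starProjection_orthogonal_val] at this
        simpa using this
      by_cases hx0 : ‖x'‖ = 0
      · rw [hx0]; positivity
      have hpos : 0 < ‖x'‖ := lt_of_le_of_ne (norm_nonneg _) (Ne.symm hx0)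
      have h7 : ‖x'‖ ≤ η * ‖y'‖ := by
        have : ‖x'‖ * ‖x'‖ ≤ ‖x'‖ * (η * ‖y'‖) := by nlinarith
        exact le_of_mul_le_mul_left this hpos
      exact h7.trans (by gcongr)
  choose S hS1 hS2 using fun n : ℕ => key (1 / ((n : ℝ) + 1)) (by positivity)
  refine isCompactOperator_of_tendsto (F := S) (l := atTop) ?_ (Eventually.of_forall hS1)
  rw [tendsto_iff_norm_sub_tendsto_zero]
  refine squeeze_zero (fun _ => norm_nonneg _) (fun n => ?_) tendsto_one_div_add_atTop_nhds_zero_nat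
  rw [norm_sub_rev]; exact hS2 n

end Orthonormal

/-! ### Eigenbases and diagonal operators -/

section Diagonal

variable {H : Type*} [NormedAddCommGroup H] [InnerProductSpace ℂ H]

/-- The operator `T` is diagonal in the basis `b`, with real eigenvalues `x`. -/
def IsDiag {ι : Type*} (T : H →L[ℂ] H) (b : HilbertBasis ι ℂ H) (x : ι → ℝ) : Prop :=
  ∀ i, T (b i) = (x i : ℂ) • b i

/-- The union of Hilbert bases of all eigenspaces, the kernel included: for a compact symmetric
operator these are pairwise orthogonal and have no common nonzero orthogonal vector. -/
theorem exists_isEigenbasis [CompleteSpace H] {T : H →L[ℂ] H} (hc : IsCompactOperator T)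
    (hT : (T : H →ₗ[ℂ] H).IsSymmetric) : ∃ w, IsEigenbasis T w := by
  let V : ℂ → Submodule ℂ H := fun μ => Module.End.eigenspace (T : H →ₗ[ℂ] H) μ
  have hVmem : ∀ μ v, v ∈ V μ ↔ T v = μ • v := fun μ v => Module.End.mem_eigenspace_iff
  have hVcl : ∀ μ, IsClosed (V μ : Set H) := by
    intro μ
    have : (V μ : Set H) = {v | T v = μ • v} := by ext v; exact hVmem μ v
    rw [this]
    exact isClosed_eq T.continuous (continuous_const_smul μ)
  have hcomp : ∀ μ, CompleteSpace (V μ) := fun μ => (hVcl μ).completeSpace_coe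
  have hex : ∀ μ, ∃ (s : Set (V μ)) (b : HilbertBasis s ℂ (V μ)), ⇑b = ((↑) : s → V μ) :=
    fun μ => exists_hilbertBasis ℂ (V μ)
  choose s b hb using hex
  have hs : ∀ μ, Orthonormal ℂ ((↑) : s μ → V μ) := fun μ => hb μ ▸ (b μ).orthonormal
  let w : Set H := ⋃ μ, ((↑) : V μ → H) '' s μ
  have hw : ∀ v ∈ w, ∃ μ, ∃ h : v ∈ V μ, (⟨v, h⟩ : V μ) ∈ s μ := by
    intro v hv
    obtain ⟨μ, y, hy, rfl⟩ := Set.mem_iUnion.1 hv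
    exact ⟨μ, y.2, hy⟩
  have hunit : ∀ v ∈ w, ‖v‖ = 1 := by
    intro v hv
    obtain ⟨μ, h, hvs⟩ := hw v hv
    exact (hs μ).1 ⟨⟨v, h⟩, hvs⟩
  have hon : Orthonormal ℂ ((↑) : w → H) := by
    refine ⟨fun v => hunit v v.2, ?_⟩
    rintro ⟨u, hu⟩ ⟨v, hv⟩ huv
    obtain ⟨μ, h, hus⟩ := hw u hu
    obtain ⟨ν, h', hvs⟩ := hw v hv
    by_cases hμν : μ = ν
    · subst hμν
      have := (hs μ).2 (i := ⟨⟨u, h⟩, hus⟩) (j := ⟨⟨v, h'⟩, hvs⟩)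
        (fun hh => huv (by simpa using hh))
      simpa using this
    · exact hT.orthogonalFamily_eigenspaces hμν ⟨u, h⟩ ⟨v, h'⟩
  refine ⟨w, hon, ?_, ?_⟩
  · rw [Submodule.topologicalClosure_eq_top_iff]
    have hbot := ContinuousLinearMap.orthogonalComplement_iSup_eigenspaces_eq_bot hc hT
    refine le_bot_iff.1 (le_trans ?_ hbot.le)
    rw [← Submodule.orthogonal_closure (Submodule.span ℂ w)]
    refine Submodule.orthogonal_le (iSup_le fun μ => ?_)
    intro v hv
    have hmem := (b μ).dense_span
    have h1 : (⟨v, hv⟩ : V μ) ∈ closure (Submodule.span ℂ (Set.range (b μ)) : Set (V μ)) := by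
      rw [← Submodule.topologicalClosure_coe, hmem]; trivial
    have h2 : v ∈ closure (((↑) : V μ → H) '' (Submodule.span ℂ (Set.range (b μ)) : Set (V μ))) :=
      image_closure_subset_closure_image continuous_subtype_val ⟨_, h1, rfl⟩
    rw [← SetLike.mem_coe, Submodule.topologicalClosure_coe]
    refine closure_mono ?_ h2
    rintro _ ⟨y, hy, rfl⟩
    have h3 : (y : H) ∈ (Submodule.span ℂ (Set.range (b μ))).map (V μ).subtype := ⟨y, hy, rfl⟩
    rw [Submodule.map_span] at h3
    refine Submodule.span_mono ?_ h3
    rintro _ ⟨_, ⟨i, rfl⟩, rfl⟩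
    refine Set.mem_iUnion.2 ⟨μ, i, i.2, ?_⟩
    rw [hb μ]; rfl
  · intro v hv
    obtain ⟨μ, h, -⟩ := hw v hv
    have h1 := (hVmem μ v).1 h
    rw [h1, inner_smul_right, inner_self_eq_norm_sq_to_K, hunit v hv]
    simp

namespace IsEigenbasis

variable [CompleteSpace H] {T : H →L[ℂ] H} {w : Set H}

/-- An eigenbasis as a Hilbert basis. -/
def basis (h : IsEigenbasis T w) : HilbertBasis w ℂ H :=
  HilbertBasis.mk h.1 (by rw [Subtype.range_coe]; exact h.2.1.ge)

@[simp] theorem basis_apply (h : IsEigenbasis T w) (v : w) : h.basis v = v := by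
  rw [basis, HilbertBasis.coe_mk]

theorem isDiag (h : IsEigenbasis T w) (hT : (T : H →ₗ[ℂ] H).IsSymmetric) :
    IsDiag T h.basis (fun v => (⟪(v : H), T v⟫_ℂ).re) := by
  intro v
  rw [basis_apply]
  conv_lhs => rw [h.2.2 v v.2]
  congr 1
  refine Complex.ext (by simp) ?_
  have h1 : ⟪T v, (v : H)⟫_ℂ = ⟪(v : H), T v⟫_ℂ := hT v v
  have h2 := hT.im_inner_apply_self (v : H)
  have h3 : (⟪T v, (v : H)⟫_ℂ).im = 0 := by simpa using h2
  rw [← h1]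
  simpa using h3

end IsEigenbasis

theorem _root_.HilbertBasis.isEigenbasis_range [CompleteSpace H] {ι : Type*} {T : H →L[ℂ] H}
    (b : HilbertBasis ι ℂ H) {x : ι → ℝ} (h : IsDiag T b x) : IsEigenbasis T (Set.range b) := by
  refine ⟨b.orthonormal.toSubtypeRange, ?_, ?_⟩
  · exact b.dense_span
  · rintro _ ⟨i, rfl⟩
    rw [h i, inner_smul_right, inner_self_eq_norm_sq_to_K, b.orthonormal.1 i]
    simp

theorem inner_mul_inner_swap (u v : H) : ⟪u, v⟫_ℂ * ⟪v, u⟫_ℂ = ((‖⟪v, u⟫_ℂ‖ ^ 2 : ℝ) : ℂ) := by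
  rw [← inner_conj_symm u v, Complex.conj_mul']; norm_cast

theorem hasSum_norm_inner_sq {ι : Type*} (b : HilbertBasis ι ℂ H) (y : H) :
    HasSum (fun i => ‖⟪b i, y⟫_ℂ‖ ^ 2) (‖y‖ ^ 2) := by
  have := Complex.hasSum_re (b.hasSum_inner_mul_inner y y)
  convert this using 1
  · ext i
    rw [inner_mul_inner_swap, Complex.ofReal_re]
  · rw [inner_self_eq_norm_sq_to_K]; norm_cast

theorem tsum_enorm_inner_sq {ι : Type*} (b : HilbertBasis ι ℂ H) (y : H) :
    ∑' i, ‖⟪b i, y⟫_ℂ‖ₑ ^ 2 = ‖y‖ₑ ^ 2 := by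
  have h2 := hasSum_norm_inner_sq b y
  have h3 : ∀ z : ℝ, 0 ≤ z → ENNReal.ofReal (z ^ 2) = ENNReal.ofReal z ^ 2 := fun z hz =>
    ENNReal.ofReal_pow hz 2
  calc ∑' i, ‖⟪b i, y⟫_ℂ‖ₑ ^ 2 = ∑' i, ENNReal.ofReal (‖⟪b i, y⟫_ℂ‖ ^ 2) := by
        simp_rw [h3 _ (norm_nonneg _), ofReal_norm]
    _ = ENNReal.ofReal (‖y‖ ^ 2) := by
        rw [← ENNReal.ofReal_tsum_of_nonneg (fun i => by positivity) h2.summable, h2.tsum_eq]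
    _ = _ := by rw [h3 _ (norm_nonneg _), ofReal_norm]

namespace IsDiag

variable {ι : Type*} {T : H →L[ℂ] H} {b : HilbertBasis ι ℂ H} {x : ι → ℝ}

theorem inner_apply (h : IsDiag T b x) (hT : (T : H →ₗ[ℂ] H).IsSymmetric) (i : ι) (y : H) :
    ⟪b i, T y⟫_ℂ = x i * ⟪b i, y⟫_ℂ := by
  have h1 : ⟪T (b i), y⟫_ℂ = ⟪b i, T y⟫_ℂ := hT _ _
  rw [← h1, h i, inner_smul_left, Complex.conj_ofReal]

theorem inner_self (h : IsDiag T b x) (i : ι) : ⟪b i, T (b i)⟫_ℂ = x i := by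
  rw [h i, inner_smul_right, inner_self_eq_norm_sq_to_K, b.orthonormal.1 i]; simp

theorem nonneg (h : IsDiag T b x) (hT : T.IsPositive) (i : ι) : 0 ≤ x i := by
  have := hT.re_inner_nonneg_right (b i)
  rw [h.inner_self] at this
  simpa using this

theorem hasSum_inner_apply (h : IsDiag T b x) (hT : (T : H →ₗ[ℂ] H).IsSymmetric) (y : H) :
    HasSum (fun i => x i * ‖⟪b i, y⟫_ℂ‖ ^ 2) (⟪y, T y⟫_ℂ).re := by
  have := Complex.hasSum_re (b.hasSum_inner_mul_inner y (T y))
  convert this using 1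
  ext i
  rw [h.inner_apply hT, mul_left_comm, inner_mul_inner_swap]
  norm_cast

theorem ofReal_inner_apply (h : IsDiag T b x) (hT : T.IsPositive) (y : H) :
    ENNReal.ofReal (⟪y, T y⟫_ℂ).re = ∑' i, ENNReal.ofReal (x i) * ‖⟪b i, y⟫_ℂ‖ₑ ^ 2 := by
  have h1 := h.hasSum_inner_apply hT.isSymmetric y
  rw [← h1.tsum_eq, ENNReal.ofReal_tsum_of_nonneg (fun i => mul_nonneg (h.nonneg hT i)
    (by positivity)) h1.summable]
  refine tsum_congr fun i => ?_
  rw [ENNReal.ofReal_mul (h.nonneg hT i), ENNReal.ofReal_pow (norm_nonneg _), ofReal_norm]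

/-- The trace of a positive diagonal operator, computed in another basis. -/
theorem tsum_ofReal_inner (h : IsDiag T b x) (hT : T.IsPositive) {κ : Type*}
    (c : HilbertBasis κ ℂ H) :
    ∑' k, ENNReal.ofReal (⟪c k, T (c k)⟫_ℂ).re = ∑' i, ENNReal.ofReal (x i) := by
  simp_rw [h.ofReal_inner_apply hT]
  rw [ENNReal.tsum_comm]
  refine tsum_congr fun i => ?_
  rw [ENNReal.tsum_mul_left]
  have : ∑' k, ‖⟪b i, c k⟫_ℂ‖ₑ ^ 2 = 1 := by
    have h1 := tsum_enorm_inner_sq c (b i)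
    simp_rw [← inner_conj_symm (b i) (c _)]
    have h2 : ‖b i‖ₑ = 1 := by rw [← ofReal_norm, b.orthonormal.1 i]; simp
    rw [h2, one_pow] at h1
    rw [← h1]
    refine tsum_congr fun k => ?_
    rw [← ofReal_norm, ← ofReal_norm, RCLike.norm_conj]
  rw [this, mul_one]

end IsDiag

end Diagonal

/-! ### Traces and spectral series of trace-class operators -/

section TraceClassAnalysis

variable {H : Type*} [NormedAddCommGroup H] [InnerProductSpace ℂ H]

namespace TraceClass

theorem tsum_norm_inner_le (T : TraceClass H) {ι : Type*} {e f : ι → H} (he : Orthonormal ℂ e)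
    (hf : Orthonormal ℂ f) :
    Summable (fun i => ‖⟪e i, T.toCLM (f i)⟫_ℂ‖) ∧ ∑' i, ‖⟪e i, T.toCLM (f i)⟫_ℂ‖ ≤ ‖T‖ := by
  have h := tsum_enorm_inner_le_traceENorm T.toCLM he hf
  have hne : ∑' i, ‖⟪e i, T.toCLM (f i)⟫_ℂ‖ₑ ≠ ⊤ := ne_top_of_le_ne_top T.traceENorm_ne_top h
  refine ⟨?_, ?_⟩
  · simpa using ENNReal.summable_toReal hne
  · rw [norm_def]
    have := (ENNReal.toReal_le_toReal hne T.traceENorm_ne_top).2 h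
    rwa [ENNReal.tsum_toReal_eq (fun _ => enorm_ne_top)] at this

/-- Cauchy–Schwarz followed by Bessel's inequality for both systems. -/
theorem traceENorm_rankOne_le (u v : H) :
    traceENorm (InnerProductSpace.rankOne ℂ u v) ≤ ENNReal.ofReal (‖u‖ * ‖v‖) := by
  refine traceENorm_le fun n e f he hf => ?_
  have h1 : ∑ i, ‖⟪e i, InnerProductSpace.rankOne ℂ u v (f i)⟫_ℂ‖ ≤ ‖u‖ * ‖v‖ := by
    have hb : ∀ i, ‖⟪e i, InnerProductSpace.rankOne ℂ u v (f i)⟫_ℂ‖ =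
        ‖⟪e i, u⟫_ℂ‖ * ‖⟪f i, v⟫_ℂ‖ := by
      intro i
      rw [InnerProductSpace.rankOne_apply, inner_smul_right, norm_mul, mul_comm,
        norm_inner_symm v (f i)]
    simp_rw [hb]
    have hu : ∑ i, ‖⟪e i, u⟫_ℂ‖ ^ 2 ≤ ‖u‖ ^ 2 := he.sum_inner_products_le u
    have hv : ∑ i, ‖⟪f i, v⟫_ℂ‖ ^ 2 ≤ ‖v‖ ^ 2 := hf.sum_inner_products_le v
    refine abs_le_of_sq_le_sq' ?_ (by positivity) |>.2
    refine (Finset.sum_mul_sq_le_sq_mul_sq _ _ _).trans ?_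
    rw [mul_pow]
    gcongr
  calc _ = ENNReal.ofReal (∑ i, ‖⟪e i, InnerProductSpace.rankOne ℂ u v (f i)⟫_ℂ‖) := by
        rw [ENNReal.ofReal_sum_of_nonneg (fun _ _ => norm_nonneg _)]
        simp_rw [ofReal_norm]
    _ ≤ _ := ENNReal.ofReal_le_ofReal h1

/-- The operator `|u⟩⟨v|` as a trace-class operator. -/
def rankOne (u v : H) : TraceClass H :=
  ⟨InnerProductSpace.rankOne ℂ u v, (traceENorm_rankOne_le u v).trans_lt ENNReal.ofReal_lt_top⟩

@[simp] theorem toCLM_rankOne (u v : H) :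
    (rankOne u v).toCLM = InnerProductSpace.rankOne ℂ u v := rfl

theorem norm_rankOne_le (u v : H) : ‖rankOne u v‖ ≤ ‖u‖ * ‖v‖ := by
  rw [norm_def]
  exact ENNReal.toReal_le_of_le_ofReal (by positivity) (traceENorm_rankOne_le u v)

/-- The inclusion into bounded operators as a continuous linear map. -/
def toCLML : TraceClass H →L[ℂ] (H →L[ℂ] H) :=
  LinearMap.mkContinuous toCLM 1 (fun T => by rw [one_mul]; exact opNorm_le T)

@[simp] theorem toCLML_apply (T : TraceClass H) : toCLML T = T.toCLM := rfl

/-- The functional `T ↦ ⟨x, T y⟩`. -/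
def matrixElem (x y : H) : TraceClass H →L[ℂ] ℂ :=
  (innerSL ℂ x) ∘L (ContinuousLinearMap.apply ℂ H y) ∘L toCLML

@[simp] theorem matrixElem_apply (x y : H) (T : TraceClass H) :
    matrixElem x y T = ⟪x, T.toCLM y⟫_ℂ := rfl

/-- The trace in a given orthonormal basis as a continuous functional. -/
def traceOn {ι : Type*} (b : HilbertBasis ι ℂ H) : TraceClass H →L[ℂ] ℂ :=
  LinearMap.mkContinuous
    { toFun := fun T => ∑' i, ⟪b i, T.toCLM (b i)⟫_ℂ
      map_add' := fun S T => by
        simp only [map_add, add_apply, inner_add_right]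
        exact (S.tsum_norm_inner_le b.orthonormal b.orthonormal).1.of_norm.tsum_add
          (T.tsum_norm_inner_le b.orthonormal b.orthonormal).1.of_norm
      map_smul' := fun c T => by
        simp only [map_smul, smul_apply, inner_smul_right, tsum_mul_left, RingHom.id_apply,
          smul_eq_mul] }
    1 (fun T => by
      rw [one_mul]
      have h := T.tsum_norm_inner_le b.orthonormal b.orthonormal
      exact (norm_tsum_le_tsum_norm h.1).trans h.2)

theorem traceOn_apply {ι : Type*} (b : HilbertBasis ι ℂ H) (T : TraceClass H) :
    traceOn b T = ∑' i, ⟪b i, T.toCLM (b i)⟫_ℂ := rfl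

theorem hasSum_traceOn {ι : Type*} (b : HilbertBasis ι ℂ H) (T : TraceClass H) :
    HasSum (fun i => ⟪b i, T.toCLM (b i)⟫_ℂ) (traceOn b T) :=
  (T.tsum_norm_inner_le b.orthonormal b.orthonormal).1.of_norm.hasSum

theorem trace_eq_traceOn [CompleteSpace H] (T : TraceClass H) :
    trace T.toCLM = traceOn (stdBasis H) T := rfl

theorem traceOn_rankOne {ι : Type*} (b : HilbertBasis ι ℂ H) (u v : H) :
    traceOn b (rankOne u v) = ⟪v, u⟫_ℂ := by
  rw [traceOn_apply, ← b.tsum_inner_mul_inner v u]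
  refine tsum_congr fun i => ?_
  rw [toCLM_rankOne, InnerProductSpace.rankOne_apply, inner_smul_right]

variable [CompleteSpace H]

section Diag

variable {ι : Type*} {b : HilbertBasis ι ℂ H} {x : ι → ℝ}

theorem summable_diag (b : HilbertBasis ι ℂ H) (hx : Summable fun i => |x i|) :
    Summable fun i => (x i : ℂ) • rankOne (b i) (b i) := by
  refine Summable.of_norm_bounded hx fun i => ?_
  rw [norm_smul, Complex.norm_real, Real.norm_eq_abs]
  have := norm_rankOne_le (b i) (b i)
  rw [b.orthonormal.1 i, one_mul] at this
  exact mul_le_of_le_one_right (abs_nonneg _) this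

/-- The operator with eigenvalues `x` in the basis `b`. -/
def diag (b : HilbertBasis ι ℂ H) (x : ι → ℝ) : TraceClass H :=
  ∑' i, (x i : ℂ) • rankOne (b i) (b i)

theorem hasSum_diag (b : HilbertBasis ι ℂ H) (hx : Summable fun i => |x i|) :
    HasSum (fun i => (x i : ℂ) • rankOne (b i) (b i)) (diag b x) :=
  (summable_diag b hx).hasSum

theorem hasSum_inner_diag (b : HilbertBasis ι ℂ H) (hx : Summable fun i => |x i|) (y z : H) :
    HasSum (fun i => (x i : ℂ) * (⟪y, b i⟫_ℂ * ⟪b i, z⟫_ℂ)) ⟪y, (diag b x).toCLM z⟫_ℂ := by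
  have h := (matrixElem y z).hasSum (hasSum_diag b hx)
  rw [matrixElem_apply] at h
  convert h using 1
  ext i
  simp [mul_comm]

theorem isDiag_diag (b : HilbertBasis ι ℂ H) (hx : Summable fun i => |x i|) :
    IsDiag (diag b x).toCLM b x := by
  classical
  intro j
  refine ext_inner_left ℂ fun y => ?_
  refine (hasSum_inner_diag b hx y (b j)).unique ?_
  rw [inner_smul_right]
  convert hasSum_ite_eq j ((x j : ℂ) * ⟪y, b j⟫_ℂ) using 2 with i
  rw [orthonormal_iff_ite.1 b.orthonormal i j]
  split_ifs with h
  · rw [h, mul_one]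
  · simp

theorem isSymmetric_diag (b : HilbertBasis ι ℂ H) (hx : Summable fun i => |x i|) :
    ((diag b x).toCLM : H →ₗ[ℂ] H).IsSymmetric := by
  intro y z
  have h1 := hasSum_inner_diag b hx z y
  have h2 := hasSum_inner_diag b hx y z
  have h3 := h1.map (starRingEnd ℂ).toAddMonoidHom Complex.continuous_conj
  have h4 : (starRingEnd ℂ) ⟪z, (diag b x).toCLM y⟫_ℂ = ⟪(diag b x).toCLM y, z⟫_ℂ :=
    inner_conj_symm _ _
  rw [ContinuousLinearMap.coe_coe, ← h4]
  refine h3.unique ?_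
  convert h2 using 1
  ext i
  simp only [Function.comp_apply, RingHom.toAddMonoidHom_eq_coe, AddMonoidHom.coe_coe, map_mul,
    Complex.conj_ofReal, inner_conj_symm]
  ring

theorem isPositive_diag (b : HilbertBasis ι ℂ H) (hx : Summable fun i => |x i|)
    (h0 : ∀ i, 0 ≤ x i) : (diag b x).toCLM.IsPositive := by
  refine ⟨isSymmetric_diag b hx, fun y => ?_⟩
  rw [ContinuousLinearMap.reApplyInnerSelf_apply, inner_re_symm]
  exact ((isDiag_diag b hx).hasSum_inner_apply (isSymmetric_diag b hx) y).nonneg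
    fun i => mul_nonneg (h0 i) (by positivity)

theorem summable_abs_of_isDiag {T : TraceClass H} (h : IsDiag T.toCLM b x) :
    Summable (fun i => |x i|) ∧ ∑' i, |x i| ≤ ‖T‖ := by
  have h1 := T.tsum_norm_inner_le b.orthonormal b.orthonormal
  simpa only [h.inner_self, Complex.norm_real, Real.norm_eq_abs] using h1

/-- The gain is that T becomes a series convergent in trace norm, so that continuous functionals can
be evaluated eigenvalue by eigenvalue. -/
theorem eq_diag {T : TraceClass H} (h : IsDiag T.toCLM b x) : T = diag b x := by
  apply toCLM_injective
  refine ContinuousLinearMap.ext_on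
    (Submodule.dense_iff_topologicalClosure_eq_top.2 b.dense_span) ?_
  rintro _ ⟨i, rfl⟩
  rw [h i, isDiag_diag b (summable_abs_of_isDiag h).1 i]

theorem traceOn_of_isDiag {T : TraceClass H} (h : IsDiag T.toCLM b x) {κ : Type*}
    (c : HilbertBasis κ ℂ H) : traceOn c T = (∑' i, x i : ℝ) := by
  have h1 := (traceOn c).hasSum (hasSum_diag b (summable_abs_of_isDiag h).1)
  rw [← eq_diag h] at h1
  rw [Complex.ofReal_tsum, ← h1.tsum_eq]
  refine tsum_congr fun i => ?_
  rw [map_smul, traceOn_rankOne, inner_self_eq_norm_sq_to_K, b.orthonormal.1 i]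
  simp

theorem norm_le_of_isDiag {T : TraceClass H} (h : IsDiag T.toCLM b x) :
    ‖T‖ ≤ ∑' i, |x i| := by
  have hx := (summable_abs_of_isDiag h).1
  conv_lhs => rw [eq_diag h]
  have h2 : ∀ i, ‖(x i : ℂ) • rankOne (b i) (b i)‖ ≤ |x i| := fun i => by
    rw [norm_smul, Complex.norm_real, Real.norm_eq_abs]
    have := norm_rankOne_le (b i) (b i)
    rw [b.orthonormal.1 i, one_mul] at this
    exact mul_le_of_le_one_right (abs_nonneg _) this
  exact tsum_of_norm_bounded hx.hasSum h2

/-- The series of the operators xᵢ |B bᵢ⟩⟨bᵢ| converges to BT in trace norm, and the trace is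
continuous there. -/
theorem hasSum_trace_comp {T : TraceClass H} (h : IsDiag T.toCLM b x) (B : H →L[ℂ] H) :
    HasSum (fun i => (x i : ℂ) * ⟪b i, B (b i)⟫_ℂ) (trace (B ∘L T.toCLM)) := by
  have hx := (summable_abs_of_isDiag h).1
  have hs : Summable fun i => (x i : ℂ) • rankOne (B (b i)) (b i) := by
    refine Summable.of_norm_bounded (hx.mul_right ‖B‖) fun i => ?_
    rw [norm_smul, Complex.norm_real, Real.norm_eq_abs]
    have h1 := norm_rankOne_le (B (b i)) (b i)
    have h2 := B.le_opNorm (b i)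
    rw [b.orthonormal.1 i, mul_one] at h1 h2
    gcongr
    exact h1.trans h2
  have e1 : (∑' i, (x i : ℂ) • rankOne (B (b i)) (b i)).toCLM = B ∘L T.toCLM := by
    have h3 := toCLML.hasSum hs.hasSum
    have h4 := (ContinuousLinearMap.compL ℂ H H H B).hasSum
      (toCLML.hasSum (hasSum_diag b hx))
    rw [← eq_diag h, ContinuousLinearMap.compL_apply, toCLML_apply] at h4
    refine h3.unique ?_
    convert h4 using 1
    ext i y
    simp
  have h5 := (traceOn (stdBasis H)).hasSum hs.hasSum
  rw [← trace_eq_traceOn, e1] at h5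
  convert h5 using 1
  ext i
  rw [map_smul, traceOn_rankOne, smul_eq_mul]

end Diag

theorem exists_isDiag (T : TraceClass H) (hT : (T.toCLM : H →ₗ[ℂ] H).IsSymmetric) :
    ∃ (w : Set H) (h : IsEigenbasis T.toCLM w),
      IsDiag T.toCLM h.basis (fun v => (⟪(v : H), T.toCLM v⟫_ℂ).re) := by
  obtain ⟨w, h⟩ := exists_isEigenbasis T.isCompactOperator hT
  exact ⟨w, h, h.isDiag hT⟩

/-- The trace does not depend on the basis. -/
theorem traceOn_eq_trace {T : TraceClass H} (hT : (T.toCLM : H →ₗ[ℂ] H).IsSymmetric) {κ : Type*}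
    (c : HilbertBasis κ ℂ H) : traceOn c T = trace T.toCLM := by
  obtain ⟨w, h, hd⟩ := T.exists_isDiag hT
  rw [trace_eq_traceOn, traceOn_of_isDiag hd, traceOn_of_isDiag hd]

theorem norm_le_trace {T : TraceClass H} (hT : T.toCLM.IsPositive) :
    ‖T‖ ≤ (trace T.toCLM).re := by
  obtain ⟨w, h, hd⟩ := T.exists_isDiag hT.isSymmetric
  rw [trace_eq_traceOn, traceOn_of_isDiag hd, Complex.ofReal_re]
  refine (norm_le_of_isDiag hd).trans (le_of_eq ?_)
  exact tsum_congr fun i => abs_of_nonneg (hd.nonneg hT i)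

/-- The adjoint of a trace-class operator. -/
theorem exists_adjoint (T : TraceClass H) :
    ∃ S : TraceClass H, S.toCLM = ContinuousLinearMap.adjoint T.toCLM ∧ ‖S‖ ≤ ‖T‖ := by
  have h : traceENorm (ContinuousLinearMap.adjoint T.toCLM) ≤ traceENorm T.toCLM := by
    refine traceENorm_le fun n e f he hf => ?_
    refine le_trans (le_of_eq ?_) (le_traceENorm T.toCLM hf he)
    refine Finset.sum_congr rfl fun i _ => ?_
    rw [ContinuousLinearMap.adjoint_inner_right, ← ofReal_norm, ← ofReal_norm, norm_inner_symm]
  refine ⟨⟨ContinuousLinearMap.adjoint T.toCLM,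
    h.trans_lt (lt_top_iff_ne_top.2 T.traceENorm_ne_top)⟩, rfl, ?_⟩
  exact (ENNReal.toReal_le_toReal (ne_top_of_le_ne_top T.traceENorm_ne_top h)
    T.traceENorm_ne_top).2 h

end TraceClass

end TraceClassAnalysis

/-! ### States: eigenvalues, separability, means of random states -/

section StateLemmas

variable {H : Type*} [NormedAddCommGroup H] [InnerProductSpace ℂ H]

theorem isPositive_of_inner_nonneg {T : H →L[ℂ] H} (h : ∀ y, 0 ≤ ⟪y, T y⟫_ℂ) : T.IsPositive := by
  rw [ContinuousLinearMap.isPositive_iff_complex]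
  intro y
  have h4 : 0 ≤ starRingEnd ℂ ⟪y, T y⟫_ℂ := star_nonneg_iff.2 (h y)
  rw [inner_conj_symm] at h4
  obtain ⟨h5, h6⟩ := Complex.nonneg_iff.1 h4
  exact ⟨Complex.ext rfl (by simpa using h6), h5⟩

theorem inner_nonneg_of_isPositive {T : H →L[ℂ] H} (h : T.IsPositive) (y : H) :
    0 ≤ ⟪y, T y⟫_ℂ := by
  rw [ContinuousLinearMap.isPositive_iff_complex] at h
  obtain ⟨h1, h2⟩ := h y
  have h3 : 0 ≤ ⟪T y, y⟫_ℂ := by rw [← h1]; exact_mod_cast h2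
  have h4 : 0 ≤ starRingEnd ℂ _ := star_nonneg_iff.2 h3
  rwa [inner_conj_symm] at h4

variable [CompleteSpace H]

namespace State

variable (ρ : State H)

theorem isPositive : ρ.op.IsPositive := ρ.2.1

theorem trace_op : trace ρ.op = 1 := ρ.2.2

theorem toCLM_toTC : ρ.toTC.toCLM = ρ.op := rfl

theorem norm_toTC_le : ‖ρ.toTC‖ ≤ 1 := by
  have := TraceClass.norm_le_trace (T := ρ.toTC) ρ.isPositive
  rwa [toCLM_toTC, ρ.trace_op, Complex.one_re] at this

theorem continuous_toTC : Continuous (toTC : State H → TraceClass H) := continuous_subtype_val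

theorem hasSum_inner {κ : Type*} (c : HilbertBasis κ ℂ H) :
    HasSum (fun k => (⟪c k, ρ.op (c k)⟫_ℂ).re) 1 := by
  have h := Complex.hasSum_re (ρ.toTC.hasSum_traceOn c)
  rwa [TraceClass.traceOn_eq_trace ρ.isPositive.isSymmetric, toCLM_toTC, ρ.trace_op] at h

theorem re_inner_nonneg (y : H) : 0 ≤ (⟪y, ρ.op y⟫_ℂ).re :=
  (Complex.nonneg_iff.1 (inner_nonneg_of_isPositive ρ.isPositive y)).1

theorem tsum_ofReal_inner {κ : Type*} (c : HilbertBasis κ ℂ H) :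
    ∑' k, ENNReal.ofReal (⟪c k, ρ.op (c k)⟫_ℂ).re = 1 := by
  have h := ρ.hasSum_inner c
  rw [← ENNReal.ofReal_tsum_of_nonneg (fun k => ρ.re_inner_nonneg _) h.summable, h.tsum_eq,
    ENNReal.ofReal_one]

variable {ρ}

theorem hasSum_eigenvalues {ι : Type*} {b : HilbertBasis ι ℂ H} {x : ι → ℝ}
    (h : IsDiag ρ.op b x) : HasSum x 1 := by
  have := ρ.hasSum_inner b
  simpa only [h.inner_self, Complex.ofReal_re] using this

theorem eigenvalue_le_one {ι : Type*} {b : HilbertBasis ι ℂ H} {x : ι → ℝ}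
    (h : IsDiag ρ.op b x) (i : ι) : x i ≤ 1 :=
  le_hasSum (hasSum_eigenvalues h) i fun j _ => h.nonneg ρ.isPositive j

variable (ρ) in
theorem exists_isDiag : ∃ (w : Set H) (h : IsEigenbasis ρ.op w),
    IsDiag ρ.op h.basis (fun v => (⟪(v : H), ρ.op v⟫_ℂ).re) :=
  ρ.toTC.exists_isDiag ρ.isPositive.isSymmetric

/-- The state with eigenvalues `x` in the basis `b`. -/
def diag {ι : Type*} (b : HilbertBasis ι ℂ H) (x : ι → ℝ) (h0 : ∀ i, 0 ≤ x i) (h1 : HasSum x 1) :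
    State H :=
  ⟨TraceClass.diag b x, by
    have hx : Summable fun i => |x i| := by simpa only [abs_of_nonneg (h0 _)] using h1.summable
    refine ⟨TraceClass.isPositive_diag b hx h0, ?_⟩
    rw [TraceClass.trace_eq_traceOn, TraceClass.traceOn_of_isDiag (TraceClass.isDiag_diag b hx),
      h1.tsum_eq, Complex.ofReal_one]⟩

theorem isDiag_diag {ι : Type*} (b : HilbertBasis ι ℂ H) (x : ι → ℝ) (h0 : ∀ i, 0 ≤ x i)
    (h1 : HasSum x 1) : IsDiag (diag b x h0 h1).op b x :=
  TraceClass.isDiag_diag b (by simpa only [abs_of_nonneg (h0 _)] using h1.summable)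

/-- The pure state of a unit vector. -/
def pure (u : H) (hu : ‖u‖ = 1) : State H :=
  ⟨TraceClass.rankOne u u, InnerProductSpace.isPositive_rankOne_self u, by
    rw [TraceClass.trace_eq_traceOn, TraceClass.traceOn_rankOne, inner_self_eq_norm_sq_to_K, hu]
    simp⟩

theorem pure_op (u : H) (hu : ‖u‖ = 1) : (pure u hu).op = InnerProductSpace.rankOne ℂ u u := rfl

theorem continuous_rankOne_self : Continuous fun u : H => TraceClass.rankOne u u := by
  refine continuous_iff_continuousAt.2 fun v => ?_
  rw [ContinuousAt, tendsto_iff_norm_sub_tendsto_zero]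
  have hb : ∀ u : H, ‖TraceClass.rankOne u u - TraceClass.rankOne v v‖
      ≤ ‖u - v‖ * ‖u‖ + ‖v‖ * ‖u - v‖ := by
    intro u
    have e : TraceClass.rankOne u u - TraceClass.rankOne v v
        = TraceClass.rankOne (u - v) u + TraceClass.rankOne v (u - v) := by
      apply TraceClass.toCLM_injective
      ext y
      simp
    rw [e]
    exact (norm_add_le _ _).trans (add_le_add (TraceClass.norm_rankOne_le _ _)
      (TraceClass.norm_rankOne_le _ _))
  refine squeeze_zero (fun _ => norm_nonneg _) hb ?_
  have : Continuous fun u : H => ‖u - v‖ * ‖u‖ + ‖v‖ * ‖u - v‖ := by fun_prop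
  simpa using this.tendsto v

/-- By its spectral series every state is in the closed span of the operators |u⟩⟨u|, a continuous
image of a separable space. Separability makes measurable families of states strongly measurable,
hence Bochner integrable. -/
theorem isSeparable_range_toTC [TopologicalSpace.SeparableSpace H] :
    TopologicalSpace.IsSeparable (Set.range (toTC : State H → TraceClass H)) := by
  have h1 : TopologicalSpace.IsSeparable (Set.range fun u : H => TraceClass.rankOne u u) :=
    TopologicalSpace.isSeparable_range continuous_rankOne_self
  refine (h1.span (R := ℂ)).closure.mono ?_
  rintro _ ⟨ρ, rfl⟩
  obtain ⟨w, h, hd⟩ := ρ.exists_isDiag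
  have hs := TraceClass.hasSum_diag h.basis (TraceClass.summable_abs_of_isDiag (T := ρ.toTC) hd).1
  rw [← TraceClass.eq_diag (T := ρ.toTC) hd] at hs
  refine mem_closure_of_tendsto hs (Eventually.of_forall fun s => ?_)
  exact Submodule.sum_mem _ fun i _ => Submodule.smul_mem _ _
    (Submodule.subset_span ⟨h.basis i, rfl⟩)

instance [TopologicalSpace.SeparableSpace H] : SecondCountableTopology (State H) := by
  have h : TopologicalSpace.IsSeparable {T : TraceClass H | T.toCLM.IsPositive ∧
      trace T.toCLM = 1} := by
    refine isSeparable_range_toTC.mono ?_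
    intro T hT
    exact ⟨⟨T, hT⟩, rfl⟩
  have : TopologicalSpace.SeparableSpace
    {T : TraceClass H // T.toCLM.IsPositive ∧ trace T.toCLM = 1} := h.separableSpace
  exact UniformSpace.secondCountable_of_separable
    {T : TraceClass H // T.toCLM.IsPositive ∧ trace T.toCLM = 1}

section Average

variable [TopologicalSpace.SeparableSpace H] {Ω : Type*} [MeasurableSpace Ω] (μ : Measure Ω)
  [IsProbabilityMeasure μ]

theorem integrable_toTC {f : Ω → State H} (hf : Measurable f) :
    Integrable (fun a => (f a).toTC) μ := by
  refine Integrable.of_bound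
    (continuous_toTC.stronglyMeasurable.comp_measurable hf).aestronglyMeasurable 1 ?_
  exact Eventually.of_forall fun a => (f a).norm_toTC_le

theorem inner_integral_toTC {f : Ω → State H} (hf : Measurable f) (x y : H) :
    ⟪x, (∫ a, (f a).toTC ∂μ).toCLM y⟫_ℂ = ∫ a, ⟪x, (f a).op y⟫_ℂ ∂μ :=
  ((TraceClass.matrixElem x y).integral_comp_comm (integrable_toTC μ hf)).symm

theorem integrable_inner {f : Ω → State H} (hf : Measurable f) (x y : H) :
    Integrable (fun a => ⟪x, (f a).op y⟫_ℂ) μ :=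
  (TraceClass.matrixElem x y).integrable_comp (integrable_toTC μ hf)

theorem re_inner_integral_toTC {f : Ω → State H} (hf : Measurable f) (x : H) :
    (⟪x, (∫ a, (f a).toTC ∂μ).toCLM x⟫_ℂ).re = ∫ a, (⟪x, (f a).op x⟫_ℂ).re ∂μ := by
  rw [inner_integral_toTC μ hf]
  exact (integral_re (integrable_inner μ hf x x)).symm

/-- The mean of a random state. -/
def mean (f : Ω → State H) (hf : Measurable f) : State H :=
  ⟨∫ a, (f a).toTC ∂μ, by
    refine ⟨isPositive_of_inner_nonneg fun y => ?_, ?_⟩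
    · rw [Complex.nonneg_iff]
      refine ⟨?_, ?_⟩
      · rw [re_inner_integral_toTC μ hf]
        exact integral_nonneg fun a => (f a).re_inner_nonneg y
      · rw [inner_integral_toTC μ hf]
        have h1 := integral_im (𝕜 := ℂ) (integrable_inner μ hf y y)
        have h2 : ∀ a, RCLike.im (⟪y, (f a).op y⟫_ℂ) = 0 := fun a =>
          (Complex.nonneg_iff.1 (inner_nonneg_of_isPositive (f a).isPositive y)).2.symm
        simp_rw [h2, integral_zero] at h1
        exact h1
    · rw [TraceClass.trace_eq_traceOn,
        ← (TraceClass.traceOn (stdBasis H)).integral_comp_comm (integrable_toTC μ hf)]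
      simp_rw [← TraceClass.trace_eq_traceOn, toCLM_toTC, trace_op]
      simp⟩

theorem mean_toTC {f : Ω → State H} (hf : Measurable f) :
    (mean μ f hf).toTC = ∫ a, (f a).toTC ∂μ := rfl

theorem lintegral_ofReal_inner {f : Ω → State H} (hf : Measurable f) (x : H) :
    ∫⁻ a, ENNReal.ofReal (⟪x, (f a).op x⟫_ℂ).re ∂μ
      = ENNReal.ofReal (⟪x, (mean μ f hf).op x⟫_ℂ).re := by
  have h1 : (⟪x, (mean μ f hf).op x⟫_ℂ).re = ∫ a, (⟪x, (f a).op x⟫_ℂ).re ∂μ :=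
    re_inner_integral_toTC μ hf x
  rw [h1]
  exact (ofReal_integral_eq_lintegral_ofReal (integrable_inner μ hf x x).re
    (Eventually.of_forall fun a => (f a).re_inner_nonneg x)).symm

end Average

end State

end StateLemmas

/-! ### Continuity of channels -/

section ChannelLemmas

variable {HA HB : Type*} [NormedAddCommGroup HA] [InnerProductSpace ℂ HA] [CompleteSpace HA]
  [NormedAddCommGroup HB] [InnerProductSpace ℂ HB] [CompleteSpace HB]

namespace Channel

variable (Φ : Channel HA HB)

theorem isPositive_map {T : TraceClass HA} (hT : T.toCLM.IsPositive) :
    (Φ.map T).toCLM.IsPositive := by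
  refine isPositive_of_inner_nonneg fun y => ?_
  have h := Φ.completelyPositive 1 (fun _ _ => T)
    (fun x => by simpa using inner_nonneg_of_isPositive hT (x 0)) (fun _ => y)
  simpa using h

theorem norm_map_le_of_isPositive {T : TraceClass HA} (hT : T.toCLM.IsPositive) :
    ‖Φ.map T‖ ≤ (trace T.toCLM).re :=
  Φ.tracePreserving T ▸ TraceClass.norm_le_trace (Φ.isPositive_map hT)

/-- Split T into its positive and negative parts; on each of them positivity and trace preservation
give the bound. -/
theorem norm_map_le_of_isSymmetric {T : TraceClass HA}
    (hT : (T.toCLM : HA →ₗ[ℂ] HA).IsSymmetric) : ‖Φ.map T‖ ≤ ‖T‖ := by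
  obtain ⟨w, h, hd⟩ := T.exists_isDiag hT
  set x : w → ℝ := fun v => (⟪(v : HA), T.toCLM v⟫_ℂ).re with hxdef
  have hx := TraceClass.summable_abs_of_isDiag hd
  have hp : Summable fun i => |max (x i) 0| := hx.1.of_nonneg_of_le (fun _ => abs_nonneg _)
    fun i => by rw [abs_of_nonneg (le_max_right _ _)]; exact max_le (le_abs_self _) (abs_nonneg _)
  have hn : Summable fun i => |max (-x i) 0| := hx.1.of_nonneg_of_le (fun _ => abs_nonneg _)
    fun i => by rw [abs_of_nonneg (le_max_right _ _)]; exact max_le (neg_le_abs _) (abs_nonneg _)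
  have e : T = TraceClass.diag h.basis (fun i => max (x i) 0)
      - TraceClass.diag h.basis (fun i => max (-x i) 0) := by
    conv_lhs => rw [TraceClass.eq_diag hd]
    refine (TraceClass.hasSum_diag h.basis hx.1).unique ?_
    convert (TraceClass.hasSum_diag h.basis hp).sub (TraceClass.hasSum_diag h.basis hn) using 1
    ext i
    rw [← sub_smul]
    congr 1
    norm_cast
    rcases le_total (x i) 0 with hi | hi
    · rw [max_eq_right hi, max_eq_left (by linarith)]; simp [hxdef]
    · rw [max_eq_left hi, max_eq_right (by linarith)]; simp [hxdef]
  have b1 := Φ.norm_map_le_of_isPositive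
    (TraceClass.isPositive_diag h.basis hp fun i => le_max_right _ _)
  have b2 := Φ.norm_map_le_of_isPositive
    (TraceClass.isPositive_diag h.basis hn fun i => le_max_right _ _)
  rw [TraceClass.trace_eq_traceOn, TraceClass.traceOn_of_isDiag (TraceClass.isDiag_diag h.basis hp),
    Complex.ofReal_re] at b1
  rw [TraceClass.trace_eq_traceOn, TraceClass.traceOn_of_isDiag (TraceClass.isDiag_diag h.basis hn),
    Complex.ofReal_re] at b2
  calc ‖Φ.map T‖ ≤ ‖Φ.map (TraceClass.diag h.basis (fun i => max (x i) 0))‖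
        + ‖Φ.map (TraceClass.diag h.basis (fun i => max (-x i) 0))‖ := by
        conv_lhs => rw [e, map_sub]
        exact norm_sub_le _ _
    _ ≤ ∑' i, max (x i) 0 + ∑' i, max (-x i) 0 := add_le_add b1 b2
    _ = ∑' i, |x i| := by
        rw [← Summable.tsum_add]
        · refine tsum_congr fun i => ?_
          rcases le_total (x i) 0 with hi | hi
          · rw [max_eq_right hi, max_eq_left (by linarith), abs_of_nonpos hi, zero_add]
          · rw [max_eq_left hi, max_eq_right (by linarith), abs_of_nonneg hi, add_zero]
        · exact summable_abs_iff.1 hp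
        · exact summable_abs_iff.1 hn
    _ ≤ ‖T‖ := hx.2

/-- Real and imaginary parts are treated separately. The crude constant 2 is enough, since only
continuity is needed for moving the channel under the Bochner integral. -/
theorem norm_map_le (T : TraceClass HA) : ‖Φ.map T‖ ≤ 2 * ‖T‖ := by
  obtain ⟨S, hS, hSn⟩ := T.exists_adjoint
  have hadj : ∀ x y, ⟪S.toCLM x, y⟫_ℂ = ⟪x, T.toCLM y⟫_ℂ := fun x y => by
    rw [hS, ContinuousLinearMap.adjoint_inner_left]
  have hadj' : ∀ x y, ⟪T.toCLM x, y⟫_ℂ = ⟪x, S.toCLM y⟫_ℂ := fun x y => by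
    rw [hS, ContinuousLinearMap.adjoint_inner_right]
  have s1 : ((T + S).toCLM : HA →ₗ[ℂ] HA).IsSymmetric := by
    intro x y
    simp only [ContinuousLinearMap.coe_coe, map_add, add_apply, inner_add_left, inner_add_right,
      hadj, hadj']
    ring
  have s2 : ((Complex.I • (S - T)).toCLM : HA →ₗ[ℂ] HA).IsSymmetric := by
    intro x y
    simp only [ContinuousLinearMap.coe_coe, map_sub, map_smul, smul_apply, sub_apply,
      inner_sub_left, inner_sub_right, inner_smul_left, inner_smul_right, hadj, hadj',
      Complex.conj_I]
    ring
  have b1 := Φ.norm_map_le_of_isSymmetric s1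
  have b2 := Φ.norm_map_le_of_isSymmetric s2
  have b1' : ‖T + S‖ ≤ 2 * ‖T‖ := (norm_add_le _ _).trans (by linarith)
  have b2' : ‖Complex.I • (S - T)‖ ≤ 2 * ‖T‖ := by
    rw [norm_smul, Complex.norm_I, one_mul]
    exact (norm_sub_le _ _).trans (by linarith)
  have e : T = (1 / 2 : ℂ) • (T + S) + (Complex.I / 2) • (Complex.I • (S - T)) := by
    rw [smul_smul, show Complex.I / 2 * Complex.I = -(1 / 2) by
      rw [div_mul_eq_mul_div, Complex.I_mul_I]; ring]
    module
  calc ‖Φ.map T‖ ≤ ‖(1 / 2 : ℂ) • Φ.map (T + S)‖ +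
        ‖(Complex.I / 2) • Φ.map (Complex.I • (S - T))‖ := by
        conv_lhs => rw [e, map_add, map_smul, map_smul _ (Complex.I / 2)]
        exact norm_add_le _ _
    _ = 1 / 2 * ‖Φ.map (T + S)‖ + 1 / 2 * ‖Φ.map (Complex.I • (S - T))‖ := by
        rw [norm_smul, norm_smul]; simp
    _ ≤ 2 * ‖T‖ := by linarith

/-- A channel as a continuous linear map. -/
def mapL : TraceClass HA →L[ℂ] TraceClass HB := Φ.map.mkContinuous 2 Φ.norm_map_le

theorem continuous_onState : Continuous Φ.onState :=
  Continuous.subtype_mk (Φ.mapL.continuous.comp State.continuous_toTC) _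

variable [TopologicalSpace.SeparableSpace HB]

theorem averageState_map (μ : Measure (State HA)) [IsProbabilityMeasure μ] :
    averageState (μ.map Φ.onState)
      = (State.mean μ Φ.onState Φ.continuous_onState.measurable).toTC := by
  rw [averageState, integral_map Φ.continuous_onState.measurable.aemeasurable
    State.continuous_toTC.stronglyMeasurable.aestronglyMeasurable, State.mean_toTC]

theorem mean_onState [TopologicalSpace.SeparableSpace HA] (μ : Measure (State HA)) [IsProbabilityMeasure μ] :
    State.mean μ Φ.onState Φ.continuous_onState.measurable
      = Φ.onState (State.mean μ id measurable_id) := by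
  refine Subtype.ext ?_
  change ∫ a, Φ.mapL a.toTC ∂μ = Φ.mapL (∫ a, State.toTC a ∂μ)
  exact Φ.mapL.integral_comp_comm (State.integrable_toTC μ measurable_id)

end Channel

end ChannelLemmas

/-! ### Entropy, cross entropy and relative entropy -/

section Entropy

variable {H : Type*} [NormedAddCommGroup H] [InnerProductSpace ℂ H] [CompleteSpace H]

theorem mem_spectrum_of_eigenvector {T : H →L[ℂ] H} {l : ℝ} {v : H} (hv : v ≠ 0)
    (h : T v = (l : ℂ) • v) : l ∈ spectrum ℝ T := by
  rw [spectrum.mem_iff]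
  intro hu
  obtain ⟨S, hS⟩ := hu.exists_left_inv
  have h1 : (algebraMap ℝ (H →L[ℂ] H) l - T) v = 0 := by
    rw [sub_apply, h, Algebra.algebraMap_eq_smul_one]
    simp
  have h2 : (S * (algebraMap ℝ (H →L[ℂ] H) l - T)) v = 0 := by
    rw [mul_apply_eq_comp, h1, map_zero]
  rw [hS] at h2
  exact hv (by simpa using h2)

/-- The continuous functional calculus acts on eigenvectors through the eigenvalue. -/
theorem cfc_apply_eigenvector {T : H →L[ℂ] H} (hT : IsSelfAdjoint T) {l : ℝ} {v : H} (hv : v ≠ 0)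
    (h : T v = (l : ℂ) • v) {f : ℝ → ℝ} (hf : ContinuousOn f (spectrum ℝ T)) :
    cfc f T v = (f l : ℂ) • v := by
  have hl := mem_spectrum_of_eigenvector hv h
  rw [cfc_apply f T hT hf]
  suffices hg : ∀ g : C(spectrum ℝ T, ℝ), cfcHom hT g v = (g ⟨l, hl⟩ : ℂ) • v from hg _
  have hid : cfcHom hT (.restrict (spectrum ℝ T) <| .id ℝ) v = (l : ℂ) • v := by
    rw [cfcHom_id hT, h]
  intro g
  induction g using ContinuousMap.induction_on_of_compact with
  | const r =>
    have : ContinuousMap.const (spectrum ℝ T) r = algebraMap ℝ C(spectrum ℝ T, ℝ) r := rfl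
    rw [this, AlgHomClass.commutes, Algebra.algebraMap_eq_smul_one]
    simp
  | id => exact hid
  | star_id =>
    have : star (ContinuousMap.restrict (spectrum ℝ T) <| .id ℝ) =
      ContinuousMap.restrict (spectrum ℝ T) (.id ℝ) := by ext; simp
    rw [this]; exact hid
  | add f g hf hg => rw [map_add, add_apply, hf, hg, ← add_smul]; simp
  | mul f g hf hg =>
    rw [map_mul, mul_apply_eq_comp, hg, map_smul, hf, smul_smul]
    simp [mul_comm]
  | frequently f hfr =>
    have hc : Continuous fun g : C(spectrum ℝ T, ℝ) => cfcHom hT g v :=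
      (ContinuousLinearMap.apply ℂ H v).continuous.comp (cfcHom_continuous hT)
    have hc2 : Continuous fun g : C(spectrum ℝ T, ℝ) => (g ⟨l, hl⟩ : ℂ) • v :=
      (Complex.continuous_ofReal.comp (continuous_eval_const _)).smul
        continuous_const
    exact hfr.mem_of_closed (isClosed_eq hc hc2)

theorem IsDiag.cfc {ι : Type*} {T : H →L[ℂ] H} {b : HilbertBasis ι ℂ H} {x : ι → ℝ}
    (h : IsDiag T b x) (hT : IsSelfAdjoint T) {f : ℝ → ℝ}
    (hf : ContinuousOn f (spectrum ℝ T)) : IsDiag (_root_.cfc f T) b (fun i => f (x i)) :=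
  fun i => cfc_apply_eigenvector hT (b.orthonormal.ne_zero i) (h i) hf

theorem IsDiag.isPositive {ι : Type*} {T : H →L[ℂ] H} {b : HilbertBasis ι ℂ H} {x : ι → ℝ}
    (h : IsDiag T b x) (hT : IsSelfAdjoint T) (hx : ∀ i, 0 ≤ x i) : T.IsPositive := by
  have hs : (T : H →ₗ[ℂ] H).IsSymmetric := hT.isSymmetric
  refine ⟨hs, fun y => ?_⟩
  rw [ContinuousLinearMap.reApplyInnerSelf_apply, inner_re_symm]
  exact (h.hasSum_inner_apply hs y).nonneg fun i => mul_nonneg (hx i) (by positivity)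

theorem IsDiag.posTrace_cfc {ι : Type*} {T : H →L[ℂ] H} {b : HilbertBasis ι ℂ H} {x : ι → ℝ}
    (h : IsDiag T b x) (hT : IsSelfAdjoint T) {f : ℝ → ℝ} (hf : ContinuousOn f (spectrum ℝ T))
    (hx : ∀ i, 0 ≤ f (x i)) : posTrace (_root_.cfc f T) = ∑' i, ENNReal.ofReal (f (x i)) :=
  (h.cfc hT hf).tsum_ofReal_inner ((h.cfc hT hf).isPositive (cfc_predicate f T) hx) (stdBasis H)

theorem State.entropy_eq {ρ : State H} {ι : Type*} {b : HilbertBasis ι ℂ H} {x : ι → ℝ}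
    (h : IsDiag ρ.op b x) : entropy ρ.op = ∑' i, ENNReal.ofReal (Real.negMulLog (x i)) :=
  h.posTrace_cfc ρ.isPositive.isSelfAdjoint Real.continuous_negMulLog.continuousOn fun i =>
    Real.negMulLog_nonneg (h.nonneg ρ.isPositive i) (State.eigenvalue_le_one h i)

/-- `- log y`, with value `+∞` at `y = 0`. -/
def negLog (y : ℝ) : ℝ≥0∞ := if y = 0 then ⊤ else ENNReal.ofReal (-Real.log y)

theorem sub_le_mul_log_sub {x y : ℝ} (hx : 0 ≤ x) (hy : 0 < y) :
    x - y ≤ x * Real.log x - x * Real.log y := by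
  rcases hx.eq_or_lt with rfl | hx
  · simp [hy.le]
  have h := Real.add_one_le_exp (Real.log (y / x))
  rw [Real.exp_log (by positivity), Real.log_div hy.ne' hx.ne'] at h
  have h2 : x * (Real.log y - Real.log x + 1) ≤ x * (y / x) := by gcongr
  rw [mul_div_cancel₀ _ hx.ne'] at h2
  nlinarith

/-- All subtractions are moved to the other side, so that the identity holds in `[0, ∞]` and
survives summation. If y = 0 < x both sides are infinite. -/
theorem relEntropyTerm_add {x y : ℝ} (hx : 0 ≤ x) (hx1 : x ≤ 1) (hy : 0 ≤ y) (hy1 : y ≤ 1) :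
    relEntropyTerm x y + ENNReal.ofReal (Real.negMulLog x) + ENNReal.ofReal x
      = ENNReal.ofReal x * negLog y + ENNReal.ofReal y := by
  unfold relEntropyTerm negLog
  by_cases h0 : y = 0
  · by_cases hx0 : x = 0
    · simp [h0, hx0]
    · have : ENNReal.ofReal x ≠ 0 := by
        simpa using lt_of_le_of_ne hx (Ne.symm hx0)
      simp [h0, hx0, ENNReal.mul_top this]
  · have hy' : 0 < y := lt_of_le_of_ne hy (Ne.symm h0)
    have hl : 0 ≤ -Real.log y := by linarith [Real.log_nonpos hy hy1]
    rw [if_neg h0, if_neg h0, ← ENNReal.ofReal_mul hx, ← ENNReal.ofReal_add,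
      ← ENNReal.ofReal_add, ← ENNReal.ofReal_add (by positivity) hy]
    · congr 1
      unfold Real.negMulLog
      ring
    · have := sub_le_mul_log_sub hx hy'
      have := Real.negMulLog_nonneg hx hx1
      linarith
    · exact hx
    · have := sub_le_mul_log_sub hx hy'
      linarith
    · exact Real.negMulLog_nonneg hx hx1

theorem tsum_enorm_inner_sq_left {ι κ : Type*} (b : HilbertBasis ι ℂ H) (c : HilbertBasis κ ℂ H)
    (j : κ) : ∑' i, ‖⟪b i, c j⟫_ℂ‖ₑ ^ 2 = 1 := by
  rw [tsum_enorm_inner_sq, ← ofReal_norm, c.orthonormal.1 j]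
  simp

theorem tsum_enorm_inner_sq_right {ι κ : Type*} (b : HilbertBasis ι ℂ H) (c : HilbertBasis κ ℂ H)
    (i : ι) : ∑' j, ‖⟪b i, c j⟫_ℂ‖ₑ ^ 2 = 1 := by
  rw [← tsum_enorm_inner_sq_left c b i]
  refine tsum_congr fun j => ?_
  rw [← ofReal_norm, norm_inner_symm, ofReal_norm]

/-- The relative entropy plus the entropy is the cross entropy. -/
theorem tsum_relEntropyTerm_add {ρ ω : State H} {ι κ : Type*} {b : HilbertBasis ι ℂ H}
    {x : ι → ℝ} {c : HilbertBasis κ ℂ H} {y : κ → ℝ} (hρ : IsDiag ρ.op b x)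
    (hω : IsDiag ω.op c y) :
    (∑' (i : ι) (j : κ), ‖⟪b i, c j⟫_ℂ‖ₑ ^ 2 * relEntropyTerm (x i) (y j))
      + ∑' i, ENNReal.ofReal (Real.negMulLog (x i))
      = ∑' j, negLog (y j) * ENNReal.ofReal (⟪c j, ρ.op (c j)⟫_ℂ).re := by
  have hx := hρ.nonneg ρ.isPositive
  have hy := hω.nonneg ω.isPositive
  have sx : ∑' i, ENNReal.ofReal (x i) = 1 := by
    simpa only [hρ.inner_self, Complex.ofReal_re] using ρ.tsum_ofReal_inner b
  have sy : ∑' j, ENNReal.ofReal (y j) = 1 := by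
    simpa only [hω.inner_self, Complex.ofReal_re] using ω.tsum_ofReal_inner c
  -- The 1 added on the left is Tr ρ, the one on the right Tr ω; with them the termwise identity
  -- applies.
  refine (ENNReal.add_left_inj ENNReal.one_ne_top).1 ?_
  calc _ = ∑' (i : ι) (j : κ), ‖⟪b i, c j⟫_ℂ‖ₑ ^ 2 * (relEntropyTerm (x i) (y j)
        + ENNReal.ofReal (Real.negMulLog (x i)) + ENNReal.ofReal (x i)) := by
        conv_lhs => rw [← sx]
        rw [← ENNReal.tsum_add, ← ENNReal.tsum_add]
        refine tsum_congr fun i => ?_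
        simp_rw [mul_add]
        rw [ENNReal.tsum_add, ENNReal.tsum_add, ENNReal.tsum_mul_right, ENNReal.tsum_mul_right,
          tsum_enorm_inner_sq_right, one_mul, one_mul]
    _ = ∑' (i : ι) (j : κ), ‖⟪b i, c j⟫_ℂ‖ₑ ^ 2 * (ENNReal.ofReal (x i) * negLog (y j)
        + ENNReal.ofReal (y j)) := by
        refine tsum_congr fun i => tsum_congr fun j => ?_
        rw [relEntropyTerm_add (hx i) (State.eigenvalue_le_one hρ i) (hy j)
          (State.eigenvalue_le_one hω j)]
    _ = _ := by
        conv_rhs => rw [← sy]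
        rw [← ENNReal.tsum_add, ENNReal.tsum_comm]
        refine tsum_congr fun j => ?_
        simp_rw [mul_add]
        rw [ENNReal.tsum_add, ENNReal.tsum_mul_right, tsum_enorm_inner_sq_left, one_mul,
          hρ.ofReal_inner_apply ρ.isPositive, ← ENNReal.tsum_mul_left]
        congr 1
        exact tsum_congr fun i => by ring

theorem relEntropy_le {ρ ω : State H} {e f : Set H} (he : IsEigenbasis ρ.op e)
    (hf : IsEigenbasis ω.op f) :
    relEntropy ρ.op ω.op ≤ ∑' (i : e) (j : f), ‖⟪(i : H), (j : H)⟫_ℂ‖ₑ ^ 2 *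
      relEntropyTerm (⟪(i : H), ρ.op i⟫_ℂ).re (⟪(j : H), ω.op j⟫_ℂ).re :=
  iInf_le_of_le e <| iInf_le_of_le he <| iInf_le_of_le f <| iInf_le _ hf

/-- An upper bound for the infimum defining the relative entropy can use any eigenbasis of ω, here
the given one. -/
theorem relEntropy_add_entropy_le {ρ ω : State H} {f : Set H} (hf : IsEigenbasis ω.op f) :
    relEntropy ρ.op ω.op + entropy ρ.op
      ≤ ∑' j : f, negLog (⟪(j : H), ω.op j⟫_ℂ).re * ENNReal.ofReal (⟪(j : H), ρ.op j⟫_ℂ).re := by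
  obtain ⟨w, h, hd⟩ := ρ.exists_isDiag
  have h1 := tsum_relEntropyTerm_add hd (hf.isDiag ω.isPositive.isSymmetric)
  simp only [IsEigenbasis.basis_apply] at h1
  rw [← h1, State.entropy_eq hd]
  gcongr
  exact relEntropy_le h hf

/-- A lower bound has to be checked in every eigenbasis of ω; finiteness of the entropy allows its
cancellation. -/
theorem le_relEntropy {ρ ω : State H} {c : ℝ≥0∞} (hS : entropy ρ.op ≠ ⊤)
    (h : ∀ f, IsEigenbasis ω.op f → c + entropy ρ.op ≤
      ∑' j : f, negLog (⟪(j : H), ω.op j⟫_ℂ).re * ENNReal.ofReal (⟪(j : H), ρ.op j⟫_ℂ).re) :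
    c ≤ relEntropy ρ.op ω.op := by
  refine le_iInf fun e => le_iInf fun he => le_iInf fun f => le_iInf fun hf => ?_
  have hd := he.isDiag ρ.isPositive.isSymmetric
  have h1 := tsum_relEntropyTerm_add hd (hf.isDiag ω.isPositive.isSymmetric)
  simp only [IsEigenbasis.basis_apply] at h1
  have h2 := h f hf
  rw [← h1, ← State.entropy_eq hd] at h2
  exact (ENNReal.add_le_add_iff_right hS).1 h2

end Entropy

/-! ### Integral representation of x log x - x log y + y - x -/

section KLKernel

/-- `x log x - x log y + y - x`. -/
def klKernel (x y : ℝ) : ℝ := x * Real.log x - x * Real.log y + y - x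

theorem klKernel_nonneg {x y : ℝ} (hx : 0 ≤ x) (hy : 0 < y) : 0 ≤ klKernel x y := by
  have := sub_le_mul_log_sub hx hy
  unfold klKernel; linarith

/-- The quadratic kernel in the integral representation of `klKernel`. -/
def quadKernel (s x y : ℝ) : ℝ := (x - y) ^ 2 / (x + s * y)

theorem integral_quadKernel {x y : ℝ} (hx : 0 ≤ x) (hy : 0 < y ∨ x = 0 ∧ y = 0) :
    IntegrableOn (fun s => s / (1 + s) ^ 2 * quadKernel s x y) (Set.Ioi 0) ∧
      ∫ s in Set.Ioi 0, s / (1 + s) ^ 2 * quadKernel s x y = klKernel x y := by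
  rcases hy with hy | ⟨rfl, rfl⟩
  swap
  · simp [quadKernel, klKernel]
  -- An explicit antiderivative in s. It goes from x - y - x log x at 0 to -x log y at infinity.
  let g : ℝ → ℝ := fun s => x * (Real.log (1 + s) - Real.log (x + s * y)) + (x - y) / (1 + s)
  have hcont : ContinuousWithinAt g (Set.Ici 0) 0 := by
    rcases hx.eq_or_lt with rfl | hx
    · simp only [g, zero_mul, zero_add, zero_sub]
      refine ContinuousAt.continuousWithinAt ?_
      exact continuousAt_const.div (by fun_prop) (by norm_num)
    · refine ContinuousAt.continuousWithinAt ?_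
      refine ((continuousAt_const.mul ((ContinuousAt.log (by fun_prop) (by norm_num)).sub
        (ContinuousAt.log (by fun_prop) (by simpa using hx.ne')))).add
        (continuousAt_const.div (by fun_prop) (by norm_num)))
  have hderiv : ∀ s ∈ Set.Ioi (0 : ℝ),
      HasDerivAt g (s / (1 + s) ^ 2 * quadKernel s x y) s := by
    intro s hs
    have hs' : 0 < s := hs
    have h1 : 0 < 1 + s := by linarith
    have h2 : 0 < x + s * y := by positivity
    have d1 : HasDerivAt (fun s => 1 + s) 1 s := (hasDerivAt_id s).const_add 1
    have d2 : HasDerivAt (fun s => x + s * y) y s := by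
      simpa using ((hasDerivAt_id s).mul_const y).const_add x
    have d3 := (((d1.log h1.ne').sub (d2.log h2.ne')).const_mul x).add
      ((hasDerivAt_const s (x - y)).div d1 h1.ne')
    refine (show HasDerivAt g _ s from d3).congr_deriv ?_
    unfold quadKernel
    field_simp
    ring
  have hpos : ∀ s ∈ Set.Ioi (0 : ℝ), 0 ≤ s / (1 + s) ^ 2 * quadKernel s x y := by
    intro s hs
    have hs' : 0 < s := hs
    unfold quadKernel
    positivity
  have hlim : Tendsto g atTop (𝓝 (-(x * Real.log y))) := by
    have t1 : Tendsto (fun s : ℝ => (1 + s)⁻¹) atTop (𝓝 0) :=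
      tendsto_inv_atTop_zero.comp (tendsto_atTop_add_const_left _ 1 tendsto_id)
    have t2 : Tendsto (fun s : ℝ => y + (x - y) * (1 + s)⁻¹) atTop (𝓝 y) := by
      simpa using (t1.const_mul (x - y)).const_add y
    have t3 := ((Real.continuousAt_log hy.ne').tendsto.comp t2).const_mul (-x)
    have t4 := t3.add (t1.const_mul (x - y))
    rw [mul_zero, add_zero, neg_mul] at t4
    refine t4.congr' ?_
    filter_upwards [eventually_gt_atTop 0] with s hs
    have h1 : 0 < 1 + s := by linarith
    have h2 : 0 < x + s * y := by positivity
    have e : y + (x - y) * (1 + s)⁻¹ = (x + s * y) / (1 + s) := by field_simp; ring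
    simp only [Function.comp_apply, g]
    rw [e, Real.log_div h2.ne' h1.ne']
    ring
  refine ⟨integrableOn_Ioi_deriv_of_nonneg hcont hderiv hpos hlim, ?_⟩
  rw [integral_Ioi_of_hasDerivAt_of_nonneg hcont hderiv hpos hlim]
  simp only [g, klKernel]
  simp
  ring

end KLKernel

/-! ### Monotonicity of the relative entropy under a common positive summand -/

section FiniteDimensional

variable {V : Type*} [NormedAddCommGroup V] [InnerProductSpace ℂ V] [FiniteDimensional ℂ V]

/-- The operator `A` has eigenvalues `x` in the orthonormal basis `a`. -/
def IsEigen {κ : Type*} [Fintype κ] (A : V →ₗ[ℂ] V) (a : OrthonormalBasis κ ℂ V) (x : κ → ℝ) :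
    Prop := ∀ i, A (a i) = (x i : ℂ) • a i

theorem exists_isEigen {A : V →ₗ[ℂ] V} (hA : A.IsSymmetric) :
    ∃ (a : OrthonormalBasis (Fin (Module.finrank ℂ V)) ℂ V) (x : _ → ℝ), IsEigen A a x :=
  ⟨hA.eigenvectorBasis rfl, hA.eigenvalues rfl, fun i => hA.apply_eigenvectorBasis rfl i⟩

/-- The functional whose supremum over `Z` is the quadratic divergence of `A` and `B`. -/
def quadForm (s : ℝ) (A B Z : V →ₗ[ℂ] V) : ℝ :=
  2 * (LinearMap.trace ℂ V (LinearMap.adjoint Z ∘ₗ (A - B))).re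
    - (LinearMap.trace ℂ V (LinearMap.adjoint Z ∘ₗ A ∘ₗ Z)).re
    - s * (LinearMap.trace ℂ V (Z ∘ₗ B ∘ₗ LinearMap.adjoint Z)).re

variable {κ κ' ι ι' : Type*} [Fintype κ] [Fintype κ'] [Fintype ι] [Fintype ι']

namespace IsEigen

variable {A : V →ₗ[ℂ] V} {a : OrthonormalBasis κ ℂ V} {x : κ → ℝ}

theorem apply_eq_sum (h : IsEigen A a x) (y : V) :
    A y = ∑ i, ((x i : ℂ) * ⟪a i, y⟫_ℂ) • a i := by
  conv_lhs => rw [← a.sum_repr' y]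
  rw [map_sum]
  refine Finset.sum_congr rfl fun i _ => ?_
  rw [map_smul, h i, smul_smul, mul_comm]

theorem inner_apply (h : IsEigen A a x) (i : κ) (y : V) : ⟪a i, A y⟫_ℂ = x i * ⟪a i, y⟫_ℂ := by
  rw [h.apply_eq_sum]
  classical
  rw [inner_sum, Finset.sum_eq_single i]
  · rw [inner_smul_right, inner_self_eq_norm_sq_to_K, a.orthonormal.1 i]; simp
  · intro j _ hj
    rw [inner_smul_right, a.orthonormal.2 hj.symm, mul_zero]
  · simp

theorem re_inner_self (h : IsEigen A a x) (y : V) :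
    (⟪y, A y⟫_ℂ).re = ∑ i, x i * ‖⟪a i, y⟫_ℂ‖ ^ 2 := by
  rw [← a.sum_inner_mul_inner y (A y), Complex.re_sum]
  refine Finset.sum_congr rfl fun i _ => ?_
  rw [h.inner_apply, mul_left_comm, inner_mul_inner_swap]
  norm_cast

end IsEigen

/-- In the eigenbases of A and B the form decouples into one scalar quadratic for each matrix
element ⟨aᵢ, Z bⱼ⟩, so it can be maximized entry by entry. -/
theorem quadForm_eq (s : ℝ) {A B : V →ₗ[ℂ] V} (Z : V →ₗ[ℂ] V) {a : OrthonormalBasis κ ℂ V}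
    {b : OrthonormalBasis κ' ℂ V} {x : κ → ℝ} {y : κ' → ℝ} (hA : IsEigen A a x)
    (hB : IsEigen B b y) :
    quadForm s A B Z = ∑ i, ∑ j, (2 * ((x i - y j) * (starRingEnd ℂ ⟪a i, Z (b j)⟫_ℂ
      * ⟪a i, b j⟫_ℂ).re) - (x i + s * y j) * ‖⟪a i, Z (b j)⟫_ℂ‖ ^ 2) := by
  have e1 : (LinearMap.trace ℂ V (LinearMap.adjoint Z ∘ₗ (A - B))).re
      = ∑ i, ∑ j, (x i - y j) * (starRingEnd ℂ ⟪a i, Z (b j)⟫_ℂ * ⟪a i, b j⟫_ℂ).re := by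
    rw [LinearMap.trace_eq_sum_inner _ b, Finset.sum_comm, Complex.re_sum]
    refine Finset.sum_congr rfl fun j _ => ?_
    rw [LinearMap.comp_apply, LinearMap.adjoint_inner_right,
      ← a.sum_inner_mul_inner (Z (b j)) ((A - B) (b j)), Complex.re_sum]
    refine Finset.sum_congr rfl fun i _ => ?_
    rw [LinearMap.sub_apply, inner_sub_right, hA.inner_apply, hB j, inner_smul_right,
      inner_conj_symm, ← sub_mul, mul_left_comm]
    rw [← Complex.ofReal_sub, Complex.re_ofReal_mul]
  have e2 : (LinearMap.trace ℂ V (LinearMap.adjoint Z ∘ₗ A ∘ₗ Z)).re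
      = ∑ i, ∑ j, x i * ‖⟪a i, Z (b j)⟫_ℂ‖ ^ 2 := by
    rw [LinearMap.trace_eq_sum_inner _ b, Finset.sum_comm, Complex.re_sum]
    refine Finset.sum_congr rfl fun j _ => ?_
    rw [LinearMap.comp_apply, LinearMap.adjoint_inner_right, LinearMap.comp_apply,
      hA.re_inner_self]
  have e3 : (LinearMap.trace ℂ V (Z ∘ₗ B ∘ₗ LinearMap.adjoint Z)).re
      = ∑ i, ∑ j, y j * ‖⟪a i, Z (b j)⟫_ℂ‖ ^ 2 := by
    rw [LinearMap.trace_eq_sum_inner _ a, Complex.re_sum]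
    refine Finset.sum_congr rfl fun i _ => ?_
    rw [LinearMap.comp_apply, ← LinearMap.adjoint_inner_left, LinearMap.comp_apply,
      hB.re_inner_self]
    refine Finset.sum_congr rfl fun j _ => ?_
    rw [LinearMap.adjoint_inner_right, norm_inner_symm]
  rw [quadForm, e1, e2, e3]
  simp only [Finset.mul_sum, ← Finset.sum_sub_distrib]
  refine Finset.sum_congr rfl fun i _ => Finset.sum_congr rfl fun j _ => ?_
  ring

/-- Completing the square in each entry; where xᵢ + s yⱼ = 0 both eigenvalues vanish and so does the
entry. -/
theorem quadForm_le {s : ℝ} (hs : 0 < s) {A B : V →ₗ[ℂ] V} (Z : V →ₗ[ℂ] V)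
    {a : OrthonormalBasis κ ℂ V} {b : OrthonormalBasis κ' ℂ V} {x : κ → ℝ} {y : κ' → ℝ}
    (hA : IsEigen A a x) (hB : IsEigen B b y) (hx : ∀ i, 0 ≤ x i) (hy : ∀ j, 0 ≤ y j) :
    quadForm s A B Z ≤ ∑ i, ∑ j, ‖⟪a i, b j⟫_ℂ‖ ^ 2 * quadKernel s (x i) (y j) := by
  rw [quadForm_eq s Z hA hB]
  refine Finset.sum_le_sum fun i _ => Finset.sum_le_sum fun j _ => ?_
  set z := ⟪a i, Z (b j)⟫_ℂ
  set c := ⟪a i, b j⟫_ℂ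
  have hre : |(starRingEnd ℂ z * c).re| ≤ ‖z‖ * ‖c‖ := by
    refine (Complex.abs_re_le_norm _).trans ?_
    rw [norm_mul, RCLike.norm_conj]
  have h1 : (x i - y j) * (starRingEnd ℂ z * c).re ≤ |x i - y j| * (‖z‖ * ‖c‖) :=
    (le_abs_self _).trans (by rw [abs_mul]; gcongr)
  have hD : 0 ≤ x i + s * y j := add_nonneg (hx i) (mul_nonneg hs.le (hy j))
  rcases hD.eq_or_lt with h0 | hpos
  · have hx0 : x i = 0 := by nlinarith [hx i, mul_nonneg hs.le (hy j)]
    have hy0 : y j = 0 := by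
      have : s * y j = 0 := by linarith
      exact (mul_eq_zero.1 this).resolve_left hs.ne'
    simp [hx0, hy0, quadKernel]
  · have h2 : ‖c‖ ^ 2 * quadKernel s (x i) (y j) - (2 * (|x i - y j| * (‖z‖ * ‖c‖))
        - (x i + s * y j) * ‖z‖ ^ 2) = (|x i - y j| * ‖c‖ - (x i + s * y j) * ‖z‖) ^ 2
        / (x i + s * y j) := by
      unfold quadKernel
      rw [← sq_abs (x i - y j)]
      generalize |x i - y j| = r
      generalize x i + s * y j = D at hpos
      field_simp
      ring
    have h3 : 0 ≤ (|x i - y j| * ‖c‖ - (x i + s * y j) * ‖z‖) ^ 2 / (x i + s * y j) := by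
      positivity
    linarith

theorem exists_quadForm_eq {s : ℝ} (hs : 0 < s) {A B : V →ₗ[ℂ] V}
    {a : OrthonormalBasis κ ℂ V} {b : OrthonormalBasis κ' ℂ V} {x : κ → ℝ} {y : κ' → ℝ}
    (hA : IsEigen A a x) (hB : IsEigen B b y) (hx : ∀ i, 0 ≤ x i) (hy : ∀ j, 0 ≤ y j) :
    ∃ Z, quadForm s A B Z = ∑ i, ∑ j, ‖⟪a i, b j⟫_ℂ‖ ^ 2 * quadKernel s (x i) (y j) := by
  classical
  -- The maximizer of each scalar quadratic; the convention 0/0 = 0 covers a vanishing denominator.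
  let z : κ → κ' → ℂ := fun i j => (((x i - y j) / (x i + s * y j) : ℝ) : ℂ) * ⟪a i, b j⟫_ℂ
  let Z : V →ₗ[ℂ] V := b.toBasis.constr ℂ fun j => ∑ i, z i j • a i
  have hZ : ∀ i j, ⟪a i, Z (b j)⟫_ℂ = z i j := by
    intro i j
    have : Z (b j) = ∑ i, z i j • a i := by
      have := b.toBasis.constr_basis ℂ (fun j => ∑ i, z i j • a i) j
      rwa [b.coe_toBasis] at this
    rw [this]
    exact a.orthonormal.inner_right_fintype _ i
  refine ⟨Z, ?_⟩
  rw [quadForm_eq s Z hA hB]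
  refine Finset.sum_congr rfl fun i _ => Finset.sum_congr rfl fun j _ => ?_
  rw [hZ]
  set c := ⟪a i, b j⟫_ℂ with hc
  have e1 : (starRingEnd ℂ (z i j) * c).re = (x i - y j) / (x i + s * y j) * ‖c‖ ^ 2 := by
    simp only [z, ← hc, map_mul, Complex.conj_ofReal]
    rw [mul_assoc, Complex.conj_mul', Complex.re_ofReal_mul]
    norm_cast
  have e2 : ‖z i j‖ ^ 2 = ((x i - y j) / (x i + s * y j)) ^ 2 * ‖c‖ ^ 2 := by
    simp only [z, ← hc, norm_mul, Complex.norm_real, Real.norm_eq_abs]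
    rw [mul_pow, sq_abs]
  rw [e1, e2]
  have hD : 0 ≤ x i + s * y j := add_nonneg (hx i) (mul_nonneg hs.le (hy j))
  rcases hD.eq_or_lt with h0 | hpos
  · simp [← h0, quadKernel]
  · unfold quadKernel
    field_simp
    ring

theorem re_trace_nonneg {C : V →ₗ[ℂ] V} (hC : C.IsPositive) (Z : V →ₗ[ℂ] V) :
    0 ≤ (LinearMap.trace ℂ V (LinearMap.adjoint Z ∘ₗ C ∘ₗ Z)).re := by
  rw [LinearMap.trace_eq_sum_inner _ (stdOrthonormalBasis ℂ V), Complex.re_sum]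
  refine Finset.sum_nonneg fun i _ => ?_
  rw [LinearMap.comp_apply, LinearMap.adjoint_inner_right, LinearMap.comp_apply]
  simpa using hC.re_inner_nonneg_right (Z (stdOrthonormalBasis ℂ V i))

/-- The linear term depends only on A - B, while C enlarges both subtracted terms. -/
theorem quadForm_add_le {s : ℝ} (hs : 0 < s) (A B : V →ₗ[ℂ] V) {C : V →ₗ[ℂ] V}
    (hC : C.IsPositive) (Z : V →ₗ[ℂ] V) : quadForm s (A + C) (B + C) Z ≤ quadForm s A B Z := by
  have h1 := re_trace_nonneg hC Z
  have h2 := re_trace_nonneg hC (LinearMap.adjoint Z)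
  rw [LinearMap.adjoint_adjoint] at h2
  have h3 := mul_nonneg hs.le h2
  unfold quadForm
  rw [add_sub_add_right_eq_sub]
  simp only [LinearMap.add_comp, LinearMap.comp_add, map_add, Complex.add_re]
  linarith

/-- Adding the same positive operator to both arguments does not increase the relative entropy. -/
theorem sum_klKernel_add_le {A B C : V →ₗ[ℂ] V} (hC : C.IsPositive)
    {a : OrthonormalBasis κ ℂ V} {b : OrthonormalBasis κ' ℂ V} {x : κ → ℝ} {y : κ' → ℝ}
    {a' : OrthonormalBasis ι ℂ V} {b' : OrthonormalBasis ι' ℂ V} {x' : ι → ℝ} {y' : ι' → ℝ}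
    (hA : IsEigen A a x) (hB : IsEigen B b y) (hA' : IsEigen (A + C) a' x')
    (hB' : IsEigen (B + C) b' y') (hx : ∀ i, 0 ≤ x i) (hy : ∀ j, 0 ≤ y j)
    (hxy : (∀ i, x i = 0) ∨ ∀ j, 0 < y j) (hx' : ∀ i, 0 ≤ x' i) (hy' : ∀ j, 0 < y' j) :
    ∑ i, ∑ j, ‖⟪a' i, b' j⟫_ℂ‖ ^ 2 * klKernel (x' i) (y' j)
      ≤ ∑ i, ∑ j, ‖⟪a i, b j⟫_ℂ‖ ^ 2 * klKernel (x i) (y j) := by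
  -- The alternative A = 0 admits a singular B. It is needed when B is the compression of a state,
  -- which may have a kernel.
  have hgood : ∀ i j, 0 < y j ∨ x i = 0 ∧ y j = 0 := by
    intro i j
    rcases hxy with h | h
    · rcases (hy j).eq_or_lt with h0 | h0
      · exact Or.inr ⟨h i, h0.symm⟩
      · exact Or.inl h0
    · exact Or.inl (h j)
  have I1 : ∀ i j, IntegrableOn (fun s => ‖⟪a i, b j⟫_ℂ‖ ^ 2 *
      (s / (1 + s) ^ 2 * quadKernel s (x i) (y j))) (Set.Ioi 0) := fun i j =>
    (integral_quadKernel (hx i) (hgood i j)).1.const_mul _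
  have I2 : ∀ i j, IntegrableOn (fun s => ‖⟪a' i, b' j⟫_ℂ‖ ^ 2 *
      (s / (1 + s) ^ 2 * quadKernel s (x' i) (y' j))) (Set.Ioi 0) := fun i j =>
    (integral_quadKernel (hx' i) (Or.inl (hy' j))).1.const_mul _
  have E1 : ∑ i, ∑ j, ‖⟪a i, b j⟫_ℂ‖ ^ 2 * klKernel (x i) (y j) = ∫ s in Set.Ioi 0,
      ∑ i, ∑ j, ‖⟪a i, b j⟫_ℂ‖ ^ 2 * (s / (1 + s) ^ 2 * quadKernel s (x i) (y j)) := by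
    rw [integral_finsetSum _ fun i _ => integrable_finsetSum _ fun j _ => I1 i j]
    refine Finset.sum_congr rfl fun i _ => ?_
    rw [integral_finsetSum _ fun j _ => I1 i j]
    refine Finset.sum_congr rfl fun j _ => ?_
    rw [integral_const_mul, (integral_quadKernel (hx i) (hgood i j)).2]
  have E2 : ∑ i, ∑ j, ‖⟪a' i, b' j⟫_ℂ‖ ^ 2 * klKernel (x' i) (y' j) = ∫ s in Set.Ioi 0,
      ∑ i, ∑ j, ‖⟪a' i, b' j⟫_ℂ‖ ^ 2 * (s / (1 + s) ^ 2 * quadKernel s (x' i) (y' j)) := by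
    rw [integral_finsetSum _ fun i _ => integrable_finsetSum _ fun j _ => I2 i j]
    refine Finset.sum_congr rfl fun i _ => ?_
    rw [integral_finsetSum _ fun j _ => I2 i j]
    refine Finset.sum_congr rfl fun j _ => ?_
    rw [integral_const_mul, (integral_quadKernel (hx' i) (Or.inl (hy' j))).2]
  rw [E1, E2]
  refine setIntegral_mono_on (integrable_finsetSum _ fun i _ => integrable_finsetSum _
    fun j _ => I2 i j) (integrable_finsetSum _ fun i _ => integrable_finsetSum _
    fun j _ => I1 i j) measurableSet_Ioi fun s hs => ?_
  have hs' : 0 < s := hs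
  -- The Z that is optimal for the shifted pair serves as a trial operator for the original pair.
  obtain ⟨Z, hZ⟩ := exists_quadForm_eq hs' hA' hB' hx' (fun j => (hy' j).le)
  have h1 := quadForm_add_le hs' A B hC Z
  have h2 := quadForm_le hs' Z hA hB hx hy
  rw [hZ] at h1
  have h3 := mul_le_mul_of_nonneg_left (h1.trans h2) (by positivity : 0 ≤ s / (1 + s) ^ 2)
  simp only [Finset.mul_sum] at h3
  calc _ = _ := Finset.sum_congr rfl fun i _ => Finset.sum_congr rfl fun j _ => by ring
    _ ≤ _ := h3
    _ = _ := Finset.sum_congr rfl fun i _ => Finset.sum_congr rfl fun j _ => by ring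

end FiniteDimensional

/-! ### Klein's inequality and the entropy of a perturbed density operator -/

section FiniteDimensionalEntropy

variable {V : Type*} [NormedAddCommGroup V] [InnerProductSpace ℂ V] [FiniteDimensional ℂ V]
variable {κ κ' ι ι' : Type*} [Fintype κ] [Fintype κ'] [Fintype ι] [Fintype ι']

theorem sum_norm_inner_sq (a : OrthonormalBasis κ ℂ V) (y : V) :
    ∑ i, ‖⟪a i, y⟫_ℂ‖ ^ 2 = ‖y‖ ^ 2 := a.sum_sq_norm_inner_right y

theorem sum_norm_inner_sq_left (a : OrthonormalBasis κ ℂ V) (b : OrthonormalBasis κ' ℂ V)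
    (j : κ') : ∑ i, ‖⟪a i, b j⟫_ℂ‖ ^ 2 = 1 := by
  rw [sum_norm_inner_sq, b.orthonormal.1 j, one_pow]

theorem sum_norm_inner_sq_right (a : OrthonormalBasis κ ℂ V) (b : OrthonormalBasis κ' ℂ V)
    (i : κ) : ∑ j, ‖⟪a i, b j⟫_ℂ‖ ^ 2 = 1 := by
  simp_rw [norm_inner_symm (a i) (b _)]
  exact sum_norm_inner_sq_left b a i

namespace IsEigen

variable {A : V →ₗ[ℂ] V} {a : OrthonormalBasis κ ℂ V} {x : κ → ℝ}

theorem isSymmetric (h : IsEigen A a x) : A.IsSymmetric := by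
  intro y z
  rw [h.apply_eq_sum y, h.apply_eq_sum z, sum_inner, inner_sum]
  refine Finset.sum_congr rfl fun i _ => ?_
  rw [inner_smul_left, inner_smul_right, map_mul, Complex.conj_ofReal, inner_conj_symm]
  ring

theorem isPositive (h : IsEigen A a x) (hx : ∀ i, 0 ≤ x i) : A.IsPositive := by
  refine ⟨h.isSymmetric, fun y => ?_⟩
  rw [inner_re_symm]
  change 0 ≤ (⟪y, A y⟫_ℂ).re
  rw [h.re_inner_self]
  exact Finset.sum_nonneg fun i _ => mul_nonneg (hx i) (by positivity)

theorem re_inner_basis (h : IsEigen A a x) (i : κ) : (⟪a i, A (a i)⟫_ℂ).re = x i := by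
  rw [h i, inner_smul_right, inner_self_eq_norm_sq_to_K, a.orthonormal.1 i]; simp

theorem nonneg (h : IsEigen A a x) (hA : A.IsPositive) (i : κ) : 0 ≤ x i := by
  rw [← h.re_inner_basis i]
  simpa using hA.re_inner_nonneg_right (a i)

theorem sum_inner (h : IsEigen A a x) (b : OrthonormalBasis κ' ℂ V) :
    ∑ j, (⟪b j, A (b j)⟫_ℂ).re = ∑ i, x i := by
  simp_rw [h.re_inner_self]
  rw [Finset.sum_comm]
  refine Finset.sum_congr rfl fun i _ => ?_
  rw [← Finset.mul_sum, sum_norm_inner_sq_right, mul_one]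

theorem sum_klKernel (h : IsEigen A a x) (b : OrthonormalBasis κ' ℂ V) (y : κ' → ℝ) :
    ∑ i, ∑ j, ‖⟪a i, b j⟫_ℂ‖ ^ 2 * klKernel (x i) (y j) = ∑ i, x i * Real.log (x i)
      - ∑ j, Real.log (y j) * (⟪b j, A (b j)⟫_ℂ).re + ∑ j, y j - ∑ i, x i := by
  have e1 : ∑ i, ∑ j, ‖⟪a i, b j⟫_ℂ‖ ^ 2 * (x i * Real.log (x i)) =
      ∑ i, x i * Real.log (x i) := by
    refine Finset.sum_congr rfl fun i _ => ?_
    rw [← Finset.sum_mul, sum_norm_inner_sq_right, one_mul]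
  have e2 : ∑ i, ∑ j, ‖⟪a i, b j⟫_ℂ‖ ^ 2 * (x i * Real.log (y j)) =
      ∑ j, Real.log (y j) * (⟪b j, A (b j)⟫_ℂ).re := by
    rw [Finset.sum_comm]
    refine Finset.sum_congr rfl fun j _ => ?_
    rw [h.re_inner_self, Finset.mul_sum]
    exact Finset.sum_congr rfl fun i _ => by ring
  have e3 : ∑ i, ∑ j, ‖⟪a i, b j⟫_ℂ‖ ^ 2 * y j = ∑ j, y j := by
    rw [Finset.sum_comm]
    refine Finset.sum_congr rfl fun j _ => ?_
    rw [← Finset.sum_mul, sum_norm_inner_sq_left, one_mul]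
  have e4 : ∑ i, ∑ j, ‖⟪a i, b j⟫_ℂ‖ ^ 2 * x i = ∑ i, x i := by
    refine Finset.sum_congr rfl fun i _ => ?_
    rw [← Finset.sum_mul, sum_norm_inner_sq_right, one_mul]
  rw [← e1, ← e2, ← e3, ← e4]
  simp only [← Finset.sum_sub_distrib, ← Finset.sum_add_distrib]
  refine Finset.sum_congr rfl fun i _ => Finset.sum_congr rfl fun j _ => ?_
  unfold klKernel
  ring

/-- Klein's inequality. -/
theorem klein (h : IsEigen A a x) (hx : ∀ i, 0 ≤ x i) (b : OrthonormalBasis κ' ℂ V)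
    {y : κ' → ℝ} (hy : ∀ j, 0 < y j) {r W : ℝ} (hr : ∑ i, x i = r) (hW : ∑ j, y j = W)
    (hr0 : 0 < r) (hW0 : 0 < W) :
    r * Real.log r - r * Real.log W ≤ ∑ i, x i * Real.log (x i)
      - ∑ j, Real.log (y j) * (⟪b j, A (b j)⟫_ℂ).re := by
  -- Rescaling y to the total r makes the trace terms of the kernel cancel.
  have h1 := h.sum_klKernel b (fun j => r / W * y j)
  have h2 : 0 ≤ ∑ i, ∑ j, ‖⟪a i, b j⟫_ℂ‖ ^ 2 * klKernel (x i) (r / W * y j) :=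
    Finset.sum_nonneg fun i _ => Finset.sum_nonneg fun j _ => mul_nonneg (by positivity)
      (klKernel_nonneg (hx i) (mul_pos (by positivity) (hy j)))
  have e1 : ∑ j, Real.log (r / W * y j) * (⟪b j, A (b j)⟫_ℂ).re
      = r * Real.log r - r * Real.log W + ∑ j, Real.log (y j) * (⟪b j, A (b j)⟫_ℂ).re := by
    simp_rw [fun j => Real.log_mul (div_pos hr0 hW0).ne' (hy j).ne', add_mul]
    rw [Finset.sum_add_distrib, ← Finset.mul_sum, h.sum_inner, hr,
      Real.log_div hr0.ne' hW0.ne']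
    ring
  rw [e1, ← Finset.mul_sum, hW, hr, div_mul_cancel₀ _ hW0.ne'] at h1
  linarith

theorem add {B : V →ₗ[ℂ] V} {y : κ → ℝ} (h : IsEigen A a x) (hB : IsEigen B a y) :
    IsEigen (A + B) a (fun i => x i + y i) := fun i => by
  rw [LinearMap.add_apply, h i, hB i, ← add_smul]; simp

theorem smul (h : IsEigen A a x) (c : ℝ) : IsEigen ((c : ℂ) • A) a (fun i => c * x i) := fun i => by
  rw [LinearMap.smul_apply, h i, smul_smul]; simp

theorem eq {B : V →ₗ[ℂ] V} (h : IsEigen A a x) (hB : IsEigen B a x) : A = B :=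
  a.toBasis.ext fun i => by rw [a.coe_toBasis, h i, hB i]

end IsEigen

theorem isEigen_smul_id (a : OrthonormalBasis κ ℂ V) (c : ℝ) :
    IsEigen ((c : ℂ) • LinearMap.id) a (fun _ => c) := fun _ => rfl

/-- The operator with eigenvalues `x` in the orthonormal basis `a`. -/
def ofEigen (a : OrthonormalBasis κ ℂ V) (x : κ → ℝ) : V →ₗ[ℂ] V :=
  a.toBasis.constr ℂ fun i => (x i : ℂ) • a i

theorem isEigen_ofEigen (a : OrthonormalBasis κ ℂ V) (x : κ → ℝ) :
    IsEigen (ofEigen a x) a x := fun i => by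
  have := a.toBasis.constr_basis ℂ (fun i => (x i : ℂ) • a i) i
  rwa [a.coe_toBasis] at this

/-- Each xᵢ is at most the total and the logarithm is increasing: the entropy of the normalized
weights is nonnegative. -/
theorem sum_mul_log_le {x : κ → ℝ} (hx : ∀ i, 0 ≤ x i) :
    ∑ i, x i * Real.log (x i) ≤ (∑ i, x i) * Real.log (∑ i, x i) := by
  rw [Finset.sum_mul]
  refine Finset.sum_le_sum fun i _ => ?_
  rcases (hx i).eq_or_lt with h | h
  · simp [← h]
  · have : x i ≤ ∑ j, x j := Finset.single_le_sum (fun j _ => hx j) (Finset.mem_univ i)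
    gcongr

/-- A lower bound for the entropy of a positive operator `R` close to a multiple of a density
operator `S`, through the cross entropy with respect to `S + (δ / dim V) I`. -/
theorem IsEigen.le_entropy {R S Ω : V →ₗ[ℂ] V} (hS : S.IsPositive)
    {u : OrthonormalBasis κ ℂ V} {z : κ → ℝ} (hR : IsEigen R u z) (hz : ∀ i, 0 ≤ z i)
    {f : OrthonormalBasis κ' ℂ V} {ω : κ' → ℝ} (hΩ : IsEigen Ω f ω) {d : ℕ}
    (hd : Module.finrank ℂ V = d) (hd0 : 0 < d) {δ r ε : ℝ} (hδ : 0 < δ)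
    (hΩS : Ω = S + ((δ / d : ℝ) : ℂ) • LinearMap.id) (htrS : ∑ j, (⟪f j, S (f j)⟫_ℂ).re = 1)
    (hω : ∀ j, 0 < ω j) (hr : ∑ i, z i = r) (hr0 : 0 < r)
    (hε : ∀ (g : OrthonormalBasis (Fin (Module.finrank ℂ V)) ℂ V) (I : Finset _),
      ∑ i ∈ I, (⟪g i, (R - (r : ℂ) • S) (g i)⟫_ℂ).re ≤ ε) :
    -∑ j, Real.log (ω j) * (⟪f j, R (f j)⟫_ℂ).re
      - ε * (Real.log d + Real.log (1 + δ) - Real.log δ)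
      ≤ ∑ i, Real.negMulLog (z i) - Real.negMulLog r := by
  classical
  have hd' : (0 : ℝ) < d := by exact_mod_cast hd0
  have hd1 : (1 : ℝ) ≤ d := by exact_mod_cast hd0
  have hRsymm := hR.isSymmetric
  have hΔ : (R - (r : ℂ) • S).IsSymmetric :=
    hRsymm.sub (hS.isSymmetric.smul (by simp))
  obtain ⟨g, t, hg⟩ := exists_isEigen hΔ
  set p : Fin (Module.finrank ℂ V) → ℝ := fun i => max (t i) 0 with hp
  -- The hypothesis tested on the eigenvectors with positive eigenvalue is Tr (R - rS)_+ ≤ ε.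
  have hsum : ∑ i, p i ≤ ε := by
    have := hε g (Finset.univ.filter fun i => 0 < t i)
    simp_rw [hg.re_inner_basis] at this
    rw [Finset.sum_filter] at this
    refine le_trans (le_of_eq (Finset.sum_congr rfl fun i _ => ?_)) this
    simp only [hp]
    split_ifs with h
    · exact max_eq_left h.le
    · exact max_eq_right (not_lt.1 h)
  have hcard : ∀ c : ℝ, ∑ _i : Fin (Module.finrank ℂ V), c = d * c := fun c => by
    rw [Finset.sum_const, Finset.card_univ, Fintype.card_fin, hd, nsmul_eq_mul]
  have htr0 : ∑ i, t i = 0 := by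
    have h1 := hg.sum_inner f
    simp only [LinearMap.sub_apply, LinearMap.smul_apply, inner_sub_right, Complex.sub_re,
      inner_smul_right, Complex.re_ofReal_mul, Finset.sum_sub_distrib, ← Finset.mul_sum] at h1
    rw [htrS, hR.sum_inner, hr] at h1
    linarith
  have hωsum : ∑ j, ω j = 1 + δ := by
    have h1 := hΩ.sum_inner f
    rw [← h1, hΩS]
    simp only [LinearMap.add_apply, LinearMap.smul_apply, LinearMap.id_apply, inner_add_right,
      Complex.add_re, inner_smul_right, Complex.re_ofReal_mul, Finset.sum_add_distrib,
      ← Finset.mul_sum, htrS]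
    have h2 : ∑ j, (⟪f j, f j⟫_ℂ).re = d := by
      have : ∀ j, (⟪f j, f j⟫_ℂ).re = 1 := fun j => by
        rw [inner_self_eq_norm_sq_to_K, f.orthonormal.1 j]; simp
      simp_rw [this]
      rw [Finset.sum_const, Finset.card_univ, ← Module.finrank_eq_card_basis f.toBasis, hd]
      simp
    rw [h2, div_mul_cancel₀ _ hd'.ne']
  set c : ℝ := Real.log d + Real.log (1 + δ) - Real.log δ with hc
  have hc0 : 0 ≤ c := by
    have h1 := Real.log_nonneg hd1
    have h2 : Real.log δ ≤ Real.log (1 + δ) := Real.log_le_log hδ (by linarith)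
    rw [hc]; linarith
  -- the estimate with the positive and the negative part of `R - r S` shifted by `η > 0`
  have key : ∀ η : ℝ, 0 < η → -∑ j, Real.log (ω j) * (⟪f j, R (f j)⟫_ℂ).re
      - (∑ i, p i + d * η) * c ≤ ∑ i, Real.negMulLog (z i) - Real.negMulLog r := by
    intro η hη
    set τ : Fin (Module.finrank ℂ V) → ℝ := fun i => p i + η with hτ
    set n : Fin (Module.finrank ℂ V) → ℝ := fun i => p i - t i + η with hn
    have hτpos : ∀ i, 0 < τ i := fun i => by
      have : 0 ≤ p i := le_max_right _ _
      simp only [hτ]; linarith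
    have hnpos : ∀ i, 0 < n i := fun i => by
      have : t i ≤ p i := le_max_left _ _
      simp only [hn]; linarith
    set s : ℝ := ∑ i, p i + d * η with hs
    have hτs : ∑ i, τ i = s := by
      simp only [hτ, Finset.sum_add_distrib, hcard, hs]
    have hns : ∑ i, n i = s := by
      simp only [hn, Finset.sum_add_distrib, Finset.sum_sub_distrib, hcard, hs, htr0, sub_zero]
    have hs0 : 0 < s := by
      have : 0 ≤ ∑ i, p i := Finset.sum_nonneg fun i _ => le_max_right _ _
      have := mul_pos hd' hη
      linarith
    have hT := isEigen_ofEigen g τ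
    have hN := isEigen_ofEigen g n
    -- The left form of this operator separates Tr R log R from Tr N log N; the right form shares
    -- the summand rS with rΩ.
    have hTN : R + ofEigen g n = ofEigen g τ + (r : ℂ) • S := by
      have h1 : ofEigen g τ = ofEigen g n + (R - (r : ℂ) • S) := by
        refine hT.eq ?_
        convert hN.add hg using 1
        ext i
        simp only [hτ, hn]; ring
      rw [h1]; abel
    have hRpos := hR.isPositive hz
    have hNpos := hN.isPositive fun i => (hnpos i).le
    have hrS : ((r : ℂ) • S).IsPositive := by
      refine ⟨hS.isSymmetric.smul (by simp), fun y => ?_⟩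
      rw [LinearMap.smul_apply, inner_smul_left, Complex.conj_ofReal]
      have := hS.re_inner_nonneg_left y
      change 0 ≤ ((r : ℂ) * ⟪S y, y⟫_ℂ).re
      rw [Complex.re_ofReal_mul]
      exact mul_nonneg hr0.le (by simpa using this)
    obtain ⟨v, l, hX⟩ := exists_isEigen (hRsymm.add hN.isSymmetric)
    have hl : ∀ k, 0 < l k := by
      intro k
      rw [← hX.re_inner_basis k, LinearMap.add_apply, inner_add_right, Complex.add_re]
      have h1 : 0 ≤ (⟪v k, R (v k)⟫_ℂ).re := by
        simpa using hRpos.re_inner_nonneg_right (v k)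
      have h2 : 0 < (⟪v k, ofEigen g n (v k)⟫_ℂ).re := by
        rw [hN.re_inner_self]
        have h3 : ∑ i, η * ‖⟪g i, v k⟫_ℂ‖ ^ 2 ≤ ∑ i, n i * ‖⟪g i, v k⟫_ℂ‖ ^ 2 := by
          refine Finset.sum_le_sum fun i _ => ?_
          have : t i ≤ p i := le_max_left _ _
          have : η ≤ n i := by simp only [hn]; linarith
          gcongr
        rw [← Finset.mul_sum, sum_norm_inner_sq_left, mul_one] at h3
        linarith
      linarith
    have hXsum : ∑ k, l k = r + s := by
      rw [← hX.sum_inner g]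
      simp only [LinearMap.add_apply, inner_add_right, Complex.add_re, Finset.sum_add_distrib]
      rw [hR.sum_inner, hN.sum_inner, hr, hns]
    -- `D(R + N ‖ r Ω) ≤ D(T ‖ r δ / d)`
    have hB : IsEigen (((r * δ / d : ℝ) : ℂ) • (LinearMap.id : V →ₗ[ℂ] V)) g
        (fun _ => r * δ / d) := isEigen_smul_id g _
    have hB' : IsEigen (((r * δ / d : ℝ) : ℂ) • (LinearMap.id : V →ₗ[ℂ] V) + (r : ℂ) • S) f
        (fun j => r * ω j) := by
      convert hΩ.smul r using 1
      rw [hΩS, smul_add, smul_smul, add_comm]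
      congr 2
      push_cast
      ring
    have hX' : IsEigen (ofEigen g τ + (r : ℂ) • S) v l := hTN ▸ hX
    have D1 := sum_klKernel_add_le hrS hT hB hX' hB' (fun i => (hτpos i).le)
      (fun _ => by positivity) (Or.inr fun _ => by positivity) (fun k => (hl k).le)
      (fun j => mul_pos hr0 (hω j))
    rw [hX.sum_klKernel, hT.sum_klKernel, hXsum, hτs, hcard] at D1
    -- `Tr R log R ≤ Tr R log (R + N)`
    have h0 : IsEigen (0 : V →ₗ[ℂ] V) g (fun _ => 0) := fun i => by simp
    have hR0 : IsEigen (0 + R) u z := by rwa [zero_add]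
    have hX1 : IsEigen (ofEigen g n + R) v l := by rwa [add_comm]
    have D2 := sum_klKernel_add_le hRpos h0 hN hR0 hX1 (fun _ => le_rfl)
      (fun i => (hnpos i).le) (Or.inl fun _ => rfl) hz hl
    rw [hR.sum_klKernel, h0.sum_klKernel, hXsum, hns, hr] at D2
    -- `Tr N log N ≤ Tr N log (R + N)`
    have hN0 : IsEigen (0 + ofEigen g n) g n := by rwa [zero_add]
    have D3 := sum_klKernel_add_le hNpos h0 hR hN0 hX (fun _ => le_rfl) hz
      (Or.inl fun _ => rfl) (fun i => (hnpos i).le) hl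
    rw [hN.sum_klKernel, h0.sum_klKernel, hXsum, hns, hr] at D3
    simp only [LinearMap.zero_apply, inner_zero_right, Complex.zero_re, mul_zero, zero_mul,
      Finset.sum_const_zero, zero_add, sub_zero] at D2 D3
    -- Klein's inequality absorbs Tr N log Ω - Tr N log N; its term s log s cancels against the one
    -- bounding Tr T log T.
    have K := hN.klein (fun i => (hnpos i).le) f hω hns hωsum hs0 (by linarith)
    have L1 : ∑ k, l k * Real.log (l k) = ∑ k, Real.log (l k) * (⟪v k, R (v k)⟫_ℂ).re
        + ∑ k, Real.log (l k) * (⟪v k, ofEigen g n (v k)⟫_ℂ).re := by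
      rw [← Finset.sum_add_distrib]
      refine Finset.sum_congr rfl fun k _ => ?_
      rw [← mul_add, ← Complex.add_re, ← inner_add_right, ← LinearMap.add_apply,
        hX.re_inner_basis, mul_comm]
    have L2 : ∑ j, Real.log (r * ω j) * (⟪f j, (R + ofEigen g n) (f j)⟫_ℂ).re
        = Real.log r * (r + s) + ∑ j, Real.log (ω j) * (⟪f j, R (f j)⟫_ℂ).re
        + ∑ j, Real.log (ω j) * (⟪f j, ofEigen g n (f j)⟫_ℂ).re := by
      have h1 := hX.sum_inner f
      rw [hXsum] at h1
      rw [← h1, Finset.mul_sum, ← Finset.sum_add_distrib, ← Finset.sum_add_distrib]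
      refine Finset.sum_congr rfl fun j _ => ?_
      rw [Real.log_mul hr0.ne' (hω j).ne', LinearMap.add_apply, inner_add_right, Complex.add_re]
      ring
    have L3 : ∑ j, Real.log (r * δ / d) * (⟪g j, ofEigen g τ (g j)⟫_ℂ).re
        = (Real.log r + Real.log δ - Real.log d) * s := by
      rw [← Finset.mul_sum, hT.sum_inner, hτs, Real.log_div (by positivity) hd'.ne',
        Real.log_mul hr0.ne' hδ.ne']
    have L4 : (d : ℝ) * (r * δ / d) = r * δ := by field_simp
    have L5 : ∑ j, r * ω j = r * (1 + δ) := by rw [← Finset.mul_sum, hωsum]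
    have L6 := sum_mul_log_le fun i => (hτpos i).le
    rw [hτs] at L6
    have L7 : ∑ i, Real.negMulLog (z i) = -∑ i, z i * Real.log (z i) := by
      rw [← Finset.sum_neg_distrib]
      exact Finset.sum_congr rfl fun i _ => by unfold Real.negMulLog; ring
    have D1' : ∑ k, l k * Real.log (l k) - (Real.log r * (r + s)
        + ∑ j, Real.log (ω j) * (⟪f j, R (f j)⟫_ℂ).re
        + ∑ j, Real.log (ω j) * (⟪f j, ofEigen g n (f j)⟫_ℂ).re) + r * (1 + δ) - (r + s)
        ≤ s * Real.log s - (Real.log r + Real.log δ - Real.log d) * s + r * δ - s := by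
      rw [L2, L3, L4, L5] at D1
      linarith
    rw [L7, hc]
    unfold Real.negMulLog
    rw [L1] at D1'
    linarith
  refine le_of_forall_pos_le_add fun θ hθ => ?_
  -- The shift is chosen so that its cost dηc is at most θ; the 1 guards against c = 0.
  have h1 := key (θ / (d * (c + 1))) (by positivity)
  have h2 : d * (θ / (d * (c + 1))) * c ≤ θ := by
    rw [show d * (θ / (d * (c + 1))) * c = θ * (c / (c + 1)) by field_simp]
    exact mul_le_of_le_one_right hθ.le ((div_le_one (by linarith)).2 (by linarith))
  have h3 : (∑ i, p i) * c ≤ ε * c := by gcongr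
  rw [add_mul] at h1
  linarith

end FiniteDimensionalEntropy

/-! ### Compressing states to finite-dimensional subspaces -/

section Compression

variable {H : Type*} [NormedAddCommGroup H] [InnerProductSpace ℂ H] [CompleteSpace H]

theorem IsDiag.mul_norm_sq_le {ι : Type*} {T : H →L[ℂ] H} {b : HilbertBasis ι ℂ H} {x : ι → ℝ}
    (h : IsDiag T b x) (hT : T.IsPositive) (i : ι) (y : H) :
    x i * ‖⟪b i, y⟫_ℂ‖ ^ 2 ≤ (⟪y, T y⟫_ℂ).re :=
  le_hasSum (h.hasSum_inner_apply hT.isSymmetric y) i fun j _ =>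
    mul_nonneg (h.nonneg hT j) (by positivity)

/-- If g is not summable the right side is infinite, so only f has to converge. -/
theorem ofReal_tsum_le_of_le {ι : Type*} {f g : ι → ℝ} {c : ℝ} (hf : HasSum f c)
    (hg : ∀ i, 0 ≤ g i) (hfg : ∀ i, f i ≤ g i) :
    ENNReal.ofReal c ≤ ∑' i, ENNReal.ofReal (g i) := by
  by_cases hs : Summable g
  · rw [← ENNReal.ofReal_tsum_of_nonneg hg hs]
    exact ENNReal.ofReal_le_ofReal (hasSum_le hfg hf hs.hasSum)
  · have : ∑' i, ENNReal.ofReal (g i) = ⊤ := by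
      by_contra hne
      refine hs ?_
      have := ENNReal.summable_toReal hne
      simpa only [ENNReal.toReal_ofReal (hg _)] using this
    rw [this]; exact le_top

variable {V : Type*} [NormedAddCommGroup V] [InnerProductSpace ℂ V] [FiniteDimensional ℂ V]

/-- The entropy of a state is at least the (trace times normalized) entropy of its compression to
a finite-dimensional subspace. -/
theorem ofReal_entropy_compression_le {ρ : State H} {ι κ : Type*} [Fintype κ]
    {b : HilbertBasis ι ℂ H} {x : ι → ℝ} (hρ : IsDiag ρ.op b x) (J : V →ₗᵢ[ℂ] H)
    {R : V →ₗ[ℂ] V} (hR : ∀ y z, ⟪y, R z⟫_ℂ = ⟪J y, ρ.op (J z)⟫_ℂ)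
    {u : OrthonormalBasis κ ℂ V} {z : κ → ℝ} (hu : IsEigen R u z) {r : ℝ}
    (hr : ∑ k, z k = r) (hr0 : 0 < r) :
    ENNReal.ofReal (∑ k, Real.negMulLog (z k) - Real.negMulLog r)
      ≤ ∑' i, ENNReal.ofReal (Real.negMulLog (x i)) := by
  have hx := hρ.nonneg ρ.isPositive
  have hx1 := State.eigenvalue_le_one hρ
  have hz : ∀ k, z k = (⟪J (u k), ρ.op (J (u k))⟫_ℂ).re := fun k => by
    rw [← hR, hu.re_inner_basis]
  have hz0 : ∀ k, 0 ≤ z k := fun k => by rw [hz k]; exact ρ.re_inner_nonneg _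
  have hJu : Orthonormal ℂ (fun k => J (u k)) := u.orthonormal.comp_linearIsometry J
  let β : ι → κ → ℝ := fun i k => ‖⟪b i, J (u k)⟫_ℂ‖ ^ 2
  have hβ0 : ∀ i k, 0 ≤ β i k := fun i k => by positivity
  have hβ1 : ∀ i, ∑ k, β i k ≤ 1 := fun i => by
    have := hJu.sum_inner_products_le (b i) (s := Finset.univ)
    rw [b.orthonormal.1 i, one_pow] at this
    refine le_trans (le_of_eq (Finset.sum_congr rfl fun k _ => ?_)) this
    simp only [β]
    rw [norm_inner_symm]
  have hW : ∀ k, HasSum (fun i => x i * β i k) (z k) := fun k => by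
    rw [hz k]; exact hρ.hasSum_inner_apply ρ.isPositive.isSymmetric _
  -- Since ρ ≥ xᵢ |bᵢ⟩⟨bᵢ|, the compressed vector v of bᵢ satisfies R ≥ xᵢ |v⟩⟨v|. Testing this on w
  -- = R⁻¹v, with the inverse taken on the support of R, gives xᵢ m² ≤ m for m = ⟨v, R⁻¹ v⟩.
  have hc : ∀ i, x i * ∑ k, β i k / z k ≤ 1 := by
    intro i
    set m := ∑ k, β i k / z k with hm
    have hm0 : 0 ≤ m := Finset.sum_nonneg fun k _ => div_nonneg (hβ0 i k) (hz0 k)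
    let w : V := ∑ k, (starRingEnd ℂ ⟪b i, J (u k)⟫_ℂ * ((z k)⁻¹ : ℝ)) • u k
    have h1 : ⟪b i, J w⟫_ℂ = (m : ℂ) := by
      simp only [w, map_sum, map_smul, inner_sum, inner_smul_right, hm]
      push_cast
      refine Finset.sum_congr rfl fun k _ => ?_
      rw [mul_right_comm, Complex.conj_mul', div_eq_mul_inv]
      simp [β]
    have h2 : (⟪J w, ρ.op (J w)⟫_ℂ).re = m := by
      rw [← hR, hu.re_inner_self, hm]
      refine Finset.sum_congr rfl fun k _ => ?_
      have : ⟪u k, w⟫_ℂ = starRingEnd ℂ ⟪b i, J (u k)⟫_ℂ * ((z k)⁻¹ : ℝ) :=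
        u.orthonormal.inner_right_fintype _ k
      rw [this, norm_mul, RCLike.norm_conj, Complex.norm_real, Real.norm_eq_abs, mul_pow, sq_abs]
      simp only [β]
      by_cases h0 : z k = 0
      · simp [h0]
      · field_simp
    have h3 := hρ.mul_norm_sq_le ρ.isPositive i (J w)
    rw [h2, h1, Complex.norm_real, Real.norm_eq_abs, sq_abs] at h3
    rcases hm0.eq_or_lt with h0 | h0
    · rw [← h0]; simp
    · by_contra hcon
      push Not at hcon
      nlinarith
  have hW0 : ∀ k, z k = 0 → ∀ i, x i * β i k = 0 := by
    intro k hk i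
    have h1 := hW k
    rw [hk] at h1
    exact le_antisymm (le_hasSum h1 i fun j _ => mul_nonneg (hx j) (hβ0 j k))
      (mul_nonneg (hx i) (hβ0 i k))
  -- The tangent inequality for log at r xᵢ / zₖ, weighted by xᵢ βᵢₖ. The quadratic remainder is
  -- controlled by `hc`, and summation over i turns the weights into zₖ.
  have key : ∀ i, ∑ k, x i * β i k * (Real.log r + 1 - Real.log (z k)) - r * x i
      ≤ Real.negMulLog (x i) := by
    intro i
    rcases (hx i).eq_or_lt with h0 | h0
    · simp [← h0]
    have hterm : ∀ k, x i * β i k * (Real.log r + 1 - Real.log (z k))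
        ≤ x i * β i k * (-Real.log (x i)) + r * (x i * (x i * (β i k / z k))) := by
      intro k
      rcases (hz0 k).eq_or_lt with hk | hk
      · rw [hW0 k hk.symm i, ← hk]; simp
      · have h2 : Real.log (r * x i / z k) ≤ r * x i / z k - 1 :=
          Real.log_le_sub_one_of_pos (by positivity)
        rw [Real.log_div (by positivity) hk.ne', Real.log_mul hr0.ne' h0.ne'] at h2
        have h3 : 0 ≤ x i * β i k := mul_nonneg (hx i) (hβ0 i k)
        have h4 : r * (x i * (x i * (β i k / z k))) = x i * β i k * (r * x i / z k) := by
          field_simp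
        rw [h4, ← mul_add]
        exact mul_le_mul_of_nonneg_left (by linarith) h3
    have h5 := Finset.sum_le_sum fun k (_ : k ∈ Finset.univ) => hterm k
    rw [Finset.sum_add_distrib, ← Finset.sum_mul, ← Finset.mul_sum, ← Finset.mul_sum,
      ← Finset.mul_sum, ← Finset.mul_sum] at h5
    have h6 : r * (x i * (x i * ∑ k, β i k / z k)) ≤ r * x i := by
      have := mul_le_mul_of_nonneg_left (hc i) h0.le
      rw [mul_one] at this
      exact mul_le_mul_of_nonneg_left this hr0.le
    have h7 : x i * (∑ k, β i k) * (-Real.log (x i)) ≤ Real.negMulLog (x i) := by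
      have hl : 0 ≤ -Real.log (x i) := by linarith [Real.log_nonpos h0.le (hx1 i)]
      have : x i * (∑ k, β i k) ≤ x i := mul_le_of_le_one_right h0.le (hβ1 i)
      unfold Real.negMulLog
      nlinarith
    linarith
  refine ofReal_tsum_le_of_le ?_ (fun i => Real.negMulLog_nonneg (hx i) (hx1 i)) key
  have h1 : HasSum (fun i => ∑ k, x i * β i k * (Real.log r + 1 - Real.log (z k)) - r * x i)
      (∑ k, z k * (Real.log r + 1 - Real.log (z k)) - r * 1) :=
    (hasSum_sum fun k _ => (hW k).mul_right _).sub ((State.hasSum_eigenvalues hρ).mul_left r)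
  convert h1 using 1
  have h2 : ∑ k, z k * (Real.log r + 1 - Real.log (z k))
      = r * (Real.log r + 1) + ∑ k, Real.negMulLog (z k) := by
    rw [← hr, Finset.sum_mul, ← Finset.sum_add_distrib, hr]
    refine Finset.sum_congr rfl fun k _ => ?_
    unfold Real.negMulLog; ring
  rw [h2]
  unfold Real.negMulLog
  ring

/-- Testing the difference of two states with a finite-rank projector. -/
theorem sum_re_inner_sub_le (ρ σ : State H) {κ : Type*} {g : κ → H} (hg : Orthonormal ℂ g)
    (I : Finset κ) :
    ∑ i ∈ I, ((⟪g i, ρ.op (g i)⟫_ℂ).re - (⟪g i, σ.op (g i)⟫_ℂ).re)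
      ≤ 1 / 2 * ‖ρ.toTC - σ.toTC‖ := by
  classical
  obtain ⟨w, b, hw, hb⟩ := hg.toSubtypeRange.exists_hilbertBasis_extension
  let r : w → ℝ := fun v => (⟪b v, ρ.op (b v)⟫_ℂ).re - (⟪b v, σ.op (b v)⟫_ℂ).re
  -- In a full basis the diagonal differences sum to zero, so the sum of their positive parts is
  -- half the sum of their absolute values. This is the origin of the factor 1/2.
  have hr : HasSum r 0 := by simpa using (ρ.hasSum_inner b).sub (σ.hasSum_inner b)
  have hn := (ρ.toTC - σ.toTC).tsum_norm_inner_le b.orthonormal b.orthonormal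
  have hle : ∀ v, |r v| ≤ ‖⟪b v, (ρ.toTC - σ.toTC).toCLM (b v)⟫_ℂ‖ := by
    intro v
    refine le_trans (le_of_eq ?_) (Complex.abs_re_le_norm _)
    rw [map_sub, sub_apply, inner_sub_right, Complex.sub_re]
    rfl
  have habs : Summable fun v => |r v| := hn.1.of_nonneg_of_le (fun _ => abs_nonneg _) hle
  have h1 : ∑' v, |r v| ≤ ‖ρ.toTC - σ.toTC‖ := (habs.tsum_le_tsum hle hn.1).trans hn.2
  let j : κ → w := fun i => ⟨g i, hw ⟨i, rfl⟩⟩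
  have hj : Function.Injective j := fun i k h => hg.linearIndependent.injective
    (by simpa [j] using h)
  have h2 : ∑ i ∈ I, (r (j i) + |r (j i)|) ≤ ∑' v, |r v| := by
    have h3 : HasSum (fun v => r v + |r v|) (∑' v, |r v|) := by
      simpa using hr.add habs.hasSum
    rw [← Finset.sum_image (f := fun v => r v + |r v|) (fun a _ c _ h => hj h), ← h3.tsum_eq]
    exact h3.summable.sum_le_tsum _ fun v _ => by linarith [neg_abs_le (r v)]
  have h4 : ∑ i ∈ I, 2 * r (j i) ≤ ∑ i ∈ I, (r (j i) + |r (j i)|) :=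
    Finset.sum_le_sum fun i _ => by linarith [le_abs_self (r (j i))]
  rw [← Finset.mul_sum] at h4
  have h5 : ∑ i ∈ I, r (j i)
      = ∑ i ∈ I, ((⟪g i, ρ.op (g i)⟫_ℂ).re - (⟪g i, σ.op (g i)⟫_ℂ).re) := by
    refine Finset.sum_congr rfl fun i _ => ?_
    simp only [r, j, hb]
  rw [← h5]
  linarith

end Compression

/-! ### The energy of a state in terms of the resolvent -/

section Energy

variable {H : Type*} [NormedAddCommGroup H] [InnerProductSpace ℂ H] [CompleteSpace H]

namespace Hamiltonian

variable (K : Hamiltonian H)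

/-- The bounded operators `0 ≤ B ≤ K`. -/
def IsMinorant (B : H →L[ℂ] H) : Prop :=
  B.IsPositive ∧ ∀ ψ : K.op.domain, (⟪(ψ : H), B ψ⟫_ℂ).re ≤ (⟪(ψ : H), K.op ψ⟫_ℂ).re

/-- The energy `⟨ψ, K ψ⟩ ∈ [0, ∞]` of a vector. -/
def vecEnergy (ψ : H) : ℝ≥0∞ :=
  ⨆ (B : H →L[ℂ] H) (_ : K.IsMinorant B), ENNReal.ofReal (⟪ψ, B ψ⟫_ℂ).re

variable {K}

theorem le_vecEnergy {B : H →L[ℂ] H} (hB : K.IsMinorant B) (ψ : H) :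
    ENNReal.ofReal (⟪ψ, B ψ⟫_ℂ).re ≤ K.vecEnergy ψ :=
  le_iSup₂_of_le B hB le_rfl

theorem le_energy {B : H →L[ℂ] H} (hB : K.IsMinorant B) (ρ : H →L[ℂ] H) :
    ENNReal.ofReal (trace (B ∘L ρ)).re ≤ K.energy ρ :=
  le_iSup_of_le B <| le_iSup₂_of_le hB.1 hB.2 le_rfl

theorem energy_le {ρ : H →L[ℂ] H} {c : ℝ≥0∞}
    (h : ∀ B, K.IsMinorant B → ENNReal.ofReal (trace (B ∘L ρ)).re ≤ c) : K.energy ρ ≤ c :=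
  iSup_le fun B => iSup₂_le fun h1 h2 => h B ⟨h1, h2⟩

theorem ofReal_trace_comp {ρ : State H} {ι : Type*} {b : HilbertBasis ι ℂ H} {x : ι → ℝ}
    (h : IsDiag ρ.op b x) {B : H →L[ℂ] H} (hB : B.IsPositive) :
    ENNReal.ofReal (trace (B ∘L ρ.op)).re
      = ∑' i, ENNReal.ofReal (x i) * ENNReal.ofReal (⟪b i, B (b i)⟫_ℂ).re := by
  have h0 : ∀ i, 0 ≤ x i := h.nonneg ρ.isPositive
  have h1 : HasSum (fun i => x i * (⟪b i, B (b i)⟫_ℂ).re) (trace (B ∘L ρ.op)).re := by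
    have := Complex.hasSum_re (ρ.toTC.hasSum_trace_comp h B)
    simp only [Complex.re_ofReal_mul] at this
    exact this
  have h2 : ∀ i, 0 ≤ (⟪b i, B (b i)⟫_ℂ).re := fun i =>
    (Complex.nonneg_iff.1 (inner_nonneg_of_isPositive hB (b i))).1
  rw [← h1.tsum_eq, ENNReal.ofReal_tsum_of_nonneg (fun i => mul_nonneg (h0 i) (h2 i)) h1.summable]
  exact tsum_congr fun i => ENNReal.ofReal_mul (h0 i)

/-- The easy half: the supremum of a sum is at most the sum of the suprema. -/
theorem energy_le_tsum {ρ : State H} {ι : Type*} {b : HilbertBasis ι ℂ H} {x : ι → ℝ}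
    (h : IsDiag ρ.op b x) : K.energy ρ.op ≤ ∑' i, ENNReal.ofReal (x i) * K.vecEnergy (b i) := by
  refine energy_le fun B hB => ?_
  rw [ofReal_trace_comp h hB.1]
  exact ENNReal.tsum_le_tsum fun i => by gcongr; exact le_vecEnergy hB _

theorem inner_op_comm (u v : K.op.domain) : ⟪K.op u, (v : H)⟫_ℂ = ⟪(u : H), K.op v⟫_ℂ := by
  have h := LinearPMap.adjoint_isFormalAdjoint K.selfAdjoint.dense_domain
  have e : K.op.adjoint = K.op := K.selfAdjoint
  rw [e] at h
  exact h u v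

namespace IsInvOneAdd

variable {R : H →L[ℂ] H}

theorem exists_repr (hR : K.IsInvOneAdd R) (x : H) : ∃ u : K.op.domain, (u : H) = R x ∧ x = u + K.op u :=
  let ⟨h, e⟩ := hR x
  ⟨⟨R x, h⟩, rfl, e.symm⟩

/-- I + K is injective because K is positive. -/
theorem apply_add (hR : K.IsInvOneAdd R) (u : K.op.domain) : R (u + K.op u) = u := by
  obtain ⟨v, hv, e⟩ := hR.exists_repr (u + K.op u)
  have h1 : ((u - v : K.op.domain) : H) + K.op (u - v) = 0 := by
    rw [LinearPMap.map_sub, Submodule.coe_sub]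
    rw [show (u : H) - v + (K.op u - K.op v) = (u + K.op u) - (v + K.op v) by abel, ← e, sub_self]
  have h2 := K.nonneg (u - v)
  have h3 : K.op (u - v) = -((u - v : K.op.domain) : H) := by
    rw [eq_neg_iff_add_eq_zero, add_comm]; exact h1
  rw [h3, inner_neg_right, inner_self_eq_norm_sq_to_K] at h2
  have h4 : ‖((u - v : K.op.domain) : H)‖ ^ 2 ≤ 0 := by
    have : (-((‖((u - v : K.op.domain) : H)‖ : ℂ) ^ 2)).re
      = -(‖((u - v : K.op.domain) : H)‖ ^ 2) := by
      rw [Complex.neg_re, ← Complex.ofReal_pow, Complex.ofReal_re]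
    have h2' := h2
    simp only [Complex.coe_algebraMap] at h2'
    linarith [this ▸ h2']
  have h5 : ((u - v : K.op.domain) : H) = 0 := by
    rw [← norm_eq_zero]; nlinarith [norm_nonneg ((u - v : K.op.domain) : H)]
  rw [← hv]
  rw [Submodule.coe_sub, sub_eq_zero] at h5
  exact h5.symm

theorem isPositive (hR : K.IsInvOneAdd R) : R.IsPositive := by
  have key : ∀ x y : H, ⟪R x, y⟫_ℂ = ⟪x, R y⟫_ℂ := by
    intro x y
    obtain ⟨u, hu, ex⟩ := hR.exists_repr x
    obtain ⟨v, hv, ey⟩ := hR.exists_repr y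
    rw [← hu, ← hv, ex, ey, inner_add_left, inner_add_right, inner_op_comm]
  refine ⟨key, fun x => ?_⟩
  rw [ContinuousLinearMap.reApplyInnerSelf_apply]
  obtain ⟨u, hu, ex⟩ := hR.exists_repr x
  rw [← hu, ex, inner_add_right, map_add]
  exact add_nonneg inner_self_nonneg (K.nonneg u)

theorem norm_apply_le (hR : K.IsInvOneAdd R) (x : H) : ‖R x‖ ≤ ‖x‖ := by
  obtain ⟨u, hu, ex⟩ := hR.exists_repr x
  rw [← hu]
  have h := K.nonneg u
  have h2 : ‖x‖ ^ 2 = ‖(u : H)‖ ^ 2 + 2 * (⟪(u : H), K.op u⟫_ℂ).re + ‖K.op u‖ ^ 2 := by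
    conv_lhs => rw [ex]
    exact norm_add_sq (𝕜 := ℂ) (u : H) (K.op u)
  exact abs_le_of_sq_le_sq' (by nlinarith [sq_nonneg ‖K.op u‖]) (norm_nonneg x) |>.2

theorem spectrum_subset (hR : K.IsInvOneAdd R) {x : ℝ} (hx : x ∈ spectrum ℝ R) : 0 ≤ x ∧ x ≤ 1 := by
  have h0 : 0 ≤ R := (ContinuousLinearMap.nonneg_iff_isPositive R).2 hR.isPositive
  refine ⟨spectrum_nonneg_of_nonneg h0 hx, ?_⟩
  cases subsingleton_or_nontrivial H
  · exact absurd hx (by simp [spectrum.of_subsingleton])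
  have h1 := spectrum.norm_le_norm_of_mem hx
  have h2 : ‖R‖ ≤ 1 := R.opNorm_le_bound zero_le_one fun x => by
    simpa using hR.norm_apply_le x
  exact (le_abs_self x).trans (h1.trans h2)

theorem re_inner_cfc_le (hR : K.IsInvOneAdd R) {f g : ℝ → ℝ} (hf : Continuous f) (hg : Continuous g)
    (h : ∀ x, 0 ≤ x → x ≤ 1 → f x ≤ g x) (ψ : H) :
    (⟪ψ, cfc f R ψ⟫_ℂ).re ≤ (⟪ψ, cfc g R ψ⟫_ℂ).re := by
  have h1 : cfc f R ≤ cfc g R := cfc_mono (fun x hx => h x (hR.spectrum_subset hx).1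
    (hR.spectrum_subset hx).2) hf.continuousOn hg.continuousOn
  have h2 := (Complex.nonneg_iff.1 (inner_nonneg_of_isPositive
    ((ContinuousLinearMap.le_def _ _).1 h1) ψ)).1
  rw [sub_apply, inner_sub_right, Complex.sub_re] at h2
  linarith

/-- The bounded minorants `(1 - R)(R + 1/(n+1))⁻¹` of `K = (1 - R) R⁻¹`. -/
def approx (R : H →L[ℂ] H) (n : ℕ) : H →L[ℂ] H :=
  cfc (fun x : ℝ => (1 - x) / (|x| + 1 / (n + 1))) R

theorem continuous_div_abs_add {f : ℝ → ℝ} (hf : Continuous f) (n : ℕ) :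
    Continuous fun x : ℝ => f x / (|x| + 1 / (n + 1)) :=
  hf.div (by fun_prop) fun x => by positivity

/-- Vectors of the domain have the form Rφ. In terms of φ the claim is the inequality x²(1-x)/(x+c)
≤ x(1-x) on [0, 1], with c = 1/(n+1), under the functional calculus of R. -/
theorem isMinorant_approx (hR : K.IsInvOneAdd R) (n : ℕ) : K.IsMinorant (approx R n) := by
  have hs : IsSelfAdjoint R := hR.isPositive.isSelfAdjoint
  have hc := continuous_div_abs_add (f := fun x => 1 - x) (by fun_prop) n
  constructor
  · refine (ContinuousLinearMap.nonneg_iff_isPositive _).1 (cfc_nonneg fun x hx => ?_)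
    have := hR.spectrum_subset hx
    have h1 : 0 ≤ 1 - x := by linarith
    positivity
  · intro u
    set φ : H := u + K.op u with hφ
    have hu : (u : H) = R φ := (hR.apply_add u).symm
    have hK : K.op u = φ - R φ := by rw [← hu, hφ]; abel
    have e1 : ⟪(u : H), approx R n u⟫_ℂ
        = ⟪φ, cfc (fun x : ℝ => x * ((1 - x) / (|x| + 1 / (n + 1)) * x)) R φ⟫_ℂ := by
      rw [cfc_mul _ _ R (by fun_prop (disch := intros; positivity)) (by fun_prop (disch := intros; positivity)), cfc_mul _ _ R (by fun_prop (disch := intros; positivity)) (by fun_prop (disch := intros; positivity)),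
        cfc_id' ℝ R, hu, hR.isPositive.isSymmetric.apply_clm φ]
      rfl
    have e2 : ⟪(u : H), K.op u⟫_ℂ = ⟪φ, cfc (fun x : ℝ => x * (1 - x)) R φ⟫_ℂ := by
      rw [cfc_mul _ _ R (by fun_prop (disch := intros; positivity)) (by fun_prop (disch := intros; positivity)), cfc_sub _ _ R (by fun_prop (disch := intros; positivity)) (by fun_prop (disch := intros; positivity)),
        cfc_const_one ℝ R, cfc_id' ℝ R, hu, hK, hR.isPositive.isSymmetric.apply_clm φ]
      rfl
    rw [e1, e2]
    refine hR.re_inner_cfc_le (by fun_prop (disch := intros; positivity)) (by fun_prop) (fun x h0 h1 => ?_) φ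
    have hd : 0 < |x| + 1 / ((n : ℝ) + 1) := by positivity
    rw [abs_of_nonneg h0] at hd ⊢
    refine mul_le_mul_of_nonneg_left ?_ h0
    rw [div_mul_eq_mul_div, div_le_iff₀ hd]
    refine mul_le_mul_of_nonneg_left ?_ (by linarith)
    have : 0 ≤ 1 / ((n : ℝ) + 1) := by positivity
    linarith

theorem re_inner_approx_mono (hR : K.IsInvOneAdd R) (ψ : H) :
    Monotone fun n : ℕ => (⟪ψ, approx R n ψ⟫_ℂ).re := by
  intro m n hmn
  refine hR.re_inner_cfc_le (continuous_div_abs_add (by fun_prop) m)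
    (continuous_div_abs_add (by fun_prop) n) (fun x h0 h1 => ?_) ψ
  have : (m : ℝ) ≤ n := by exact_mod_cast hmn
  gcongr

/-- The bounded operators `R (R + 1/(n+1))⁻¹`, which tend to the identity. -/
def approxOne (R : H →L[ℂ] H) (n : ℕ) : H →L[ℂ] H :=
  cfc (fun x : ℝ => x / (|x| + 1 / (n + 1))) R

/-- The operators are contractions and converge at the rate 1/(n+1) on the range of R, which is the
dense domain of K. -/
theorem tendsto_approxOne (hR : K.IsInvOneAdd R) (ψ : H) :
    Tendsto (fun n => approxOne R n ψ) atTop (𝓝 ψ) := by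
  have hs : IsSelfAdjoint R := hR.isPositive.isSelfAdjoint
  have hc := fun n => continuous_div_abs_add (f := fun x => x) (by fun_prop) n
  have n1 : ∀ n, ‖approxOne R n‖ ≤ 1 := fun n => by
    refine norm_cfc_le zero_le_one fun x hx => ?_
    have h := hR.spectrum_subset hx
    have hd : 0 < |x| + 1 / ((n : ℝ) + 1) := by positivity
    rw [Real.norm_of_nonneg (div_nonneg h.1 hd.le), div_le_one hd, abs_of_nonneg h.1]
    have : 0 ≤ 1 / ((n : ℝ) + 1) := by positivity
    linarith
  have n2 : ∀ (n : ℕ) (φ : H), ‖approxOne R n (R φ) - R φ‖ ≤ 1 / ((n : ℝ) + 1) * ‖φ‖ := by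
    intro n φ
    have e : approxOne R n (R φ) - R φ
        = cfc (fun x : ℝ => x / (|x| + 1 / (n + 1)) * x - x) R φ := by
      rw [cfc_sub _ _ R (by fun_prop (disch := intros; positivity)) (by fun_prop (disch := intros; positivity)), cfc_mul _ _ R (by fun_prop (disch := intros; positivity)) (by fun_prop (disch := intros; positivity)),
        cfc_id' ℝ R]
      rfl
    rw [e]
    refine ContinuousLinearMap.le_of_opNorm_le _ (norm_cfc_le (by positivity) fun x hx => ?_) φ
    have h := hR.spectrum_subset hx
    have hd : 0 < |x| + 1 / ((n : ℝ) + 1) := by positivity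
    rw [abs_of_nonneg h.1] at hd ⊢
    have h3 : x / (x + 1 / ((n : ℝ) + 1)) * x - x
        = -(x / (x + 1 / ((n : ℝ) + 1)) * (1 / ((n : ℝ) + 1))) := by
      have hd' := hd.ne'
      generalize 1 / ((n : ℝ) + 1) = c at hd' ⊢
      field_simp; ring
    rw [h3, norm_neg, Real.norm_of_nonneg (by have := h.1; positivity)]
    refine mul_le_of_le_one_left (by positivity) ?_
    rw [div_le_one hd]
    have : 0 ≤ 1 / ((n : ℝ) + 1) := by positivity
    linarith
  rw [Metric.tendsto_atTop]
  intro ε hε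
  obtain ⟨u, hu, hd⟩ := Metric.dense_iff.1 K.selfAdjoint.dense_domain ψ (ε / 4) (by positivity)
  obtain ⟨φ, rfl⟩ : ∃ φ, u = R φ := ⟨_, (hR.apply_add ⟨u, hd⟩).symm⟩
  have lim : Tendsto (fun n : ℕ => 1 / ((n : ℝ) + 1) * ‖φ‖) atTop (𝓝 0) := by
    simpa using tendsto_one_div_add_atTop_nhds_zero_nat.mul_const ‖φ‖
  obtain ⟨N, hN⟩ := Metric.tendsto_atTop.1 lim (ε / 4) (by positivity)
  refine ⟨N, fun n hn => ?_⟩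
  have h1 := hN n hn
  rw [Real.dist_0_eq_abs, abs_of_nonneg (by positivity)] at h1
  rw [Metric.mem_ball, dist_eq_norm] at hu
  have h2 : ‖approxOne R n (ψ - R φ)‖ ≤ ‖ψ - R φ‖ := by
    simpa using (approxOne R n).le_of_opNorm_le (n1 n) (ψ - R φ)
  rw [norm_sub_rev] at h2
  rw [dist_eq_norm]
  calc ‖approxOne R n ψ - ψ‖
      = ‖approxOne R n (ψ - R φ) + (approxOne R n (R φ) - R φ) + (R φ - ψ)‖ := by
        rw [map_sub]; congr 1; abel
    _ ≤ ‖approxOne R n (ψ - R φ)‖ + ‖approxOne R n (R φ) - R φ‖ + ‖R φ - ψ‖ := norm_add₃_le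
    _ < ε := by
      have := n2 n φ
      linarith

/-- The regularized vector R(R+c)⁻¹ψ lies in the domain, where B ≤ K may be used; what remains is
x(1-x)/(x+c)² ≤ (1-x)/(x+c). -/
theorem re_inner_approxOne_le (hR : K.IsInvOneAdd R) {B : H →L[ℂ] H} (hB : K.IsMinorant B) (n : ℕ)
    (ψ : H) : (⟪approxOne R n ψ, B (approxOne R n ψ)⟫_ℂ).re ≤ (⟪ψ, approx R n ψ⟫_ℂ).re := by
  have hs : IsSelfAdjoint R := hR.isPositive.isSelfAdjoint
  have hc := continuous_div_abs_add (f := fun x => 1) (by fun_prop) n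
  set k := cfc (fun x : ℝ => 1 / (|x| + 1 / (n + 1))) R with hk
  have hks : (k : H →ₗ[ℂ] H).IsSymmetric :=
    (ContinuousLinearMap.isSelfAdjoint_iff_isSymmetric).1 (cfc_predicate _ R)
  have e : approxOne R n ψ = R (k ψ) := by
    have : approxOne R n = R * k := by
      conv_rhs => rw [hk]; enter [1]; rw [← cfc_id' ℝ R]
      rw [← cfc_mul _ _ R (by fun_prop (disch := intros; positivity)) (by fun_prop (disch := intros; positivity))]
      refine cfc_congr fun x _ => ?_
      simp [div_eq_mul_inv]
    rw [this]; rfl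
  obtain ⟨u, hu, ek⟩ := hR.exists_repr (k ψ)
  have hK : K.op u = k ψ - R (k ψ) := by
    rw [hu] at ek; exact eq_sub_of_add_eq' ek.symm
  rw [e, ← hu]
  refine (hB.2 u).trans ?_
  have e2 : ⟪(u : H), K.op u⟫_ℂ = ⟪ψ, cfc (fun x : ℝ => 1 / (|x| + 1 / (n + 1)) *
      (x * ((1 - x) * (1 / (|x| + 1 / (n + 1)))))) R ψ⟫_ℂ := by
    rw [cfc_mul _ _ R (by fun_prop (disch := intros; positivity)) (by fun_prop (disch := intros; positivity)), cfc_mul _ _ R (by fun_prop (disch := intros; positivity)) (by fun_prop (disch := intros; positivity)),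
      cfc_mul _ _ R (by fun_prop (disch := intros; positivity)) (by fun_prop (disch := intros; positivity)),
      cfc_sub _ _ R (by fun_prop (disch := intros; positivity)) (by fun_prop (disch := intros; positivity)), cfc_const_one ℝ R, cfc_id' ℝ R, hu, hK, ← hk,
      hR.isPositive.isSymmetric.apply_clm (k ψ), hks.apply_clm ψ]
    rfl
  rw [e2]
  refine hR.re_inner_cfc_le (by fun_prop (disch := intros; positivity)) (continuous_div_abs_add (by fun_prop) n)
    (fun x h0 h1 => ?_) ψ
  have hd : 0 < |x| + 1 / ((n : ℝ) + 1) := by positivity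
  rw [abs_of_nonneg h0] at hd ⊢
  have h3 : 1 / (x + 1 / ((n : ℝ) + 1)) * (x * ((1 - x) * (1 / (x + 1 / ((n : ℝ) + 1)))))
      = (1 - x) / (x + 1 / ((n : ℝ) + 1)) * (x / (x + 1 / ((n : ℝ) + 1))) := by ring
  rw [h3]
  refine mul_le_of_le_one_right (div_nonneg (by linarith) hd.le) ?_
  rw [div_le_one hd]
  have : 0 ≤ 1 / ((n : ℝ) + 1) := by positivity
  linarith

/-- The supremum over all minorants is that of a single increasing sequence, and such suprema
commute with finite sums. This makes the energy additive in the spectral decomposition. -/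
theorem vecEnergy_eq_iSup (hR : K.IsInvOneAdd R) (ψ : H) :
    K.vecEnergy ψ = ⨆ n : ℕ, ENNReal.ofReal (⟪ψ, approx R n ψ⟫_ℂ).re := by
  refine le_antisymm (iSup₂_le fun B hB => ?_)
    (iSup_le fun n => le_vecEnergy (hR.isMinorant_approx n) ψ)
  have lim : Tendsto (fun n => ENNReal.ofReal
      (⟪approxOne R n ψ, B (approxOne R n ψ)⟫_ℂ).re) atTop (𝓝 (ENNReal.ofReal (⟪ψ, B ψ⟫_ℂ).re)) :=
    ENNReal.tendsto_ofReal ((Complex.continuous_re.tendsto _).comp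
      ((hR.tendsto_approxOne ψ).inner ((B.continuous.tendsto _).comp (hR.tendsto_approxOne ψ))))
  refine le_of_tendsto lim (Eventually.of_forall fun n => ?_)
  exact (ENNReal.ofReal_le_ofReal (hR.re_inner_approxOne_le hB n ψ)).trans
    (le_iSup (fun n : ℕ => ENNReal.ofReal (⟪ψ, approx R n ψ⟫_ℂ).re) n)

theorem tsum_le_energy (hR : K.IsInvOneAdd R) {ρ : State H} {ι : Type*} {b : HilbertBasis ι ℂ H}
    {x : ι → ℝ} (h : IsDiag ρ.op b x) :
    ∑' i, ENNReal.ofReal (x i) * K.vecEnergy (b i) ≤ K.energy ρ.op := by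
  rw [ENNReal.tsum_eq_iSup_sum]
  refine iSup_le fun s => ?_
  simp only [hR.vecEnergy_eq_iSup, ENNReal.mul_iSup]
  rw [ENNReal.finsetSum_iSup_of_monotone]
  · refine iSup_le fun n => le_trans ?_ (le_energy (hR.isMinorant_approx n) ρ.op)
    rw [ofReal_trace_comp h (hR.isMinorant_approx n).1]
    exact ENNReal.sum_le_tsum s
  · intro i m n hmn
    dsimp only
    gcongr _ * ENNReal.ofReal ?_
    exact hR.re_inner_approx_mono (b i) hmn

theorem energy_eq_tsum (hR : K.IsInvOneAdd R) {ρ : State H} {ι : Type*} {b : HilbertBasis ι ℂ H}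
    {x : ι → ℝ} (h : IsDiag ρ.op b x) :
    K.energy ρ.op = ∑' i, ENNReal.ofReal (x i) * K.vecEnergy (b i) :=
  le_antisymm (energy_le_tsum h) (hR.tsum_le_energy h)

end IsInvOneAdd

end Hamiltonian

end Energy

/-! ### Consequences of an admissible entropy bound -/

section EntropyBound

variable {H : Type*} [NormedAddCommGroup H] [InnerProductSpace ℂ H] [CompleteSpace H]

namespace Hamiltonian

variable {K : Hamiltonian H}

theorem groundEnergy_nonneg : 0 ≤ K.groundEnergy := Real.iInf_nonneg fun φ => K.nonneg φ.1

theorem groundEnergy_mul_le (u : K.op.domain) :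
    K.groundEnergy * ‖(u : H)‖ ^ 2 ≤ (⟪(u : H), K.op u⟫_ℂ).re := by
  by_cases hu : (u : H) = 0
  · rw [hu]; simp
  have hn : ‖(u : H)‖ ≠ 0 := norm_ne_zero_iff.2 hu
  have h1 : ‖((((‖(u : H)‖⁻¹ : ℝ) : ℂ) • u : K.op.domain) : H)‖ = 1 := by
    rw [Submodule.coe_smul, norm_smul, Complex.norm_real]; simp [hn]
  have h := ciInf_le (f := fun φ : {φ : K.op.domain // ‖(φ : H)‖ = 1} =>
    (⟪((φ : K.op.domain) : H), K.op φ⟫_ℂ).re)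
    ⟨0, by rintro _ ⟨φ, rfl⟩; exact K.nonneg φ.1⟩ ⟨((‖(u : H)‖⁻¹ : ℝ) : ℂ) • u, h1⟩
  have h2 : (⟪((((‖(u : H)‖⁻¹ : ℝ) : ℂ) • u : K.op.domain) : H),
      K.op (((‖(u : H)‖⁻¹ : ℝ) : ℂ) • u)⟫_ℂ).re
      = ‖(u : H)‖⁻¹ * (‖(u : H)‖⁻¹ * (⟪(u : H), K.op u⟫_ℂ).re) := by
    rw [LinearPMap.map_smul, Submodule.coe_smul, inner_smul_left, inner_smul_right,
      Complex.conj_ofReal, Complex.re_ofReal_mul, Complex.re_ofReal_mul]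
  have h3 : K.groundEnergy ≤ ‖(u : H)‖⁻¹ * (‖(u : H)‖⁻¹ * (⟪(u : H), K.op u⟫_ℂ).re) := by
    rw [← h2]; exact h
  calc K.groundEnergy * ‖(u : H)‖ ^ 2
      ≤ ‖(u : H)‖⁻¹ * (‖(u : H)‖⁻¹ * (⟪(u : H), K.op u⟫_ℂ).re) * ‖(u : H)‖ ^ 2 := by gcongr
    _ = _ := by field_simp

/-- The operator E₀ I is itself a bounded minorant of K. -/
theorem ofReal_groundEnergy_le (ρ : State H) :
    ENNReal.ofReal K.groundEnergy ≤ K.energy ρ.op := by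
  have hB : K.IsMinorant ((K.groundEnergy : ℂ) • ContinuousLinearMap.id ℂ H) := by
    have e : ∀ y : H, ⟪y, ((K.groundEnergy : ℂ) • ContinuousLinearMap.id ℂ H) y⟫_ℂ
        = ((K.groundEnergy * ‖y‖ ^ 2 : ℝ) : ℂ) := fun y => by
      rw [smul_apply, ContinuousLinearMap.id_apply, inner_smul_right, inner_self_eq_norm_sq_to_K]
      push_cast; rfl
    refine ⟨isPositive_of_inner_nonneg fun y => ?_, fun u => ?_⟩
    · rw [e]
      exact_mod_cast mul_nonneg groundEnergy_nonneg (by positivity)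
    · rw [e, Complex.ofReal_re]
      exact groundEnergy_mul_le u
  refine le_trans (le_of_eq ?_) (le_energy hB ρ.op)
  obtain ⟨w, hw, hd⟩ := ρ.exists_isDiag
  have h := ρ.toTC.hasSum_trace_comp hd ((K.groundEnergy : ℂ) • ContinuousLinearMap.id ℂ H)
  have h' := ρ.toTC.hasSum_trace_comp hd (ContinuousLinearMap.id ℂ H)
  have e1 : trace (((K.groundEnergy : ℂ) • ContinuousLinearMap.id ℂ H) ∘L ρ.op)
      = (K.groundEnergy : ℂ) * 1 := by
    rw [← ρ.trace_op]
    refine h.unique ?_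
    have := h'.mul_left (K.groundEnergy : ℂ)
    rw [ContinuousLinearMap.id_comp] at this
    have e : (fun i : w => (((⟪(i : H), ρ.op i⟫_ℂ).re : ℝ) : ℂ) *
        ⟪hw.basis i, ((K.groundEnergy : ℂ) • ContinuousLinearMap.id ℂ H) (hw.basis i)⟫_ℂ)
        = fun i : w => (K.groundEnergy : ℂ) * ((((⟪(i : H), ρ.op i⟫_ℂ).re : ℝ) : ℂ) *
        ⟪hw.basis i, ContinuousLinearMap.id ℂ H (hw.basis i)⟫_ℂ) := by
      funext i
      rw [smul_apply, inner_smul_right]; ring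
    rw [e]
    exact this
  rw [e1, mul_one, Complex.ofReal_re]

namespace IsEntropyBound

variable {F : ℝ → ℝ}

theorem concaveOn (hF : K.IsEntropyBound F) : ConcaveOn ℝ (Set.Ici 0) F := by
  refine concaveOn_of_deriv2_nonpos (convex_Ici 0) hF.continuousOn ?_ ?_ ?_
  · rw [interior_Ici]; exact hF.contDiffOn.differentiableOn (by norm_num)
  · rw [interior_Ici]
    exact ((contDiffOn_succ_iff_deriv_of_isOpen (n := 1) isOpen_Ioi).1
      (by exact_mod_cast hF.contDiffOn)).2.2.differentiableOn (by norm_num)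
  · intro x hx
    rw [interior_Ici] at hx
    exact hF.deriv_deriv_nonpos x hx

theorem monotoneOn (hF : K.IsEntropyBound F) : MonotoneOn F (Set.Ici 0) := by
  refine monotoneOn_of_deriv_nonneg (convex_Ici 0) hF.continuousOn ?_ ?_
  · rw [interior_Ici]; exact hF.contDiffOn.differentiableOn (by norm_num)
  · intro x hx
    rw [interior_Ici] at hx
    exact (hF.deriv_pos x hx).le

theorem nonneg_zero (hF : K.IsEntropyBound F) : 0 ≤ F 0 := by
  have h : Tendsto F (𝓝[>] 0) (𝓝 (F 0)) :=
    (hF.continuousOn 0 Set.self_mem_Ici).mono_left (nhdsWithin_mono _ Set.Ioi_subset_Ici_self)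
  exact ge_of_tendsto h (eventually_nhdsWithin_of_forall fun x hx => (hF.pos x hx).le)

/-- The perspective δ ↦ δF(E/δ) of a concave F with F(0) ≥ 0 is increasing. -/
theorem mul_div_le (hF : K.IsEntropyBound F) {δ θ E : ℝ} (hδ : 0 < δ) (hθ : δ ≤ θ) (hE : 0 ≤ E) :
    δ * F (E / δ) ≤ θ * F (E / θ) := by
  have hθ0 : 0 < θ := hδ.trans_le hθ
  have hle : δ / θ ≤ 1 := (div_le_one hθ0).2 hθ
  have h := hF.concaveOn.2 (Set.mem_Ici.2 (show 0 ≤ E / δ by positivity)) Set.self_mem_Ici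
    (show 0 ≤ δ / θ by positivity) (sub_nonneg.2 hle) (by ring)
  simp only [smul_eq_mul, mul_zero, add_zero] at h
  rw [show δ / θ * (E / δ) = E / θ by field_simp] at h
  have h0 := mul_nonneg (sub_nonneg.2 hle) hF.nonneg_zero
  calc δ * F (E / δ) = θ * (δ / θ * F (E / δ)) := by field_simp
    _ ≤ θ * F (E / θ) := by gcongr; linarith

/-- The restriction E ≥ E₀ can be dropped, since a state of energy at most E forces it. -/
theorem entropy_le (hF : K.IsEntropyBound F) {ρ : State H} {E : ℝ} (hE : 0 ≤ E)
    (h : K.energy ρ.op ≤ ENNReal.ofReal E) : entropy ρ.op ≤ ENNReal.ofReal (F E) := by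
  have h1 := (ENNReal.ofReal_le_ofReal_iff hE).1 ((ofReal_groundEnergy_le ρ).trans h)
  lift E to ℝ≥0 using hE
  rw [ENNReal.ofReal_coe_nnreal] at h
  refine le_trans ?_ (hF.maxEntropy_le E h1)
  exact le_iSup₂_of_le (f := fun (ρ : State H) (_ : K.energy ρ.op ≤ E) => entropy ρ.op) ρ h le_rfl

variable {ι : Type*} {b : HilbertBasis ι ℂ H}

/-- Apply the entropy bound to the uniform mixture of the vectors of J. -/
theorem log_card_le (hF : K.IsEntropyBound F) {J : Finset ι} (hJ : J.Nonempty) {M : ℝ} (hM : 0 < M)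
    (h : ∀ j ∈ J, K.vecEnergy (b j) ≤ ENNReal.ofReal M) : Real.log J.card ≤ F M := by
  classical
  have hc : (0 : ℝ) < J.card := by exact_mod_cast hJ.card_pos
  have h0 : ∀ i, 0 ≤ (if i ∈ J then (J.card : ℝ)⁻¹ else 0) := fun i => by split_ifs <;> positivity
  have h1 : HasSum (fun i => if i ∈ J then (J.card : ℝ)⁻¹ else 0) 1 := by
    have : HasSum (fun i => if i ∈ J then (J.card : ℝ)⁻¹ else 0)
        (∑ i ∈ J, if i ∈ J then (J.card : ℝ)⁻¹ else 0) :=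
      hasSum_sum_of_ne_finset_zero fun i hi => if_neg hi
    rwa [Finset.sum_congr rfl fun i hi => if_pos hi, Finset.sum_const, nsmul_eq_mul,
      mul_inv_cancel₀ hc.ne'] at this
  set ρ := State.diag b _ h0 h1
  have hd : IsDiag ρ.op b _ := State.isDiag_diag b _ h0 h1
  have hen : K.energy ρ.op ≤ ENNReal.ofReal M := by
    refine (energy_le_tsum hd).trans ?_
    rw [tsum_eq_sum (s := J) fun i hi => by rw [if_neg hi]; simp]
    calc ∑ i ∈ J, ENNReal.ofReal (if i ∈ J then (J.card : ℝ)⁻¹ else 0) * K.vecEnergy (b i)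
        ≤ ∑ i ∈ J, ENNReal.ofReal ((J.card : ℝ)⁻¹) * ENNReal.ofReal M := by
          refine Finset.sum_le_sum fun i hi => ?_
          rw [if_pos hi]; gcongr; exact h i hi
      _ = ENNReal.ofReal M := by
          rw [← ENNReal.ofReal_mul (by positivity), Finset.sum_const, nsmul_eq_mul,
            ← ENNReal.ofReal_natCast, ← ENNReal.ofReal_mul (by positivity)]
          congr 1; field_simp
  have hS := hF.entropy_le hM.le hen
  rw [State.entropy_eq hd, tsum_eq_sum (s := J) fun i hi => by rw [if_neg hi]; simp,
    Finset.sum_congr rfl fun i hi => by rw [if_pos hi], Finset.sum_const, nsmul_eq_mul,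
    ← ENNReal.ofReal_natCast, ← ENNReal.ofReal_mul (by positivity),
    ENNReal.ofReal_le_ofReal_iff (hF.pos M hM).le, Real.negMulLog, Real.log_inv] at hS
  calc Real.log J.card = J.card * (-(J.card : ℝ)⁻¹ * -Real.log J.card) := by field_simp
    _ ≤ F M := hS

/-- Infinitely many such vectors would contain subsets of any size, against log |J| ≤ F(M). -/
theorem finite_setOf_vecEnergy_le (hF : K.IsEntropyBound F) {M : ℝ} (hM : 0 < M) :
    {i | K.vecEnergy (b i) ≤ ENNReal.ofReal M}.Finite := by
  by_contra hinf
  obtain ⟨J, hJ, hc⟩ := Set.Infinite.exists_subset_card_eq hinf (⌊Real.exp (F M)⌋₊ + 1)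
  have hne : J.Nonempty := Finset.card_pos.1 (by omega)
  have h := hF.log_card_le hne hM fun j hj => hJ hj
  have h2 : Real.exp (F M) < J.card := by
    rw [hc]; push_cast; exact Nat.lt_floor_add_one _
  exact absurd ((Real.lt_log_iff_exp_lt ((Real.exp_pos _).trans h2)).2 h2) (not_lt.2 h)

/-- The tail divided by its mass δ is the spectrum of a state τ of energy at most E/δ, and the tail
contributes δH(τ) + η(δ). -/
theorem tsum_negMulLog_tail_le (hF : K.IsEntropyBound F) {ρ : State H} {x : ι → ℝ}
    {R : H →L[ℂ] H} (hR : K.IsInvOneAdd R) (hd : IsDiag ρ.op b x) {E δ : ℝ} (hE : 0 ≤ E)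
    (hρ : K.energy ρ.op ≤ ENNReal.ofReal E) (s : Set ι) (hδ : 0 < δ)
    (hs : HasSum (s.indicator x) δ) :
    ∑' i, ENNReal.ofReal (s.indicator (fun i => Real.negMulLog (x i)) i)
      ≤ ENNReal.ofReal (δ * F (E / δ) + Real.negMulLog δ) := by
  classical
  have hx0 : ∀ i, 0 ≤ x i := hd.nonneg ρ.isPositive
  have hi0 : ∀ i, 0 ≤ s.indicator x i := fun i => Set.indicator_nonneg (fun i _ => hx0 i) i
  have h0 : ∀ i, 0 ≤ δ⁻¹ * s.indicator x i := fun i => mul_nonneg (by positivity) (hi0 i)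
  have h1 : HasSum (fun i => δ⁻¹ * s.indicator x i) 1 := by
    simpa [hδ.ne'] using hs.mul_left δ⁻¹
  have hle1 : δ ≤ 1 := hasSum_le (fun i => Set.indicator_le_self' (fun i _ => hx0 i) i) hs
    (State.hasSum_eigenvalues hd)
  set τ := State.diag b _ h0 h1
  have hτ : IsDiag τ.op b _ := State.isDiag_diag b _ h0 h1
  have hen : K.energy τ.op ≤ ENNReal.ofReal (E / δ) := by
    refine (energy_le_tsum hτ).trans ?_
    calc ∑' i, ENNReal.ofReal (δ⁻¹ * s.indicator x i) * K.vecEnergy (b i)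
        ≤ ∑' i, ENNReal.ofReal δ⁻¹ * (ENNReal.ofReal (x i) * K.vecEnergy (b i)) := by
          refine ENNReal.tsum_le_tsum fun i => ?_
          rw [ENNReal.ofReal_mul (by positivity), mul_assoc]
          gcongr
          exact Set.indicator_le_self' (fun i _ => hx0 i) i
      _ = ENNReal.ofReal δ⁻¹ * K.energy ρ.op := by
          rw [ENNReal.tsum_mul_left, hR.energy_eq_tsum hd]
      _ ≤ ENNReal.ofReal (E / δ) := by
          rw [div_eq_inv_mul, ENNReal.ofReal_mul (by positivity)]
          gcongr
  have hS := hF.entropy_le (by positivity) hen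
  rw [State.entropy_eq hτ] at hS
  have hlog : 0 ≤ -Real.log δ := by linarith [Real.log_nonpos hδ.le hle1]
  have hτ1 : ∀ i, δ⁻¹ * s.indicator x i ≤ 1 := fun i =>
    le_hasSum h1 i (fun j _ => h0 j)
  have key : ∀ i, s.indicator (fun i => Real.negMulLog (x i)) i
      = δ * Real.negMulLog (δ⁻¹ * s.indicator x i) + s.indicator x i * -Real.log δ := by
    intro i
    by_cases hi : i ∈ s
    · rw [Set.indicator_of_mem hi, Set.indicator_of_mem hi, Real.negMulLog_mul, Real.negMulLog,
        Real.negMulLog, Real.log_inv]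
      field_simp; ring
    · simp [Set.indicator_of_notMem hi]
  have e2 : Real.negMulLog δ = δ * -Real.log δ := by rw [Real.negMulLog]; ring
  have hF0 : 0 ≤ F (E / δ) := hF.nonneg_zero.trans
    (hF.monotoneOn Set.self_mem_Ici (Set.mem_Ici.2 (by positivity)) (by positivity))
  calc ∑' i, ENNReal.ofReal (s.indicator (fun i => Real.negMulLog (x i)) i)
      = ∑' i, (ENNReal.ofReal δ * ENNReal.ofReal (Real.negMulLog (δ⁻¹ * s.indicator x i))
          + ENNReal.ofReal (s.indicator x i * -Real.log δ)) := by
        refine tsum_congr fun i => ?_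
        rw [key, ENNReal.ofReal_add (mul_nonneg hδ.le (Real.negMulLog_nonneg (h0 i) (hτ1 i)))
          (mul_nonneg (hi0 i) hlog), ENNReal.ofReal_mul hδ.le]
    _ = ENNReal.ofReal δ * ∑' i, ENNReal.ofReal (Real.negMulLog (δ⁻¹ * s.indicator x i))
          + ENNReal.ofReal (δ * -Real.log δ) := by
        rw [ENNReal.tsum_add, ENNReal.tsum_mul_left, ← (hs.mul_right _).tsum_eq,
          ENNReal.ofReal_tsum_of_nonneg (fun i => mul_nonneg (hi0 i) hlog)
            (hs.mul_right _).summable]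
    _ ≤ ENNReal.ofReal δ * ENNReal.ofReal (F (E / δ)) + ENNReal.ofReal (δ * -Real.log δ) := by
        gcongr
    _ = ENNReal.ofReal (δ * F (E / δ) + Real.negMulLog δ) := by
        rw [← ENNReal.ofReal_mul hδ.le, ← ENNReal.ofReal_add (by positivity)
          (mul_nonneg hδ.le hlog), e2]

end IsEntropyBound

end Hamiltonian

end EntropyBound

/-! ### A reference density operator on a subspace and its logarithm -/

section Reference

variable {H : Type*} [NormedAddCommGroup H] [InnerProductSpace ℂ H] [CompleteSpace H]
variable (W : Submodule ℂ H) [FiniteDimensional ℂ W]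

/-- The compression of an operator to a finite-dimensional subspace. -/
def compress (T : H →L[ℂ] H) : W →ₗ[ℂ] W :=
  (W.orthogonalProjectionOnto ∘L T ∘L W.subtypeL : W →L[ℂ] W)

theorem inner_compress (T : H →L[ℂ] H) (y z : W) :
    ⟪y, compress W T z⟫_ℂ = ⟪(y : H), T z⟫_ℂ := by
  exact Submodule.inner_orthogonalProjectionOnto_eq_of_mem_left y _

theorem isPositive_compress (ρ : State H) : (compress W ρ.op).IsPositive := by
  have key : ∀ y z : W, ⟪compress W ρ.op y, z⟫_ℂ = ⟪y, compress W ρ.op z⟫_ℂ := fun y z => by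
    rw [← inner_conj_symm, inner_compress, inner_compress, inner_conj_symm]
    exact ρ.isPositive.isSymmetric (y : H) (z : H)
  refine ⟨key, fun y => ?_⟩
  rw [key, inner_compress]
  exact ρ.re_inner_nonneg _

theorem orthonormal_coe {κ : Type*} [Fintype κ] (g : OrthonormalBasis κ ℂ W) :
    Orthonormal ℂ fun i => (g i : H) := g.orthonormal.comp_linearIsometry W.subtypeₗᵢ

theorem re_trace_eq_sum {κ : Type*} [Fintype κ] (T : H →L[ℂ] H) (g : OrthonormalBasis κ ℂ W) :
    (LinearMap.trace ℂ W (compress W T)).re = ∑ i, (⟪(g i : H), T (g i)⟫_ℂ).re := by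
  rw [LinearMap.trace_eq_sum_inner _ g, Complex.re_sum]
  simp_rw [inner_compress]

/-- The normalized compression of `σ`, or the chaotic state if this compression is zero, is at
least as close to the compressions of all states `ρ` as `σ` is to `ρ`. -/
theorem exists_reference (hd : 0 < Module.finrank ℂ W) (σ : State H) :
    ∃ S : W →ₗ[ℂ] W, S.IsPositive ∧ (LinearMap.trace ℂ W S).re = 1 ∧
      ∀ (ρ : State H) (g : OrthonormalBasis (Fin (Module.finrank ℂ W)) ℂ W) (I : Finset _),
        ∑ i ∈ I, (⟪g i, (compress W ρ.op
          - (((LinearMap.trace ℂ W (compress W ρ.op)).re : ℝ) : ℂ) • S) (g i)⟫_ℂ).re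
          ≤ 1 / 2 * ‖ρ.toTC - σ.toTC‖ := by
  classical
  set b := (LinearMap.trace ℂ W (compress W σ.op)).re with hb
  have hb0 : 0 ≤ b := by
    rw [hb, re_trace_eq_sum W σ.op (stdOrthonormalBasis ℂ W)]
    exact Finset.sum_nonneg fun i _ => σ.re_inner_nonneg _
  -- If σ vanishes on W, the compression of ρ is that of ρ - σ, and subtracting a multiple of any
  -- positive operator only helps.
  rcases hb0.eq_or_lt with hb0 | hb0
  · set d := Module.finrank ℂ W
    have hd' : (0 : ℝ) < d := by exact_mod_cast hd
    have hS : IsEigen (((d : ℝ)⁻¹ : ℂ) • (LinearMap.id : W →ₗ[ℂ] W)) (stdOrthonormalBasis ℂ W)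
        fun _ => (d : ℝ)⁻¹ := fun i => by simp
    refine ⟨_, hS.isPositive fun _ => by positivity, ?_, fun ρ g I => ?_⟩
    · rw [map_smul, LinearMap.trace_id, smul_eq_mul, Complex.ofReal_natCast,
        inv_mul_cancel₀ (by exact_mod_cast hd.ne')]; rfl
    · have ha : 0 ≤ (LinearMap.trace ℂ W (compress W ρ.op)).re := by
        rw [re_trace_eq_sum W ρ.op g]
        exact Finset.sum_nonneg fun i _ => ρ.re_inner_nonneg _
      have hz : ∑ i, (⟪(g i : H), σ.op (g i)⟫_ℂ).re = 0 := by
        rw [← re_trace_eq_sum W σ.op g, ← hb, hb0]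
      have hz' := (Finset.sum_eq_zero_iff_of_nonneg fun i _ => σ.re_inner_nonneg _).1 hz
      refine le_trans (Finset.sum_le_sum fun i _ => ?_)
        (sum_re_inner_sub_le ρ σ (orthonormal_coe W g) I)
      rw [hz' i (Finset.mem_univ i), sub_zero, LinearMap.sub_apply, inner_sub_right, Complex.sub_re,
        inner_compress, LinearMap.smul_apply, LinearMap.smul_apply, LinearMap.id_apply,
        inner_smul_right, inner_smul_right, inner_self_eq_norm_sq_to_K, g.orthonormal.1 i,
        Complex.re_ofReal_mul]
      have : 0 ≤ ((((d : ℝ)⁻¹ : ℂ) * (((1 : ℝ) : ℂ)) ^ 2)).re := by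
        rw [Complex.ofReal_one, one_pow, mul_one, ← Complex.ofReal_inv, Complex.ofReal_re]
        positivity
      have h2 := mul_nonneg ha this
      exact sub_le_self _ h2
  · refine ⟨((b⁻¹ : ℝ) : ℂ) • compress W σ.op, ?_, ?_, fun ρ g I => ?_⟩
    · refine (isPositive_compress W σ).smul_of_nonneg ?_
      exact_mod_cast inv_nonneg.2 hb0.le
    · rw [map_smul, smul_eq_mul, Complex.re_ofReal_mul, ← hb, inv_mul_cancel₀ hb0.ne']
    · set a := (LinearMap.trace ℂ W (compress W ρ.op)).re with ha
      have e : ∀ i, (⟪g i, (compress W ρ.op - (a : ℂ) • ((b⁻¹ : ℝ) : ℂ) • compress W σ.op)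
          (g i)⟫_ℂ).re = (⟪(g i : H), ρ.op (g i)⟫_ℂ).re
            - a / b * (⟪(g i : H), σ.op (g i)⟫_ℂ).re := by
        intro i
        rw [LinearMap.sub_apply, inner_sub_right, Complex.sub_re, inner_compress,
          LinearMap.smul_apply, LinearMap.smul_apply, inner_smul_right, inner_smul_right,
          Complex.re_ofReal_mul, Complex.re_ofReal_mul, inner_compress]
        ring
      simp_rw [e]
      have hσ : ∀ i, 0 ≤ (⟪(g i : H), σ.op (g i)⟫_ℂ).re := fun i => σ.re_inner_nonneg _
      -- If a ≥ b, the factor a/b ≥ 1 subtracts at least σ. Otherwise pass to the complement of I,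
      -- which is possible because the operator has trace zero, and exchange the roles of ρ and σ.
      rcases le_total b a with hab | hab
      · refine le_trans (Finset.sum_le_sum fun i _ => ?_)
          (sum_re_inner_sub_le ρ σ (orthonormal_coe W g) I)
        have : 1 ≤ a / b := (one_le_div hb0).2 hab
        nlinarith [hσ i]
      · have h0 : ∑ i, ((⟪(g i : H), ρ.op (g i)⟫_ℂ).re
            - a / b * (⟪(g i : H), σ.op (g i)⟫_ℂ).re) = 0 := by
          rw [Finset.sum_sub_distrib, ← Finset.mul_sum, ← re_trace_eq_sum, ← re_trace_eq_sum,
            ← ha, ← hb, div_mul_cancel₀ _ hb0.ne', sub_self]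
        rw [← Finset.sum_add_sum_compl I] at h0
        have h1 : ∑ i ∈ I, ((⟪(g i : H), ρ.op (g i)⟫_ℂ).re
            - a / b * (⟪(g i : H), σ.op (g i)⟫_ℂ).re)
            = ∑ i ∈ Iᶜ, (a / b * (⟪(g i : H), σ.op (g i)⟫_ℂ).re
              - (⟪(g i : H), ρ.op (g i)⟫_ℂ).re) := by
          rw [eq_neg_of_add_eq_zero_left h0, ← Finset.sum_neg_distrib]
          exact Finset.sum_congr rfl fun i _ => by ring
        rw [h1, norm_sub_rev]
        refine le_trans (Finset.sum_le_sum fun i _ => ?_)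
          (sum_re_inner_sub_le σ ρ (orthonormal_coe W g) Iᶜ)
        have : a / b ≤ 1 := (div_le_one hb0).2 hab
        nlinarith [hσ i]

/-- A lower bound for the entropy of all states `ρ` close to `σ` by the mean values in `ρ` of a
positive observable on `W`, which has the eigenvectors `f j` and is the logarithm of an operator
of known trace. -/
theorem exists_logarithmic_observable {d : ℕ} (hdd : Module.finrank ℂ W = d) (hd : 0 < d) (σ : State H)
    {ε δ : ℝ}
    (hδ : 0 < δ) :
    ∃ (f : OrthonormalBasis (Fin (Module.finrank ℂ W)) ℂ W) (ω : _ → ℝ),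
      (∀ j, 0 < ω j) ∧ ∑ j, ω j = 1 + δ ∧ ∀ ρ : State H, 1 / 2 * ‖ρ.toTC - σ.toTC‖ ≤ ε →
        ENNReal.ofReal (∑ j, (Real.log (1 + δ) - Real.log (ω j)) * (⟪(f j : H), ρ.op (f j)⟫_ℂ).re)
          ≤ entropy ρ.op + (ENNReal.ofReal (ε * (Real.log d + Real.log (1 + δ)
              - Real.log δ))
            + ENNReal.ofReal (Real.log (1 + δ)) *
              ∑ j, ENNReal.ofReal (⟪(f j : H), ρ.op (f j)⟫_ℂ).re) := by
  obtain ⟨S, hS, htr, href⟩ := exists_reference W (hdd ▸ hd) σ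
  have hd' : (0 : ℝ) < d := by exact_mod_cast hd
  obtain ⟨f, s, hs⟩ := exists_isEigen hS.isSymmetric
  have hs0 : ∀ j, 0 ≤ s j := hs.nonneg hS
  have hs1 : ∑ j, s j = 1 := by
    rw [← htr, LinearMap.trace_eq_sum_inner _ f, Complex.re_sum]
    simp_rw [hs.re_inner_basis]
  have hΩ : IsEigen (S + ((δ / d : ℝ) : ℂ) • LinearMap.id) f fun j => s j + δ / d := fun j => by
    rw [LinearMap.add_apply, hs j, LinearMap.smul_apply, LinearMap.id_apply, ← add_smul]
    push_cast; rfl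
  have hω : ∀ j, 0 < s j + δ / d := fun j => add_pos_of_nonneg_of_pos (hs0 j) (by positivity)
  have hsum : ∑ j, (s j + δ / d) = 1 + δ := by
    rw [Finset.sum_add_distrib, hs1, Finset.sum_const, Finset.card_univ, Fintype.card_fin,
      nsmul_eq_mul, hdd]
    field_simp
  refine ⟨f, fun j => s j + δ / d, hω, hsum, fun ρ hρ => ?_⟩
  set r := (LinearMap.trace ℂ W (compress W ρ.op)).re with hr
  have hr' : r = ∑ j, (⟪(f j : H), ρ.op (f j)⟫_ℂ).re := re_trace_eq_sum W ρ.op f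
  have hρ0 : ∀ j, 0 ≤ (⟪(f j : H), ρ.op (f j)⟫_ℂ).re := fun j => ρ.re_inner_nonneg _
  have hr0 : 0 ≤ r := hr' ▸ Finset.sum_nonneg fun j _ => hρ0 j
  rcases hr0.eq_or_lt with hr0 | hr0
  · have hz : ∑ j, (⟪(f j : H), ρ.op (f j)⟫_ℂ).re = 0 := hr'.symm.trans hr0.symm
    have hz' := (Finset.sum_eq_zero_iff_of_nonneg fun i _ => hρ0 i).1 hz
    rw [Finset.sum_eq_zero fun j _ => by rw [hz' j (Finset.mem_univ j), mul_zero],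
      ENNReal.ofReal_zero]
    exact bot_le
  obtain ⟨u, z, hz⟩ := exists_isEigen (isPositive_compress W ρ).isSymmetric
  have hz0 := hz.nonneg (isPositive_compress W ρ)
  have hzr : ∑ i, z i = r := by
    rw [hr, re_trace_eq_sum W ρ.op u]
    exact Finset.sum_congr rfl fun i _ => by rw [← hz.re_inner_basis, inner_compress]
  obtain ⟨w, hw, hdiag⟩ := ρ.exists_isDiag
  -- The correction η(r) lost in the compression is the same one that appears in
  -- `IsEigen.le_entropy`.
  have h1 := ofReal_entropy_compression_le hdiag W.subtypeₗᵢ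
    (fun y z => inner_compress W ρ.op y z) hz hzr hr0
  have h2 := hz.le_entropy hS hz0 hΩ hdd hd hδ rfl
    (by simp_rw [hs.re_inner_basis]; exact hs1) hω hzr hr0
    (fun g I => (href ρ g I).trans hρ)
  rw [← State.entropy_eq hdiag] at h1
  have hlog : 0 ≤ Real.log (1 + δ) := Real.log_nonneg (by linarith)
  have hlogd : 0 ≤ Real.log d := Real.log_natCast_nonneg d
  have hld : Real.log δ ≤ Real.log (1 + δ) := Real.log_le_log hδ (by linarith)
  rw [← ENNReal.ofReal_sum_of_nonneg fun j _ => hρ0 j, ← hr', ← ENNReal.ofReal_mul hlog]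
  calc _ ≤ ENNReal.ofReal ((∑ k, Real.negMulLog (z k) - Real.negMulLog r)
        + (ε * (Real.log d + Real.log (1 + δ) - Real.log δ) + Real.log (1 + δ) * r)) := by
        refine ENNReal.ofReal_le_ofReal ?_
        simp_rw [inner_compress] at h2
        have h3 : ∑ j, (Real.log (1 + δ) - Real.log (s j + δ / d)) *
            (⟪(f j : H), ρ.op (f j)⟫_ℂ).re = Real.log (1 + δ) * r
            - ∑ j, Real.log (s j + δ / d) * (⟪(f j : H), ρ.op (f j)⟫_ℂ).re := by
          rw [hr', Finset.mul_sum, ← Finset.sum_sub_distrib]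
          exact Finset.sum_congr rfl fun j _ => by ring
        rw [h3]
        linarith
    _ ≤ _ := by
        refine ENNReal.ofReal_add_le.trans (add_le_add h1 ENNReal.ofReal_add_le)

end Reference

/-! ### The Holevo quantity of an ensemble close to one state -/

section UpperBound

variable {H : Type*} [NormedAddCommGroup H] [InnerProductSpace ℂ H]

/-- Balls of radius 1/2 around the vectors are disjoint. Countability permits exchanging the sum
over an eigenbasis with the integral. -/
theorem Orthonormal.countable [TopologicalSpace.SeparableSpace H] {ι : Type*} {e : ι → H}
    (he : Orthonormal ℂ e) : Countable ι := by
  refine Pairwise.countable_of_isOpen_disjoint (s := fun i => Metric.ball (e i) (1 / 2)) ?_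
    (fun i => Metric.isOpen_ball) fun i => ⟨e i, Metric.mem_ball_self (by norm_num)⟩
  intro i j hij
  refine Metric.ball_disjoint_ball ?_
  have h := norm_sub_sq (𝕜 := ℂ) (e i) (e j)
  rw [he.2 hij, he.1, he.1] at h
  simp only [map_zero, mul_zero, sub_zero] at h
  rw [dist_eq_norm]
  nlinarith [norm_nonneg (e i - e j)]

variable [CompleteSpace H] [TopologicalSpace.SeparableSpace H] {Ω : Type*} [MeasurableSpace Ω]
  (μ : Measure Ω) [IsProbabilityMeasure μ]

/-- The cross entropy with respect to the mean is linear in the random state, so integration yields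
the entropy of the mean; an eigenvalue zero contributes ∞ · 0 = 0. -/
theorem lintegral_crossEntropy {f : Ω → State H} (hf : Measurable f) {w : Set H}
    (hw : IsEigenbasis (State.mean μ f hf).op w) :
    ∫⁻ a, ∑' j : w, negLog (⟪(j : H), (State.mean μ f hf).op j⟫_ℂ).re *
        ENNReal.ofReal (⟪(j : H), (f a).op j⟫_ℂ).re ∂μ
      = ∑' j : w, ENNReal.ofReal
          (Real.negMulLog (⟪(j : H), (State.mean μ f hf).op j⟫_ℂ).re) := by
  have hc : Countable w := Orthonormal.countable hw.1
  have hm : ∀ j : w, Measurable fun a => ENNReal.ofReal (⟪(j : H), (f a).op j⟫_ℂ).re := by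
    intro j
    have h1 : Continuous fun ρ : State H => (⟪(j : H), ρ.op j⟫_ℂ).re :=
      Complex.continuous_re.comp ((TraceClass.matrixElem (j : H) (j : H)).continuous.comp
        State.continuous_toTC)
    exact ENNReal.measurable_ofReal.comp (h1.measurable.comp hf)
  rw [lintegral_tsum fun j => ((hm j).const_mul _).aemeasurable]
  refine tsum_congr fun j => ?_
  rw [lintegral_const_mul _ (hm j), State.lintegral_ofReal_inner μ hf]
  have h0 := (State.mean μ f hf).re_inner_nonneg (j : H)
  have h1 := State.eigenvalue_le_one
    (hw.isDiag (State.mean μ f hf).isPositive.isSymmetric) j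
  set y := (⟪(j : H), (State.mean μ f hf).op j⟫_ℂ).re
  rw [negLog]
  split_ifs with hy
  · rw [hy]; simp
  · rw [← ENNReal.ofReal_mul (by linarith [Real.log_nonpos h0 h1]), Real.negMulLog]
    congr 1; ring

/-- J selects a block of the mean state, of mass a. The mean may have infinite entropy, so nothing
is subtracted until its entropy is split into the block, which is finite and cancels, and the tail,
which stays in the result. -/
theorem lintegral_relEntropy_le {f : Ω → State H} (hf : Measurable f) {σ : State H} {ε : ℝ}
    (hε : 0 < ε) (hσ : ∀ a, 1 / 2 * ‖(f a).toTC - σ.toTC‖ ≤ ε) {w : Set H}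
    (hw : IsEigenbasis (State.mean μ f hf).op w) (J : Finset w) {a : ℝ}
    (ha : ∑ j ∈ J, (⟪(j : H), (State.mean μ f hf).op j⟫_ℂ).re = a) (ha0 : 0 < a) :
    ∫⁻ x, relEntropy (f x).op (State.mean μ f hf).op ∂μ
      ≤ (∑' j, ENNReal.ofReal ((J : Set w)ᶜ.indicator
          (fun j => Real.negMulLog (⟪(j : H), (State.mean μ f hf).op j⟫_ℂ).re) j))
        + ENNReal.ofReal (Real.negMulLog a + ε * Real.log J.card + a * gFun (ε / a)) := by
  classical
  set ω := State.mean μ f hf with hωdef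
  have hd := hw.isDiag ω.isPositive.isSymmetric
  have hy0 : ∀ j : w, 0 ≤ (⟪(j : H), ω.op j⟫_ℂ).re := fun j => ω.re_inner_nonneg _
  have hy1 : ∀ j : w, (⟪(j : H), ω.op j⟫_ℂ).re ≤ 1 := State.eigenvalue_le_one hd
  have ha1 : a ≤ 1 := by
    rw [← ha]; exact sum_le_hasSum J (fun i _ => hy0 i) (State.hasSum_eigenvalues hd)
  have hJ : J.Nonempty := by
    rw [Finset.nonempty_iff_ne_empty]; rintro rfl
    rw [Finset.sum_empty] at ha; exact ha0.ne ha
  set W : Submodule ℂ H := Submodule.span ℂ (J.image ((↑) : w → H) : Set H)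
  let e : OrthonormalBasis J ℂ W := OrthonormalBasis.span hw.1 J
  have he : ∀ j : J, (e j : H) = (j : w) := fun j => OrthonormalBasis.span_apply hw.1 J j
  have hfin : Module.finrank ℂ W = J.card := by
    rw [Module.finrank_eq_card_basis e.toBasis, Fintype.card_coe]
  have hcard : 0 < J.card := hJ.card_pos
  -- With ε = aδ the terms ε(log(1+δ) - log δ) + a log(1+δ) add up to a g(ε/a).
  set δ := ε / a with hδ
  have hδ0 : 0 < δ := by positivity
  obtain ⟨g, z, hz0, hzs, hent⟩ :=
    exists_logarithmic_observable W hfin hcard σ (ε := ε) hδ0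
  have hlog : 0 ≤ Real.log (1 + δ) := Real.log_nonneg (by linarith)
  have hl0 : ∀ j, 0 ≤ Real.log (1 + δ) - Real.log (z j) := fun j => by
    have : z j ≤ 1 + δ := hzs ▸ Finset.single_le_sum (fun i _ => (hz0 i).le) (Finset.mem_univ j)
    linarith [Real.log_le_log (hz0 j) this]
  set c := ε * (Real.log J.card + Real.log (1 + δ) - Real.log δ) with hc
  have hc0 : 0 ≤ c := by
    have h1 : 0 ≤ Real.log J.card := Real.log_natCast_nonneg _
    have h2 : Real.log δ ≤ Real.log (1 + δ) := Real.log_le_log hδ0 (by linarith)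
    exact mul_nonneg hε.le (by linarith)
  have hm : ∀ j, Measurable fun x => ENNReal.ofReal (⟪(g j : H), (f x).op (g j)⟫_ℂ).re := by
    intro j
    have h1 : Continuous fun ρ : State H => (⟪(g j : H), ρ.op (g j)⟫_ℂ).re :=
      Complex.continuous_re.comp ((TraceClass.matrixElem (g j : H) (g j : H)).continuous.comp
        State.continuous_toTC)
    exact ENNReal.measurable_ofReal.comp (h1.measurable.comp hf)
  have hV : ∀ ρ : State H, ENNReal.ofReal (∑ j, (Real.log (1 + δ) - Real.log (z j)) *
      (⟪(g j : H), ρ.op (g j)⟫_ℂ).re) = ∑ j, ENNReal.ofReal (Real.log (1 + δ) - Real.log (z j)) *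
      ENNReal.ofReal (⟪(g j : H), ρ.op (g j)⟫_ℂ).re := fun ρ => by
    rw [ENNReal.ofReal_sum_of_nonneg fun j _ => mul_nonneg (hl0 j) (ρ.re_inner_nonneg _)]
    exact Finset.sum_congr rfl fun j _ => ENNReal.ofReal_mul (hl0 j)
  have hae : ∑ j, (⟪(g j : H), ω.op (g j)⟫_ℂ).re = a := by
    rw [← re_trace_eq_sum, re_trace_eq_sum W ω.op e, ← ha, ← Finset.sum_coe_sort J]
    exact Finset.sum_congr rfl fun j _ => by rw [he]
  -- the integrated inequality
  have hrel : ∫⁻ x, relEntropy (f x).op ω.op ∂μ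
      + ENNReal.ofReal (∑ j, (Real.log (1 + δ) - Real.log (z j)) *
        (⟪(g j : H), ω.op (g j)⟫_ℂ).re)
      ≤ (∑' j : w, ENNReal.ofReal (Real.negMulLog (⟪(j : H), ω.op j⟫_ℂ).re))
        + (ENNReal.ofReal c + ENNReal.ofReal (Real.log (1 + δ)) * ENNReal.ofReal a) := by
    have e1 : ENNReal.ofReal (∑ j, (Real.log (1 + δ) - Real.log (z j)) *
        (⟪(g j : H), ω.op (g j)⟫_ℂ).re)
        = ∫⁻ x, ∑ j, ENNReal.ofReal (Real.log (1 + δ) - Real.log (z j)) *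
      ENNReal.ofReal (⟪(g j : H), (f x).op (g j)⟫_ℂ).re ∂μ := by
      rw [hV, lintegral_finsetSum _ fun j _ => (hm j).const_mul _]
      refine Finset.sum_congr rfl fun j _ => ?_
      rw [lintegral_const_mul _ (hm j), State.lintegral_ofReal_inner μ hf]
    have e2 : ENNReal.ofReal c + ENNReal.ofReal (Real.log (1 + δ)) * ENNReal.ofReal a
        = ∫⁻ x, (ENNReal.ofReal c + ENNReal.ofReal (Real.log (1 + δ)) *
          ∑ j, ENNReal.ofReal (⟪(g j : H), (f x).op (g j)⟫_ℂ).re) ∂μ := by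
      rw [lintegral_add_left measurable_const, lintegral_const, measure_univ, mul_one,
        lintegral_const_mul _ (Finset.measurable_fun_sum _ fun j _ => hm j),
        lintegral_finsetSum _ fun j _ => hm j, ← hae,
        ENNReal.ofReal_sum_of_nonneg fun j _ => ω.re_inner_nonneg _]
      congr 2
      exact Finset.sum_congr rfl fun j _ => (State.lintegral_ofReal_inner μ hf _).symm
    -- Only the finite sums are required to be measurable here, not the relative entropy as a
    -- function of the state.
    rw [e1, e2, ← lintegral_crossEntropy μ hf hw,
      ← lintegral_add_right _ (Finset.measurable_fun_sum _ fun j _ => (hm j).const_mul _),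
      ← lintegral_add_right _ (((Finset.measurable_fun_sum _ fun j _ => hm j).const_mul
        (ENNReal.ofReal (Real.log (1 + δ)))).const_add (ENNReal.ofReal c))]
    refine lintegral_mono fun x => ?_
    have h1 := hent (f x) (hσ x)
    rw [hV] at h1
    calc _ ≤ relEntropy (f x).op ω.op + (entropy (f x).op + _) := by gcongr
      _ = (relEntropy (f x).op ω.op + entropy (f x).op) + _ := (add_assoc _ _ _).symm
      _ ≤ _ := by gcongr; exact relEntropy_add_entropy_le hw
  -- Klein's inequality
  have heig : IsEigen (compress W ω.op) e fun j => (⟪((j : w) : H), ω.op (j : w)⟫_ℂ).re := by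
    intro j
    refine Subtype.ext ?_
    have h1 : ω.op (e j : H) = (((⟪((j : w) : H), ω.op (j : w)⟫_ℂ).re : ℝ) : ℂ) • (e j : H) := by
      rw [he]; simpa using hd j
    change ((W.orthogonalProjectionOnto (ω.op (e j : H)) : W) : H) = _
    rw [h1, map_smul, Submodule.orthogonalProjectionOnto_mem_subspace_eq_self]
  have hkl := heig.klein (fun j => hy0 j) g hz0
    (by rw [← ha, ← Finset.sum_coe_sort J]) hzs ha0 (by linarith)
  simp_rw [inner_compress] at hkl
  set A := ∑ j ∈ J, Real.negMulLog (⟪(j : H), ω.op j⟫_ℂ).re with hA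
  have hA0 : 0 ≤ A := Finset.sum_nonneg fun j _ => Real.negMulLog_nonneg (hy0 j) (hy1 j)
  have hη0 : 0 ≤ Real.negMulLog a := Real.negMulLog_nonneg ha0.le ha1
  have hAle : A - Real.negMulLog a ≤ ∑ j, (Real.log (1 + δ) - Real.log (z j)) *
        (⟪(g j : H), ω.op (g j)⟫_ℂ).re := by
    have h3 : ∑ j, (Real.log (1 + δ) - Real.log (z j)) * (⟪(g j : H), ω.op (g j)⟫_ℂ).re
        = Real.log (1 + δ) * a - ∑ j, Real.log (z j) * (⟪(g j : H), ω.op (g j)⟫_ℂ).re := by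
      rw [← hae, Finset.mul_sum, ← Finset.sum_sub_distrib]
      exact Finset.sum_congr rfl fun j _ => by ring
    have h4 : A = -∑ j : J, (⟪((j : w) : H), ω.op (j : w)⟫_ℂ).re *
        Real.log (⟪((j : w) : H), ω.op (j : w)⟫_ℂ).re := by
      rw [hA, ← Finset.sum_coe_sort J, ← Finset.sum_neg_distrib]
      exact Finset.sum_congr rfl fun j _ => by rw [Real.negMulLog]; ring
    rw [h3, h4, Real.negMulLog]
    linarith
  have hsplit : ∑' j : w, ENNReal.ofReal (Real.negMulLog (⟪(j : H), ω.op j⟫_ℂ).re)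
      = ENNReal.ofReal A + ∑' j, ENNReal.ofReal ((J : Set w)ᶜ.indicator
          (fun j => Real.negMulLog (⟪(j : H), ω.op j⟫_ℂ).re) j) := by
    have h1 : ENNReal.ofReal A = ∑' j, ENNReal.ofReal ((J : Set w).indicator
        (fun j => Real.negMulLog (⟪(j : H), ω.op j⟫_ℂ).re) j) := by
      rw [hA, ENNReal.ofReal_sum_of_nonneg fun j _ => Real.negMulLog_nonneg (hy0 j) (hy1 j),
        tsum_eq_sum (s := J) fun j hj => by
          rw [Set.indicator_of_notMem (fun h => hj (Finset.mem_coe.1 h)), ENNReal.ofReal_zero]]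
      exact Finset.sum_congr rfl fun j hj => by rw [Set.indicator_of_mem (Finset.mem_coe.2 hj)]
    rw [h1, ← ENNReal.tsum_add]
    refine tsum_congr fun j => ?_
    by_cases hj : j ∈ (J : Set w) <;> simp [hj]
  rw [hsplit] at hrel
  set T := ∑' j, ENNReal.ofReal ((J : Set w)ᶜ.indicator
          (fun j => Real.negMulLog (⟪(j : H), ω.op j⟫_ℂ).re) j)
  -- The block entropy A is added on both sides and cancelled at the end, being finite.
  have hfinal : ∫⁻ x, relEntropy (f x).op ω.op ∂μ + ENNReal.ofReal A
      ≤ (T + ENNReal.ofReal (Real.negMulLog a + ε * Real.log J.card + a * gFun (ε / a)))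
        + ENNReal.ofReal A := by
    calc _ ≤ ∫⁻ x, relEntropy (f x).op ω.op ∂μ
          + (ENNReal.ofReal (A - Real.negMulLog a) + ENNReal.ofReal (Real.negMulLog a)) := by
          gcongr
          refine le_trans (le_of_eq (by rw [sub_add_cancel])) ENNReal.ofReal_add_le
      _ ≤ (∫⁻ x, relEntropy (f x).op ω.op ∂μ
          + ENNReal.ofReal (∑ j, (Real.log (1 + δ) - Real.log (z j)) *
            (⟪(g j : H), ω.op (g j)⟫_ℂ).re)) + ENNReal.ofReal (Real.negMulLog a) := by
          rw [← add_assoc]; gcongr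
      _ ≤ _ := by
          refine (add_le_add_left hrel _).trans (le_of_eq ?_)
          have : Real.negMulLog a + ε * Real.log J.card + a * gFun (ε / a)
              = c + Real.log (1 + δ) * a + Real.negMulLog a := by
            rw [hc, gFun, ← hδ, add_comm δ 1]
            have : ε = a * δ := by rw [hδ]; field_simp
            rw [this]; ring
          rw [this, ENNReal.ofReal_add (add_nonneg hc0 (mul_nonneg hlog ha0.le)) hη0,
            ENNReal.ofReal_add hc0 (mul_nonneg hlog ha0.le), ENNReal.ofReal_mul hlog]
          ring
  exact (ENNReal.add_le_add_iff_right ENNReal.ofReal_ne_top).1 hfinal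

end UpperBound

/-! ### The bound as a function of t, and attainment of its infimum -/

section BoundFunction

theorem continuous_gFun : Continuous gFun := by
  unfold gFun
  exact (Real.continuous_mul_log.comp (continuous_id.add continuous_const)).sub
    Real.continuous_mul_log

theorem gFun_zero : gFun 0 = 0 := by simp [gFun]

theorem gFun_monotoneOn : MonotoneOn gFun (Set.Ici 0) := by
  have hd : ∀ x : ℝ, 0 < x → HasDerivAt gFun (Real.log (x + 1) - Real.log x) x := by
    intro x hx
    have h1 := (Real.hasDerivAt_mul_log (x := x + 1) (by linarith)).comp_add_const x 1
    have h2 := h1.sub (Real.hasDerivAt_mul_log hx.ne')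
    exact HasDerivAt.congr_deriv (f := gFun) h2 (by ring)
  refine monotoneOn_of_deriv_nonneg (convex_Ici 0) continuous_gFun.continuousOn ?_ ?_
  · intro x hx
    rw [interior_Ici] at hx
    exact (hd x hx).differentiableAt.differentiableWithinAt
  · intro x hx
    rw [interior_Ici] at hx
    rw [(hd x hx).deriv, sub_nonneg]
    exact Real.log_le_log hx (by linarith)

theorem gFun_nonneg {p : ℝ} (hp : 0 ≤ p) : 0 ≤ gFun p := by
  rw [← gFun_zero]; exact gFun_monotoneOn Set.self_mem_Ici hp hp

theorem one_le_coeff {ε κ t : ℝ} (hε : 0 < ε) (hκ : 0 ≤ κ) (ht : t ∈ Set.Ioc 0 (1 / (2 * ε))) :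
    ε * t ≤ 1 / 2 ∧ 0 < 1 - ε * t ∧ 1 / (1 - ε * t) ≤ (1 + κ * t) / (1 - ε * t) ∧
      1 ≤ (1 + κ * t) / (1 - ε * t) := by
  have h1 : ε * t ≤ 1 / 2 := by
    have := (le_div_iff₀ (by positivity)).1 ht.2
    linarith
  have h2 : 0 < 1 - ε * t := by linarith
  have h3 : 0 ≤ κ * t := mul_nonneg hκ ht.1.le
  refine ⟨h1, h2, by gcongr; linarith, ?_⟩
  rw [one_le_div h2]
  have := mul_pos hε ht.1
  linarith

theorem continuousOn_boundAt {F : ℝ → ℝ} (hF : ContinuousOn F (Set.Ici 0)) {ε κ Es : ℝ} (hε : 0 < ε)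
    (hκ : 0 ≤ κ) (hE : 0 ≤ Es) : ContinuousOn (boundAt F ε κ Es) (Set.Ioc 0 (1 / (2 * ε))) := by
  have hq : ContinuousOn (fun t : ℝ => (1 + κ * t) / (1 - ε * t)) (Set.Ioc 0 (1 / (2 * ε))) :=
    ContinuousOn.div (by fun_prop) (by fun_prop) fun t ht => (one_le_coeff hε hκ ht).2.1.ne'
  have hM : ContinuousOn (fun t : ℝ => Es / (ε * t)) (Set.Ioc 0 (1 / (2 * ε))) :=
    ContinuousOn.div (by fun_prop) (by fun_prop) fun t ht => (mul_pos hε ht.1).ne'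
  have h1 : ContinuousOn (fun t : ℝ => F (Es / (ε * t))) (Set.Ioc 0 (1 / (2 * ε))) :=
    hF.comp hM fun t ht => Set.mem_Ici.2 (div_nonneg hE (mul_pos hε ht.1).le)
  unfold boundAt
  refine ((continuousOn_const.mul (hq.add continuousOn_id)).mul h1).add
    (Real.binEntropy_continuous.comp_continuousOn (by fun_prop)) |>.add
    (continuous_gFun.comp_continuousOn (hq.mul continuousOn_const))

variable {H : Type*} [NormedAddCommGroup H] [InnerProductSpace ℂ H] [CompleteSpace H]
  {K : Hamiltonian H} {F : ℝ → ℝ}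

/-- The coefficient of εF is at least 1 and the other terms are nonnegative. The estimate serves
both positivity of the bound and its growth as t → 0. -/
theorem Hamiltonian.IsEntropyBound.mul_le_boundAt (hF : K.IsEntropyBound F) {ε κ Es t : ℝ}
    (hε : 0 < ε) (hκ : 0 ≤ κ) (hE : 0 < Es) (ht : t ∈ Set.Ioc 0 (1 / (2 * ε))) :
    ε * F (Es / (ε * t)) ≤ boundAt F ε κ Es t := by
  obtain ⟨h1, h2, -, h4⟩ := one_le_coeff hε hκ ht
  have h5 := mul_pos hε ht.1
  have hFp := hF.pos _ (div_pos hE h5)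
  have h6 : 0 ≤ Real.binEntropy (ε * t) := Real.binEntropy_nonneg h5.le (by linarith)
  have h7 : 0 ≤ gFun ((1 + κ * t) / (1 - ε * t) * ε) := gFun_nonneg (by positivity)
  have h8 : ε * F (Es / (ε * t)) ≤ ε * ((1 + κ * t) / (1 - ε * t) + t) * F (Es / (ε * t)) := by
    gcongr
    refine le_mul_of_one_le_right hε.le ?_
    linarith [ht.1]
  unfold boundAt
  linarith

theorem Hamiltonian.IsEntropyBound.exists_boundAt_min (hF : K.IsEntropyBound F)
    (hinf : ∀ c, ∃ M, 0 < M ∧ c < F M) {ε κ Es : ℝ} (hε : 0 < ε) (hκ : 0 ≤ κ) (hE : 0 < Es) :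
    ∃ t ∈ Set.Ioc 0 (1 / (2 * ε)), sInf (boundAt F ε κ Es '' Set.Ioc 0 (1 / (2 * ε)))
      = boundAt F ε κ Es t := by
  set a := 1 / (2 * ε) with ha
  have ha0 : 0 < a := by positivity
  obtain ⟨M, hM0, hM⟩ := hinf (boundAt F ε κ Es a / ε)
  -- For t < t₁ the argument of F exceeds M, so the bound is at least its value at the right
  -- endpoint. A minimum over the compact interval [t₁, a] is therefore global.
  set t₁ := min a (Es / (ε * M))
  have ht₁ : 0 < t₁ := lt_min ha0 (by positivity)
  obtain ⟨t₀, ht₀, hmin⟩ := (isCompact_Icc (a := t₁) (b := a)).exists_isMinOn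
    ⟨a, min_le_left _ _, le_rfl⟩ ((continuousOn_boundAt hF.continuousOn hε hκ hE.le).mono
      fun t ht => ⟨ht₁.trans_le ht.1, ht.2⟩)
  refine ⟨t₀, ⟨ht₁.trans_le ht₀.1, ht₀.2⟩, IsLeast.csInf_eq
    ⟨Set.mem_image_of_mem _ ⟨ht₁.trans_le ht₀.1, ht₀.2⟩, ?_⟩⟩
  rintro _ ⟨t, ht, rfl⟩
  rcases le_or_gt t₁ t with h | h
  · exact hmin ⟨h, ht.2⟩
  · refine (hmin ⟨min_le_left _ _, le_rfl⟩).trans (le_trans ?_ (hF.mul_le_boundAt hε hκ hE ht))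
    rw [div_lt_iff₀' hε] at hM
    refine hM.le.trans (mul_le_mul_of_nonneg_left (hF.monotoneOn hM0.le ?_ ?_) hε.le)
    · exact Set.mem_Ici.2 (div_pos hE (mul_pos hε ht.1)).le
    · have h2 := h.trans_le (min_le_right _ _)
      rw [lt_div_iff₀ (by positivity)] at h2
      rw [le_div_iff₀ (mul_pos hε ht.1)]
      linarith

/-- The dense domain is infinite-dimensional, so it contains n orthonormal vectors, of finite
energy, and `log_card_le` gives values of F above log n. -/
theorem Hamiltonian.IsEntropyBound.unbounded (hF : K.IsEntropyBound F)
    (hH : ¬ FiniteDimensional ℂ H) (c : ℝ) : ∃ M, 0 < M ∧ c < F M := by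
  classical
  obtain ⟨n, hn⟩ := exists_nat_gt (Real.exp c)
  have hn0 : 0 < n := by exact_mod_cast (Real.exp_pos c).trans hn
  have hD : ¬ FiniteDimensional ℂ K.op.domain := by
    intro h
    have h1 : (K.op.domain : Set H) = Set.univ :=
      (Submodule.closed_of_finiteDimensional K.op.domain).closure_eq ▸
        K.selfAdjoint.dense_domain.closure_eq
    have h2 : K.op.domain = ⊤ := SetLike.coe_injective (by simpa using h1)
    rw [h2] at h
    exact hH (Module.Finite.equiv (Submodule.topEquiv (R := ℂ) (M := H)))
  have hrank : (n : Cardinal) ≤ Module.rank ℂ K.op.domain := by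
    have := not_lt.1 (mt Module.rank_lt_aleph0_iff.1 hD)
    exact Cardinal.natCast_lt_aleph0.le.trans this
  obtain ⟨s, hs, hli⟩ := le_rank_iff_exists_linearIndependent_finset.1 hrank
  set W : Submodule ℂ K.op.domain := Submodule.span ℂ (s : Set K.op.domain)
  have hW : Module.finrank ℂ W = n := by rw [← hs]; exact finrank_span_finset_eq_card hli
  let u := stdOrthonormalBasis ℂ W
  have hu : Orthonormal ℂ fun i => ((u i : K.op.domain) : H) :=
    (u.orthonormal.comp_linearIsometry W.subtypeₗᵢ).comp_linearIsometry K.op.domain.subtypeₗᵢ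
  obtain ⟨w, b, hw, hb⟩ := hu.toSubtypeRange.exists_hilbertBasis_extension
  let v : Fin (Module.finrank ℂ W) → w := fun i => ⟨_, hw ⟨i, rfl⟩⟩
  have hv : Function.Injective v := fun i j hij => by
    have h : (v i : H) = v j := by rw [hij]
    exact hu.linearIndependent.injective h
  set J : Finset w := Finset.univ.image v
  have hJ : J.card = n := by
    rw [Finset.card_image_of_injective _ hv, Finset.card_univ, Fintype.card_fin, hW]
  let E : ℝ := ∑ i, (⟪((u i : K.op.domain) : H), K.op (u i)⟫_ℂ).re
  have hE : 0 ≤ E := Finset.sum_nonneg fun i _ => K.nonneg _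
  refine ⟨E + 1, by linarith, ?_⟩
  have h := hF.log_card_le (b := b) (J := J) (Finset.card_pos.1 (hJ ▸ hn0))
    (M := E + 1) (by linarith) ?_
  · rw [hJ] at h
    exact ((Real.lt_log_iff_exp_lt (by exact_mod_cast hn0)).2 hn).trans_le h
  · intro j hj
    obtain ⟨i, -, rfl⟩ := Finset.mem_image.1 hj
    refine iSup₂_le fun B hB => ENNReal.ofReal_le_ofReal ?_
    have e : b (v i) = ((u i : K.op.domain) : H) := by rw [hb]
    rw [e]
    have h1 := hB.2 (u i)
    have h2 : (⟪((u i : K.op.domain) : H), K.op (u i)⟫_ℂ).re ≤ E :=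
      Finset.single_le_sum (f := fun i => (⟪((u i : K.op.domain) : H), K.op (u i)⟫_ℂ).re)
        (fun i _ => K.nonneg _) (Finset.mem_univ i)
    linarith

end BoundFunction

/-! ### The upper bound for the capacity -/

section CapacityBound

variable {HA HB : Type*} [NormedAddCommGroup HA] [InnerProductSpace ℂ HA] [CompleteSpace HA]
  [NormedAddCommGroup HB] [InnerProductSpace ℂ HB] [CompleteSpace HB]

namespace Channel

variable (Φ : Channel HA HB)

theorem half_norm_le_divergence (σ : State HB) (ρ : State HA) :
    1 / 2 * ‖(Φ.onState ρ).toTC - σ.toTC‖ ≤ Φ.divergence σ := by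
  refine mul_le_mul_of_nonneg_left (le_ciSup (f := fun ρ : State HA =>
    ‖(Φ.onState ρ).toTC - σ.toTC‖) ⟨2, ?_⟩ ρ) (by norm_num)
  rintro _ ⟨τ, rfl⟩
  refine (norm_sub_le _ _).trans ?_
  linarith [(Φ.onState τ).norm_toTC_le, σ.norm_toTC_le]

variable [TopologicalSpace.SeparableSpace HA] [TopologicalSpace.SeparableSpace HB]

theorem capacity_le_boundAt {KA : Hamiltonian HA} {KB : Hamiltonian HB} {R : HB →L[ℂ] HB}
    (hR : KB.IsInvOneAdd R) {σ : State HB} {E : ℝ≥0} {F : ℝ → ℝ} (hF : KB.IsEntropyBound F)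
    (hε : 0 < Φ.divergence σ) {Es : ℝ} (hEs : 0 < Es)
    (hmax : Φ.maxOutputEnergy KA KB E ≤ ENNReal.ofReal Es) {κ : ℝ} (hκ : 0 ≤ κ) {t : ℝ}
    (ht : t ∈ Set.Ioc 0 (1 / (2 * Φ.divergence σ))) :
    Φ.capacity KA E ≤ ENNReal.ofReal (boundAt F (Φ.divergence σ) κ Es t) := by
  classical
  refine iSup_le fun μ => iSup₂_le fun hμ hen => ?_
  set ε := Φ.divergence σ with hεdef
  obtain ⟨hεt, h1εt, hq1, hq2⟩ := one_le_coeff hε hκ ht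
  have hεt0 : 0 < ε * t := mul_pos hε ht.1
  have hm := Φ.continuous_onState.measurable
  set ω := State.mean μ Φ.onState hm with hω
  have hav : (averageState (μ.map Φ.onState)).toCLM = ω.op := by rw [averageState_map]; rfl
  have hωE : KB.energy ω.op ≤ ENNReal.ofReal Es := by
    refine le_trans ?_ hmax
    rw [hω, mean_onState]
    exact le_iSup₂_of_le (f := fun (ρ : State HA) (_ : KA.energy ρ.op ≤ E) =>
      KB.energy (Φ.onState ρ).op) (State.mean μ id measurable_id) hen le_rfl
  obtain ⟨w, hw, hd⟩ := ω.exists_isDiag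
  set y : w → ℝ := fun v => (⟪(v : HB), ω.op v⟫_ℂ).re with hy
  have hy0 : ∀ j, 0 ≤ y j := fun j => ω.re_inner_nonneg _
  -- The spectral cutoff: Markov's inequality at this level leaves a tail of mass at most E_*/M =
  -- εt.
  set M := Es / (ε * t) with hM
  have hM0 : 0 < M := by positivity
  have hfin := hF.finite_setOf_vecEnergy_le (b := hw.basis) hM0
  set J := hfin.toFinset
  set a := ∑ j ∈ J, y j with ha
  set δ := 1 - a with hδ
  have hy1 : HasSum y 1 := State.hasSum_eigenvalues hd
  have hδs : HasSum ((J : Set w)ᶜ.indicator y) δ := by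
    have h1 : HasSum ((J : Set w).indicator y) a := by
      have := hasSum_sum_of_ne_finset_zero (f := (J : Set w).indicator y) (s := J)
        (L := SummationFilter.unconditional w) fun j hj => Set.indicator_of_notMem (by simpa using hj) y
      rwa [Finset.sum_congr rfl fun j hj => Set.indicator_of_mem (Finset.mem_coe.2 hj) y] at this
    have h2 := hy1.sub h1
    rwa [Set.indicator_compl']
  have hi0 : ∀ j, 0 ≤ (J : Set w)ᶜ.indicator y j := fun j =>
    Set.indicator_nonneg (fun j _ => hy0 j) j
  have hδ0 : 0 ≤ δ := hδs.nonneg hi0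
  have hδle : δ ≤ ε * t := by
    have h1 : ENNReal.ofReal (δ * M) ≤ ENNReal.ofReal Es := by
      refine le_trans ?_ hωE
      rw [hR.energy_eq_tsum hd, ENNReal.ofReal_mul hδ0, ← hδs.tsum_eq,
        ENNReal.ofReal_tsum_of_nonneg hi0 hδs.summable, ← ENNReal.tsum_mul_right]
      refine ENNReal.tsum_le_tsum fun j => ?_
      by_cases hj : j ∈ (J : Set w)
      · simp [hj]
      · rw [Set.indicator_of_mem (Set.mem_compl hj)]
        gcongr
        have : j ∉ J := hj
        simp only [J, Set.Finite.mem_toFinset, Set.mem_ofPred_eq, not_le] at this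
        exact this.le
    rw [ENNReal.ofReal_le_ofReal_iff hEs.le, hM, ← mul_div_assoc, div_le_iff₀ hεt0] at h1
    nlinarith
  have ha0 : 0 < a := by linarith
  have ha1 : a ≤ 1 := by linarith
  have hJ : J.Nonempty := by
    rw [Finset.nonempty_iff_ne_empty]; intro h
    rw [ha, h, Finset.sum_empty] at ha0; exact ha0.false
  have hlog := hF.log_card_le (b := hw.basis) hJ hM0 fun j hj => hfin.mem_toFinset.1 hj
  have hFM := hF.pos M hM0
  have hmain := lintegral_relEntropy_le μ hm hε (Φ.half_norm_le_divergence σ) hw J rfl ha0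
  -- A tail of zero mass has no conditioned state and is treated separately; otherwise δF(E_*/δ) ≤
  -- εtF(M) by monotonicity of the perspective.
  have htail : (∑' j, ENNReal.ofReal ((J : Set w)ᶜ.indicator (fun j => Real.negMulLog (y j)) j))
      ≤ ENNReal.ofReal (ε * t * F M + Real.negMulLog δ) := by
    rcases hδ0.eq_or_lt with h | h
    · have h0 : ∀ j, (J : Set w)ᶜ.indicator y j = 0 :=
        fun j => congrFun ((hasSum_zero_iff_of_nonneg hi0).1 (h ▸ hδs)) j
      refine le_trans (le_of_eq (ENNReal.tsum_eq_zero.2 fun j => ?_)) bot_le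
      have := h0 j
      by_cases hj : j ∈ (J : Set w)
      · simp [hj]
      · rw [Set.indicator_of_mem (Set.mem_compl hj)] at this ⊢
        rw [this]; simp
    · refine (hF.tsum_negMulLog_tail_le hR hd hEs.le hωE _ h hδs).trans
        (ENNReal.ofReal_le_ofReal ?_)
      have := hF.mul_div_le h hδle hEs.le
      linarith
  have hδ1 : δ ≤ 1 := by linarith
  have hηδ := Real.negMulLog_nonneg hδ0 hδ1
  have hηa := Real.negMulLog_nonneg ha0.le ha1
  have hg0 : 0 ≤ gFun (ε / a) := gFun_nonneg (by positivity)
  have hlog0 : 0 ≤ Real.log J.card := Real.log_natCast_nonneg _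
  calc holevoQuantity (μ.map Φ.onState)
      ≤ ∫⁻ x, relEntropy (Φ.onState x).op ω.op ∂μ := by
        rw [holevoQuantity, hav]
        -- This inequality for push-forwards holds without measurability of the integrand.
        exact lintegral_map_le _ _
    _ ≤ ENNReal.ofReal (ε * t * F M + Real.negMulLog δ)
        + ENNReal.ofReal (Real.negMulLog a + ε * Real.log J.card + a * gFun (ε / a)) :=
        hmain.trans (by gcongr)
    _ ≤ ENNReal.ofReal (boundAt F ε κ Es t) := by
        rw [← ENNReal.ofReal_add (by positivity) (by positivity)]
        refine ENNReal.ofReal_le_ofReal ?_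
        -- As a = 1 - δ, the left side is the binary entropy of δ; it is increasing on [0, 1/2],
        -- which contains εt.
        have hb : Real.negMulLog δ + Real.negMulLog a ≤ Real.binEntropy (ε * t) := by
          have e : Real.negMulLog δ + Real.negMulLog a = Real.binEntropy δ := by
            rw [Real.binEntropy_eq_negMulLog_add_negMulLog_one_sub, hδ, sub_sub_cancel]
          rw [e]
          exact Real.binEntropy_strictMonoOn.monotoneOn ⟨hδ0, by norm_num at *; linarith⟩
            ⟨hεt0.le, by norm_num at *; linarith⟩ hδle
        have hg : a * gFun (ε / a) ≤ gFun ((1 + κ * t) / (1 - ε * t) * ε) := by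
          refine (mul_le_of_le_one_left hg0 ha1).trans
            (gFun_monotoneOn (Set.mem_Ici.2 (by positivity)) (Set.mem_Ici.2 (by positivity)) ?_)
          calc ε / a ≤ ε / (1 - ε * t) := by gcongr; linarith
            _ = 1 / (1 - ε * t) * ε := by ring
            _ ≤ _ := by gcongr
        have hl : ε * Real.log J.card ≤ ε * F M := by gcongr
        have hc : ε * F M ≤ ε * ((1 + κ * t) / (1 - ε * t)) * F M := by
          gcongr; exact le_mul_of_one_le_right hε.le hq2
        unfold boundAt
        rw [← hM]
        linarith

theorem capacity_le_capacityBound {KA : Hamiltonian HA} {KB : Hamiltonian HB} {R : HB →L[ℂ] HB}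
    (hR : KB.IsInvOneAdd R) {σ : State HB} {E : ℝ≥0} {F : ℝ → ℝ} (hF : KB.IsEntropyBound F)
    (hε : 0 < Φ.divergence σ) (htop : Φ.maxOutputEnergy KA KB E ≠ ⊤)
    (h0 : Φ.maxOutputEnergy KA KB E ≠ 0) :
    Φ.capacity KA E ≤ ENNReal.ofReal (Φ.capacityBound KA KB F σ E) := by
  have hpos := ENNReal.toReal_pos h0 htop
  have key : ∀ t ∈ Set.Ioc 0 (1 / (2 * Φ.divergence σ)),
      Φ.capacity KA E ≤ ENNReal.ofReal (Φ.capacityBoundAt KA KB F σ E t) := fun t ht =>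
    Φ.capacity_le_boundAt hR hF hε hpos (ENNReal.ofReal_toReal htop).ge (by positivity) ht
  have hne : (Set.Ioc 0 (1 / (2 * Φ.divergence σ))).Nonempty :=
    ⟨_, by positivity, le_rfl⟩
  obtain ⟨t₀, ht₀⟩ := hne
  have hfin : Φ.capacity KA E ≠ ⊤ := ne_top_of_le_ne_top ENNReal.ofReal_ne_top (key t₀ ht₀)
  rw [← ENNReal.ofReal_toReal hfin]
  -- `ENNReal.ofReal` truncates negative numbers, so comparisons can be pulled back to the reals
  -- only for positive capacity.
  rcases (ENNReal.toReal_nonneg (a := Φ.capacity KA E)).eq_or_lt with h | h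
  · rw [← h]; simp
  refine ENNReal.ofReal_le_ofReal (le_csInf ⟨_, t₀, ht₀, rfl⟩ ?_)
  rintro _ ⟨t, ht, rfl⟩
  have h1 := key t ht
  rw [← ENNReal.ofReal_toReal hfin] at h1
  exact ((ENNReal.ofReal_le_ofReal_iff' ).1 h1).resolve_right (by linarith)

end Channel

end CapacityBound

/-! ### Hamiltonians with a basis of eigenvectors -/

section PurePoint

variable {H : Type*} [NormedAddCommGroup H] [InnerProductSpace ℂ H] [CompleteSpace H]

theorem continuous_ite_nonpos {φ : ℝ → ℝ} (h : ContinuousOn φ (Set.Ioi 0))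
    (h0 : Tendsto φ (𝓝[>] 0) (𝓝 0)) : Continuous fun x : ℝ => if x ≤ 0 then 0 else φ x := by
  rw [continuous_iff_continuousAt]
  intro x
  rcases lt_trichotomy x 0 with hx | rfl | hx
  · refine (continuousAt_const (y := (0 : ℝ))).congr ?_
    filter_upwards [Iio_mem_nhds hx] with z hz
    rw [if_pos (le_of_lt hz)]
  · rw [ContinuousAt, if_pos le_rfl]
    have key : Tendsto (fun x : ℝ => if x ≤ 0 then 0 else φ x) (𝓝[≤] 0 ⊔ 𝓝[>] 0) (𝓝 0) := by
      refine tendsto_sup.2 ⟨?_, ?_⟩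
      · refine (tendsto_const_nhds (x := (0 : ℝ))).congr' ?_
        filter_upwards [self_mem_nhdsWithin] with z hz
        rw [if_pos (Set.mem_Iic.1 hz)]
      · refine h0.congr' ?_
        filter_upwards [self_mem_nhdsWithin] with z hz
        rw [if_neg (not_le.2 hz)]
    rwa [nhdsLE_sup_nhdsGT] at key
  · refine (h.continuousAt (Ioi_mem_nhds hx)).congr ?_
    filter_upwards [Ioi_mem_nhds hx] with z hz
    rw [if_neg (not_le.2 hz)]

namespace Hamiltonian

variable {ι : Type*} {K : Hamiltonian H} {b : HilbertBasis ι ℂ H} {l : ι → ℝ}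

variable (K) in
/-- `b` is a basis of eigenvectors of `K` with the eigenvalues `l`. -/
def IsDiagonal (b : HilbertBasis ι ℂ H) (l : ι → ℝ) : Prop :=
  ∀ n, ∃ h : b n ∈ K.op.domain, K.op ⟨b n, h⟩ = (l n : ℂ) • b n

namespace IsDiagonal

theorem nonneg (hK : K.IsDiagonal b l) (n : ι) : 0 ≤ l n := by
  obtain ⟨h, e⟩ := hK n
  have h1 := K.nonneg ⟨b n, h⟩
  rw [e, inner_smul_right, inner_self_eq_norm_sq_to_K, b.orthonormal.1 n] at h1
  simpa using h1

theorem inner_op (hK : K.IsDiagonal b l) (n : ι) (u : K.op.domain) :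
    ⟪b n, K.op u⟫_ℂ = l n * ⟪b n, (u : H)⟫_ℂ := by
  obtain ⟨h, e⟩ := hK n
  rw [← inner_op_comm ⟨b n, h⟩ u, e, inner_smul_left, Complex.conj_ofReal]

/-- Expanding in b shows that Rx is in the domain of the adjoint of K, with value x - Rx there.
Self-adjointness turns this into a statement about K, so the action of K on the eigenvectors
determines the resolvent. -/
theorem isInvOneAdd (hK : K.IsDiagonal b l) {R : H →L[ℂ] H} (hRs : IsSelfAdjoint R)
    (hR : IsDiag R b fun n => (1 + l n)⁻¹) : K.IsInvOneAdd R := by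
  intro x
  have hd := K.selfAdjoint.dense_domain
  have e : K.op.adjoint = K.op := K.selfAdjoint
  have key : ∀ u : K.op.domain, ⟪x - R x, (u : H)⟫_ℂ = ⟪R x, K.op u⟫_ℂ := by
    intro u
    rw [← b.tsum_inner_mul_inner, ← b.tsum_inner_mul_inner]
    refine tsum_congr fun n => ?_
    have h1 : ⟪R x, b n⟫_ℂ = ((1 + l n)⁻¹ : ℝ) * ⟪x, b n⟫_ℂ := by
      rw [← inner_conj_symm, hR.inner_apply hRs.isSymmetric, map_mul, Complex.conj_ofReal,
        inner_conj_symm]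
    rw [hK.inner_op, inner_sub_left, h1]
    have h2 : ((l n : ℂ)) + 1 ≠ 0 := by
      exact_mod_cast (by linarith [hK.nonneg n] : l n + 1 ≠ 0)
    push_cast
    rw [add_comm (1 : ℂ)]
    field_simp
    ring
  have hmem : R x ∈ K.op.adjoint.domain :=
    LinearPMap.mem_adjoint_domain_of_exists _ ⟨_, key⟩
  have happ : K.op.adjoint ⟨R x, hmem⟩ = x - R x :=
    LinearPMap.adjoint_apply_eq hd ⟨R x, hmem⟩ key
  have main : ∀ A : H →ₗ.[ℂ] H, A = K.op → ∀ h : R x ∈ A.domain, A ⟨R x, h⟩ = x - R x →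
      ∃ h : R x ∈ K.op.domain, R x + K.op ⟨R x, h⟩ = x := by
    rintro A rfl h h2
    exact ⟨h, by rw [h2]; abel⟩
  exact main _ e hmem happ

/-- The resolvent is obtained by functional calculus from the trace-class operator exp(-sK),
available as a trace-norm convergent series. -/
theorem exists_isInvOneAdd (hK : K.IsDiagonal b l) {s : ℝ} (hs : 0 < s)
    (hsum : Summable fun n => Real.exp (-s * l n)) :
    ∃ R : H →L[ℂ] H, IsSelfAdjoint R ∧ IsDiag R b (fun n => (1 + l n)⁻¹) := by
  have hx : Summable fun n => |Real.exp (-s * l n)| := by simpa using hsum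
  set T := (TraceClass.diag b fun n => Real.exp (-s * l n)).toCLM
  have hT : IsSelfAdjoint T := (ContinuousLinearMap.isSelfAdjoint_iff_isSymmetric).2
    (TraceClass.isSymmetric_diag b hx)
  have hd : IsDiag T b _ := TraceClass.isDiag_diag b hx
  -- At an eigenvalue exp(-s l) the ratio |log x|/s recovers l, so f has the value 1/(1 + l); it is
  -- continuous with f(0) = 0.
  set f : ℝ → ℝ := fun x => if x ≤ 0 then 0 else (1 + |Real.log x| / s)⁻¹
  have hf : Continuous f := by
    refine continuous_ite_nonpos ?_ ?_
    · refine ContinuousOn.inv₀ ?_ fun x _ => by positivity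
      refine continuousOn_const.add ((Real.continuousOn_log.mono ?_).abs.div_const s)
      intro x hx; exact (ne_of_gt hx)
    · refine Tendsto.inv_tendsto_atTop ?_
      refine tendsto_atTop_add_const_left _ _ (Tendsto.atTop_div_const hs ?_)
      exact tendsto_abs_atBot_atTop.comp Real.tendsto_log_nhdsGT_zero
  refine ⟨cfc f T, cfc_predicate f T, ?_⟩
  have := hd.cfc hT hf.continuousOn
  intro n
  rw [this n]
  simp only [f, if_neg (not_le.2 (Real.exp_pos _)), Real.log_exp]
  rw [neg_mul, abs_neg, abs_of_nonneg (mul_nonneg hs.le (hK.nonneg n)), mul_div_cancel_left₀ _ hs.ne']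

theorem gibbsCondition (hK : K.IsDiagonal b l) {s : ℝ} (hs : 0 < s)
    (hsum : Summable fun n => Real.exp (-s * l n)) : K.GibbsCondition := by
  obtain ⟨R, hRs, hR⟩ := hK.exists_isInvOneAdd hs hsum
  refine ⟨s, hs, R, hK.isInvOneAdd hRs hR, ?_⟩
  have hf : Continuous fun x : ℝ => if x ≤ 0 then 0 else Real.exp (-s * (x⁻¹ - 1)) := by
    refine continuous_ite_nonpos ?_ ?_
    · refine Real.continuous_exp.comp_continuousOn (continuousOn_const.mul
        (ContinuousOn.sub (continuousOn_id.inv₀ fun x hx => ne_of_gt hx) continuousOn_const))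
    · refine Real.tendsto_exp_atBot.comp ?_
      refine Tendsto.const_mul_atTop_of_neg (by linarith) ?_
      exact tendsto_atTop_add_const_right _ _ tendsto_inv_nhdsGT_zero
  have hp : ∀ n, 0 < (1 + l n)⁻¹ := fun n => inv_pos.2 (by linarith [hK.nonneg n])
  have e : ∀ n, (if (1 + l n)⁻¹ ≤ 0 then 0 else Real.exp (-s * (((1 + l n)⁻¹)⁻¹ - 1)))
      = Real.exp (-s * l n) := fun n => by
    rw [if_neg (not_le.2 (hp n)), inv_inv, add_sub_cancel_left]
  rw [expNeg, hR.posTrace_cfc hRs hf.continuousOn fun n => by rw [e]; positivity]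
  simp_rw [e]
  rw [← ENNReal.ofReal_tsum_of_nonneg (fun n => (Real.exp_pos _).le) hsum]
  exact ENNReal.ofReal_lt_top

/-- Finite partial sums of ψ lie in the domain of K, where a minorant is compared with K; a bounded
minorant passes to the limit. -/
theorem vecEnergy_le (hK : K.IsDiagonal b l) (ψ : H) :
    K.vecEnergy ψ ≤ ∑' n, ENNReal.ofReal (l n) * ‖⟪b n, ψ⟫_ℂ‖ₑ ^ 2 := by
  refine iSup₂_le fun B hB => ?_
  have lim := b.hasSum_repr ψ
  have lim2 : Tendsto (fun s : Finset ι => ENNReal.ofReal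
      (⟪∑ n ∈ s, b.repr ψ n • b n, B (∑ n ∈ s, b.repr ψ n • b n)⟫_ℂ).re) atTop
      (𝓝 (ENNReal.ofReal (⟪ψ, B ψ⟫_ℂ).re)) :=
    ENNReal.tendsto_ofReal ((Complex.continuous_re.tendsto _).comp
      (Tendsto.inner lim ((B.continuous.tendsto _).comp lim)))
  refine le_of_tendsto lim2 (Eventually.of_forall fun s => ?_)
  choose hmem hop using hK
  set u : K.op.domain := ∑ n ∈ s, b.repr ψ n • ⟨b n, hmem n⟩ with hu
  have hu' : (u : H) = ∑ n ∈ s, b.repr ψ n • b n := by rw [hu]; simp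
  have hKu : K.op u = ∑ n ∈ s, b.repr ψ n • (l n : ℂ) • b n := by
    rw [hu, ← LinearPMap.toFun_eq_coe, map_sum]
    refine Finset.sum_congr rfl fun n _ => ?_
    rw [map_smul, LinearPMap.toFun_eq_coe, hop]
  have h1 := hB.2 u
  rw [hu'] at h1
  refine (ENNReal.ofReal_le_ofReal h1).trans ?_
  have h2 : (⟪∑ n ∈ s, b.repr ψ n • b n, K.op u⟫_ℂ).re = ∑ n ∈ s, l n * ‖⟪b n, ψ⟫_ℂ‖ ^ 2 := by
    rw [hKu]
    simp_rw [smul_smul]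
    rw [b.orthonormal.inner_sum, Complex.re_sum]
    refine Finset.sum_congr rfl fun n _ => ?_
    rw [b.repr_apply_apply, mul_comm _ (l n : ℂ), mul_left_comm, Complex.re_ofReal_mul,
      ← Complex.normSq_eq_conj_mul_self, Complex.ofReal_re, Complex.normSq_eq_norm_sq]
  have hl : ∀ n, 0 ≤ l n := IsDiagonal.nonneg fun n => ⟨hmem n, hop n⟩
  rw [h2, ENNReal.ofReal_sum_of_nonneg fun n _ => mul_nonneg (hl n) (by positivity)]
  refine le_trans (le_of_eq (Finset.sum_congr rfl fun n _ => ?_)) (ENNReal.sum_le_tsum s)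
  rw [ENNReal.ofReal_mul (hl n), ENNReal.ofReal_pow (norm_nonneg _), ofReal_norm]

/-- The eigenvalues of the bounded minorants `approx` tend to those of K. -/
theorem le_vecEnergy (hK : K.IsDiagonal b l) {R : H →L[ℂ] H} (hRs : IsSelfAdjoint R)
    (hR : IsDiag R b fun n => (1 + l n)⁻¹) (ψ : H) :
    ∑' n, ENNReal.ofReal (l n) * ‖⟪b n, ψ⟫_ℂ‖ₑ ^ 2 ≤ K.vecEnergy ψ := by
  have hinv := hK.isInvOneAdd hRs hR
  rw [ENNReal.tsum_eq_iSup_sum]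
  refine iSup_le fun s => ?_
  have hlim : ∀ n, Tendsto (fun k : ℕ => (1 - (1 + l n)⁻¹) / (|(1 + l n)⁻¹| + 1 / ((k : ℝ) + 1)))
      atTop (𝓝 (l n)) := by
    intro n
    have h1 : 0 < 1 + l n := by linarith [hK.nonneg n]
    have h2 : Tendsto (fun k : ℕ => (1 - (1 + l n)⁻¹) / (|(1 + l n)⁻¹| + 1 / ((k : ℝ) + 1)))
      atTop (𝓝 ((1 - (1 + l n)⁻¹) / (|(1 + l n)⁻¹| + 0))) :=
      tendsto_const_nhds.div (tendsto_const_nhds.add tendsto_one_div_add_atTop_nhds_zero_nat)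
        (by positivity)
    convert h2 using 2
    rw [add_zero, abs_of_pos (inv_pos.2 h1)]
    field_simp
    ring
  have hlim2 : Tendsto (fun k : ℕ => ∑ n ∈ s, ENNReal.ofReal
      ((1 - (1 + l n)⁻¹) / (|(1 + l n)⁻¹| + 1 / ((k : ℝ) + 1))) * ‖⟪b n, ψ⟫_ℂ‖ₑ ^ 2) atTop
      (𝓝 (∑ n ∈ s, ENNReal.ofReal (l n) * ‖⟪b n, ψ⟫_ℂ‖ₑ ^ 2)) :=
    tendsto_finsetSum _ fun n _ => ENNReal.Tendsto.mul_const
      (ENNReal.tendsto_ofReal (hlim n)) (Or.inr (by simp))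
  refine le_of_tendsto hlim2 (Eventually.of_forall fun k => ?_)
  refine le_trans ?_ (Hamiltonian.le_vecEnergy (hinv.isMinorant_approx k) ψ)
  have hda : IsDiag (IsInvOneAdd.approx R k) b _ := hR.cfc hRs
    (IsInvOneAdd.continuous_div_abs_add (by fun_prop) k).continuousOn
  rw [hda.ofReal_inner_apply (hinv.isMinorant_approx k).1]
  exact ENNReal.sum_le_tsum s

theorem energy_eq (hK : K.IsDiagonal b l) {R : H →L[ℂ] H} (hRs : IsSelfAdjoint R)
    (hR : IsDiag R b fun n => (1 + l n)⁻¹) (ρ : State H) :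
    K.energy ρ.op = ∑' n, ENNReal.ofReal (l n) * ENNReal.ofReal (⟪b n, ρ.op (b n)⟫_ℂ).re := by
  obtain ⟨w, hw, hd⟩ := ρ.exists_isDiag
  rw [(hK.isInvOneAdd hRs hR).energy_eq_tsum hd]
  have h1 : ∀ ψ, K.vecEnergy ψ = ∑' n, ENNReal.ofReal (l n) * ‖⟪b n, ψ⟫_ℂ‖ₑ ^ 2 := fun ψ =>
    le_antisymm (hK.vecEnergy_le ψ) (hK.le_vecEnergy hRs hR ψ)
  simp_rw [h1, ← ENNReal.tsum_mul_left]
  rw [ENNReal.tsum_comm]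
  refine tsum_congr fun n => ?_
  rw [hd.ofReal_inner_apply ρ.isPositive (b n), ← ENNReal.tsum_mul_left]
  refine tsum_congr fun i => ?_
  rw [← ofReal_norm, norm_inner_symm, ofReal_norm]
  ring

theorem le_groundEnergy (hK : K.IsDiagonal b l) {R : H →L[ℂ] H} (hRs : IsSelfAdjoint R)
    (hR : IsDiag R b fun n => (1 + l n)⁻¹) [Nonempty ι] {c : ℝ} (hc : ∀ n, c ≤ l n) :
    c ≤ K.groundEnergy := by
  obtain ⟨n₀⟩ := ‹Nonempty ι›
  obtain ⟨h0, -⟩ := hK n₀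
  have : Nonempty {φ : K.op.domain // ‖(φ : H)‖ = 1} := ⟨⟨⟨b n₀, h0⟩, b.orthonormal.1 n₀⟩⟩
  refine le_ciInf fun φ => ?_
  obtain ⟨φ, hφ⟩ := φ
  refine (ENNReal.ofReal_le_ofReal_iff (K.nonneg φ)).1 ?_
  have h1 : K.vecEnergy φ ≤ ENNReal.ofReal (⟪(φ : H), K.op φ⟫_ℂ).re :=
    iSup₂_le fun B hB => ENNReal.ofReal_le_ofReal (hB.2 φ)
  refine le_trans ?_ ((hK.le_vecEnergy hRs hR φ).trans h1)
  calc ENNReal.ofReal c = ∑' n, ENNReal.ofReal c * ‖⟪b n, (φ : H)⟫_ℂ‖ₑ ^ 2 := by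
        rw [ENNReal.tsum_mul_left, tsum_enorm_inner_sq, ← ofReal_norm, hφ]; simp
    _ ≤ _ := ENNReal.tsum_le_tsum fun n => by gcongr; exact hc n

end IsDiagonal

end Hamiltonian

end PurePoint

/-! ### Oscillator levels and the partition function -/

section OscillatorSpectrum

variable {ℓ : ℕ}

/-- The energy of the number state `|n⟩` of oscillators with the quanta `c i`. -/
def oscLevel (c : Fin ℓ → ℝ) (n : Fin ℓ → ℕ) : ℝ := ∑ i, c i * (n i + 1 / 2)

theorem creation_annihilation_single (i : Fin ℓ) (n : Fin ℓ → ℕ) :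
    creation i (annihilation i (Finsupp.single n 1)) = (n i : ℂ) • Finsupp.single n (1 : ℂ) := by
  have h1 : annihilation i (Finsupp.single n (1 : ℂ))
      = ((Real.sqrt (n i) : ℝ) : ℂ) • Finsupp.single (n - Pi.single i 1) (1 : ℂ) := by
    simp [annihilation]
  have h2 : ∀ m : Fin ℓ → ℕ, creation i (Finsupp.single m (1 : ℂ))
      = ((Real.sqrt (m i + 1) : ℝ) : ℂ) • Finsupp.single (m + Pi.single i 1) (1 : ℂ) := by
    intro m; simp [creation]
  rw [h1, map_smul, h2, smul_smul]
  -- At nᵢ = 0 the subtraction on ℕ is truncated, but the factor √0 removes the term.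
  rcases Nat.eq_zero_or_pos (n i) with h | h
  · simp [h]
  · have e1 : n - Pi.single i 1 + Pi.single i 1 = n := by
      funext j
      by_cases hj : j = i
      · subst hj; simp; omega
      · simp [hj]
    have e2 : (((n - Pi.single i 1 : Fin ℓ → ℕ) i : ℕ) : ℝ) + 1 = n i := by
      have : (n - Pi.single i 1 : Fin ℓ → ℕ) i + 1 = n i := by simp; omega
      exact_mod_cast this
    rw [e1, e2, ← Complex.ofReal_mul, Real.mul_self_sqrt (Nat.cast_nonneg _)]
    simp

theorem oscillatorOp_single (ħ : ℝ) (ω : Fin ℓ → ℝ) (n : Fin ℓ → ℕ) :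
    oscillatorOp ħ ω (Finsupp.single n 1)
      = ((oscLevel (fun i => ħ * ω i) n : ℝ) : ℂ) • Finsupp.single n (1 : ℂ) := by
  rw [oscillatorOp, LinearMap.sum_apply, oscLevel, Complex.ofReal_sum, Finset.sum_smul]
  refine Finset.sum_congr rfl fun i _ => ?_
  rw [LinearMap.smul_apply, LinearMap.add_apply, LinearMap.comp_apply,
    creation_annihilation_single, LinearMap.smul_apply, LinearMap.id_apply, ← add_smul, smul_smul]
  push_cast; rfl

theorem Hamiltonian.IsOscillator.exists_isDiagonal {H : Type*} [NormedAddCommGroup H]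
    [InnerProductSpace ℂ H] [CompleteSpace H] {K : Hamiltonian H} {ħ : ℝ} {ω : Fin ℓ → ℝ}
    (hK : K.IsOscillator ħ ω) :
    ∃ b : HilbertBasis (Fin ℓ → ℕ) ℂ H, K.IsDiagonal b (oscLevel fun i => ħ * ω i) := by
  obtain ⟨b, hb⟩ := hK
  refine ⟨b, fun n => ?_⟩
  obtain ⟨h, e⟩ := hb (Finsupp.single n 1)
  have h1 : Finsupp.linearCombination ℂ b (Finsupp.single n 1) = b n := by simp
  rw [oscillatorOp_single, map_smul] at e
  simp only [h1] at e
  exact ⟨h1 ▸ h, e⟩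

theorem tsum_pi_prod : ∀ {ℓ : ℕ} (f : Fin ℓ → ℕ → ℝ≥0∞),
    ∑' n : Fin ℓ → ℕ, ∏ i, f i (n i) = ∏ i, ∑' k, f i k
  | 0, f => by simp [tsum_fintype]
  | ℓ + 1, f => by
    rw [Fin.prod_univ_succ, ← tsum_pi_prod (fun i => f i.succ),
      ← (Fin.consEquiv fun _ : Fin (ℓ + 1) => ℕ).tsum_eq, ENNReal.tsum_prod', ← ENNReal.tsum_mul_right]
    refine tsum_congr fun k => ?_
    rw [← ENNReal.tsum_mul_left]
    refine tsum_congr fun n => ?_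
    rw [Fin.prod_univ_succ]
    rfl

variable {c : Fin ℓ → ℝ}

/-- The geometric series sums to 1/(2 sinh(x/2)), and sinh u ≥ u for u ≥ 0. -/
theorem tsum_exp_half_le {x : ℝ} (hx : 0 < x) :
    ∑' k : ℕ, ENNReal.ofReal (Real.exp (-(x * (k + 1 / 2)))) ≤ ENNReal.ofReal (1 / x) := by
  have e : ∀ k : ℕ, Real.exp (-(x * (k + 1 / 2))) = Real.exp (-(x / 2)) * Real.exp (-x) ^ k := by
    intro k
    rw [← Real.exp_nat_mul, ← Real.exp_add]; congr 1; ring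
  have h1 : Real.exp (-x) < 1 := Real.exp_lt_one_iff.2 (by linarith)
  have hs := (hasSum_geometric_of_lt_one (Real.exp_pos _).le h1).mul_left (Real.exp (-(x / 2)))
  simp_rw [← e] at hs
  rw [← ENNReal.ofReal_tsum_of_nonneg (fun k => (Real.exp_pos _).le) hs.summable, hs.tsum_eq]
  refine ENNReal.ofReal_le_ofReal ?_
  rw [← div_eq_mul_inv, div_le_div_iff₀ (by linarith) hx]
  have h2 : x / 2 ≤ Real.sinh (x / 2) := Real.self_le_sinh_iff.2 (by positivity)
  rw [Real.sinh_eq] at h2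
  have h3 : Real.exp (-x) = Real.exp (-(x / 2)) * Real.exp (-(x / 2)) := by
    rw [← Real.exp_add]; congr 1; ring
  have h4 : Real.exp (-(x / 2)) * Real.exp (x / 2) = 1 := by rw [← Real.exp_add]; simp
  have h5 := mul_le_mul_of_nonneg_left h2 (Real.exp_pos (-(x / 2))).le
  rw [h3]
  nlinarith

theorem tsum_exp_oscLevel_le (hc : ∀ i, 0 < c i) {s : ℝ} (hs : 0 < s) :
    ∑' n, ENNReal.ofReal (Real.exp (-s * oscLevel c n)) ≤ ENNReal.ofReal (∏ i, 1 / (s * c i)) := by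
  have e : ∀ n : Fin ℓ → ℕ, ENNReal.ofReal (Real.exp (-s * oscLevel c n))
      = ∏ i, ENNReal.ofReal (Real.exp (-(s * c i * (n i + 1 / 2)))) := by
    intro n
    rw [← ENNReal.ofReal_prod_of_nonneg fun i _ => (Real.exp_pos _).le, ← Real.exp_sum, oscLevel,
      Finset.mul_sum]
    congr 2
    exact Finset.sum_congr rfl fun i _ => by ring
  simp_rw [e]
  rw [tsum_pi_prod fun i (k : ℕ) => ENNReal.ofReal (Real.exp (-(s * c i * (k + 1 / 2)))),
    ENNReal.ofReal_prod_of_nonneg fun i _ => by have := hc i; positivity]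
  exact Finset.prod_le_prod' fun i _ => tsum_exp_half_le (mul_pos hs (hc i))

theorem summable_exp_oscLevel (hc : ∀ i, 0 < c i) {s : ℝ} (hs : 0 < s) :
    Summable fun n => Real.exp (-s * oscLevel c n) := by
  have h := ne_top_of_le_ne_top ENNReal.ofReal_ne_top (tsum_exp_oscLevel_le hc hs)
  refine (ENNReal.summable_toReal h).congr fun n => ENNReal.toReal_ofReal (Real.exp_pos _).le

theorem half_sum_le_oscLevel (hc : ∀ i, 0 < c i) (n : Fin ℓ → ℕ) :
    1 / 2 * ∑ i, c i ≤ oscLevel c n := by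
  rw [oscLevel, Finset.mul_sum]
  refine Finset.sum_le_sum fun i _ => ?_
  have := mul_nonneg (hc i).le (Nat.cast_nonneg (α := ℝ) (n i))
  linarith

end OscillatorSpectrum

/-! ### Entropy at given energy: the Gibbs variational principle -/

section OscillatorEntropy

variable {H : Type*} [NormedAddCommGroup H] [InnerProductSpace ℂ H] [CompleteSpace H]

theorem relEntropy_add_entropy_le_of_isDiag {ρ ω : State H} {ι : Type*} {b : HilbertBasis ι ℂ H}
    {q : ι → ℝ} (hω : IsDiag ω.op b q) : relEntropy ρ.op ω.op + entropy ρ.op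
      ≤ ∑' n, negLog (q n) * ENNReal.ofReal (⟪b n, ρ.op (b n)⟫_ℂ).re := by
  refine (relEntropy_add_entropy_le (b.isEigenbasis_range hω)).trans (le_of_eq ?_)
  rw [← (Equiv.ofInjective b b.orthonormal.linearIndependent.injective).tsum_eq]
  refine tsum_congr fun n => ?_
  rw [Equiv.ofInjective_apply, hω.inner_self, Complex.ofReal_re]

variable {ℓ : ℕ} {K : Hamiltonian H} {b : HilbertBasis (Fin ℓ → ℕ) ℂ H} {c : Fin ℓ → ℝ}

/-- The entropy is at most the cross entropy with the Gibbs state at inverse temperature s, which is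
s times the energy plus log Z, and Z ≤ ∏ 1/(s cᵢ). -/
theorem entropy_le_of_oscLevel (hc : ∀ i, 0 < c i) (ρ : State H) {s E : ℝ} (hs : 0 < s) (hE : 0 ≤ E)
    (hρ : ∑' n, ENNReal.ofReal (oscLevel c n) * ENNReal.ofReal (⟪b n, ρ.op (b n)⟫_ℂ).re
      ≤ ENNReal.ofReal E) :
    entropy ρ.op ≤ ENNReal.ofReal (s * E - ∑ i, Real.log (s * c i)) := by
  have hsum := summable_exp_oscLevel hc hs
  set Z := ∑' n, Real.exp (-s * oscLevel c n) with hZ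
  have hZ0 : 0 < Z := hsum.tsum_pos (fun n => (Real.exp_pos _).le) 0 (Real.exp_pos _)
  have hZle : Z ≤ ∏ i, 1 / (s * c i) := by
    have h := tsum_exp_oscLevel_le hc hs
    rw [← ENNReal.ofReal_tsum_of_nonneg (fun n => (Real.exp_pos _).le) hsum] at h
    exact (ENNReal.ofReal_le_ofReal_iff (Finset.prod_nonneg fun i _ => by
      have := hc i; positivity)).1 h
  have hlogZ : Real.log Z ≤ -∑ i, Real.log (s * c i) := by
    refine (Real.log_le_log hZ0 hZle).trans (le_of_eq ?_)
    rw [Real.log_prod fun i _ => by have := hc i; positivity, ← Finset.sum_neg_distrib]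
    exact Finset.sum_congr rfl fun i _ => by rw [one_div, Real.log_inv]
  have h0 : ∀ n, 0 ≤ Real.exp (-s * oscLevel c n) / Z := fun n => by positivity
  have h1 : HasSum (fun n => Real.exp (-s * oscLevel c n) / Z) 1 := by
    have := hsum.hasSum.div_const Z
    rwa [← hZ, div_self hZ0.ne'] at this
  set ω := State.diag b _ h0 h1
  have hω : IsDiag ω.op b _ := State.isDiag_diag b _ h0 h1
  have hneg : ∀ n, negLog (Real.exp (-s * oscLevel c n) / Z)
      = ENNReal.ofReal (s * oscLevel c n + Real.log Z) := fun n => by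
    rw [negLog, if_neg (by positivity), Real.log_div (Real.exp_pos _).ne' hZ0.ne', Real.log_exp]
    congr 1; ring
  have hl0 : ∀ n, 0 ≤ oscLevel c n := fun n =>
    Finset.sum_nonneg fun i _ => by have := hc i; positivity
  have hρ1 := ρ.hasSum_inner b
  have hρ0 : ∀ n, 0 ≤ (⟪b n, ρ.op (b n)⟫_ℂ).re := fun n => ρ.re_inner_nonneg _
  have hq1 : ∀ n, 0 ≤ s * oscLevel c n + Real.log Z := fun n => by
    have h2 : Real.exp (-s * oscLevel c n) / Z ≤ 1 := le_hasSum h1 n fun j _ => h0 j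
    have h3 := Real.log_nonpos (h0 n) h2
    rw [Real.log_div (Real.exp_pos _).ne' hZ0.ne', Real.log_exp] at h3
    linarith
  have hsl : Summable fun n => oscLevel c n * (⟪b n, ρ.op (b n)⟫_ℂ).re := by
    have h := ENNReal.summable_toReal (ne_top_of_le_ne_top ENNReal.ofReal_ne_top hρ)
    refine h.congr fun n => ?_
    rw [ENNReal.toReal_mul, ENNReal.toReal_ofReal (hl0 n), ENNReal.toReal_ofReal (hρ0 n)]
  have hEl : ∑' n, oscLevel c n * (⟪b n, ρ.op (b n)⟫_ℂ).re ≤ E := by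
    refine (ENNReal.ofReal_le_ofReal_iff hE).1 (le_trans (le_of_eq ?_) hρ)
    rw [ENNReal.ofReal_tsum_of_nonneg (fun n => mul_nonneg (hl0 n) (hρ0 n)) hsl]
    exact tsum_congr fun n => ENNReal.ofReal_mul (hl0 n)
  have htot : HasSum (fun n => (s * oscLevel c n + Real.log Z) * (⟪b n, ρ.op (b n)⟫_ℂ).re)
      (s * ∑' n, oscLevel c n * (⟪b n, ρ.op (b n)⟫_ℂ).re + Real.log Z * 1) := by
    have e : (fun n => (s * oscLevel c n + Real.log Z) * (⟪b n, ρ.op (b n)⟫_ℂ).re)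
        = fun n => s * (oscLevel c n * (⟪b n, ρ.op (b n)⟫_ℂ).re)
          + Real.log Z * (⟪b n, ρ.op (b n)⟫_ℂ).re := by funext n; ring
    rw [e]
    exact (hsl.hasSum.mul_left s).add (hρ1.mul_left (Real.log Z))
  calc entropy ρ.op ≤ relEntropy ρ.op ω.op + entropy ρ.op := le_add_self
    _ ≤ _ := relEntropy_add_entropy_le_of_isDiag hω
    _ = ENNReal.ofReal (s * ∑' n, oscLevel c n * (⟪b n, ρ.op (b n)⟫_ℂ).re + Real.log Z * 1) := by
      rw [← htot.tsum_eq, ENNReal.ofReal_tsum_of_nonneg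
        (fun n => mul_nonneg (hq1 n) (hρ0 n)) htot.summable]
      exact tsum_congr fun n => by rw [hneg, ENNReal.ofReal_mul (hq1 n)]
    _ ≤ _ := ENNReal.ofReal_le_ofReal (by nlinarith)

end OscillatorEntropy

/-! ### Admissibility of the oscillator entropy bound -/

section OscillatorEntropyBound

variable {ℓ : ℕ} {ħ : ℝ} {ω : Fin ℓ → ℝ}

theorem oscillatorEntropyBound_eq (hℓ : 0 < ℓ) (hc : ∀ i, 0 < ħ * ω i) {E : ℝ}
    (hE : 0 < E + 1 / 2 * ∑ i, ħ * ω i) :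
    oscillatorEntropyBound ħ ω E = ℓ * Real.log (E + 1 / 2 * ∑ i, ħ * ω i)
      + (ℓ - ℓ * Real.log ℓ - ∑ i, Real.log (ħ * ω i)) := by
  have hℓ' : (0 : ℝ) < ℓ := by exact_mod_cast hℓ
  have hP : 0 < ∏ i, ħ * ω i := Finset.prod_pos fun i _ => hc i
  have hr : 0 < (∏ i, ħ * ω i) ^ (1 / (ℓ : ℝ)) := Real.rpow_pos_of_pos hP _
  rw [oscillatorEntropyBound, Real.log_div hE.ne' (mul_pos hℓ' hr).ne',
    Real.log_mul hℓ'.ne' hr.ne', Real.log_rpow hP, Real.log_prod fun i _ => (hc i).ne']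
  field_simp
  ring

theorem hasDerivAt_oscillatorEntropyBound (hℓ : 0 < ℓ) (hc : ∀ i, 0 < ħ * ω i) {E : ℝ}
    (hE : 0 < E) :
    HasDerivAt (oscillatorEntropyBound ħ ω) (ℓ / (E + 1 / 2 * ∑ i, ħ * ω i)) E := by
  have h0 : 0 ≤ 1 / 2 * ∑ i, ħ * ω i :=
    mul_nonneg (by norm_num) (Finset.sum_nonneg fun i _ => (hc i).le)
  have h1 : HasDerivAt (fun E : ℝ => ℓ * Real.log (E + 1 / 2 * ∑ i, ħ * ω i)
      + (ℓ - ℓ * Real.log ℓ - ∑ i, Real.log (ħ * ω i))) (ℓ / (E + 1 / 2 * ∑ i, ħ * ω i)) E := by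
    have := ((((hasDerivAt_id E).add_const (1 / 2 * ∑ i, ħ * ω i)).log
      (by simp only [id]; linarith)).const_mul (ℓ : ℝ)).add_const
      (ℓ - ℓ * Real.log ℓ - ∑ i, Real.log (ħ * ω i))
    simpa [div_eq_mul_inv] using this
  refine h1.congr_of_eventuallyEq ?_
  filter_upwards [Ioi_mem_nhds hE] with x hx
  exact oscillatorEntropyBound_eq hℓ hc (by have : 0 < x := hx; linarith)

/-- By the inequality of arithmetic and geometric means the argument of the logarithm is at least
1/2, and log 2 < 1. -/
theorem oscillatorEntropyBound_pos (hℓ : 0 < ℓ) (hc : ∀ i, 0 < ħ * ω i) {E : ℝ} (hE : 0 ≤ E) :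
    0 < oscillatorEntropyBound ħ ω E := by
  have hℓ' : (0 : ℝ) < ℓ := by exact_mod_cast hℓ
  have hP : 0 < ∏ i, ħ * ω i := Finset.prod_pos fun i _ => hc i
  have hr : 0 < (∏ i, ħ * ω i) ^ (1 / (ℓ : ℝ)) := Real.rpow_pos_of_pos hP _
  have hamgm : (∏ i, ħ * ω i) ^ (1 / (ℓ : ℝ)) ≤ ∑ i, 1 / (ℓ : ℝ) * (ħ * ω i) := by
    rw [← Real.finsetProd_rpow _ _ fun i _ => (hc i).le]
    exact Real.geom_mean_le_arith_mean_weighted Finset.univ (fun _ => 1 / (ℓ : ℝ)) _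
      (fun _ _ => by positivity) (by simp [hℓ'.ne']) fun i _ => (hc i).le
  rw [← Finset.mul_sum, one_div, ← div_eq_inv_mul, le_div_iff₀ hℓ'] at hamgm
  have h1 : 1 / 2 ≤ (E + 1 / 2 * ∑ i, ħ * ω i) / (ℓ * (∏ i, ħ * ω i) ^ (1 / (ℓ : ℝ))) := by
    rw [le_div_iff₀ (mul_pos hℓ' hr), one_div (ℓ : ℝ)]
    linarith
  have h2 := Real.log_le_log (by norm_num) h1
  rw [one_div, Real.log_inv] at h2
  have h3 := Real.log_two_lt_d9
  rw [oscillatorEntropyBound]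
  nlinarith

variable {H : Type*} [NormedAddCommGroup H] [InnerProductSpace ℂ H] [CompleteSpace H]
  {K : Hamiltonian H} {b : HilbertBasis (Fin ℓ → ℕ) ℂ H}

theorem isEntropyBound_oscillator (hℓ : 0 < ℓ) (hc : ∀ i, 0 < ħ * ω i)
    (hK : K.IsDiagonal b (oscLevel fun i => ħ * ω i)) {R : H →L[ℂ] H} (hRs : IsSelfAdjoint R)
    (hR : IsDiag R b fun n => (1 + oscLevel (fun i => ħ * ω i) n)⁻¹) :
    K.IsEntropyBound (oscillatorEntropyBound ħ ω) := by
  have hℓ' : (0 : ℝ) < ℓ := by exact_mod_cast hℓ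
  have hne : (Finset.univ : Finset (Fin ℓ)).Nonempty := ⟨⟨0, hℓ⟩, Finset.mem_univ _⟩
  have h0 : 0 < 1 / 2 * ∑ i, ħ * ω i :=
    mul_pos (by norm_num) (Finset.sum_pos (fun i _ => hc i) hne)
  have heq : Set.EqOn (oscillatorEntropyBound ħ ω)
      (fun E => ℓ * Real.log (E + 1 / 2 * ∑ i, ħ * ω i)
      + (ℓ - ℓ * Real.log ℓ - ∑ i, Real.log (ħ * ω i))) (Set.Ici 0) := fun E hE =>
    oscillatorEntropyBound_eq hℓ hc (by have : 0 ≤ E := hE; linarith)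
  refine ⟨?_, ?_, fun E _ => iSup₂_le fun ρ hρ => ?_, fun E hE =>
    oscillatorEntropyBound_pos hℓ hc hE.le, fun E hE => ?_, fun E hE => ?_⟩
  · refine ContinuousOn.congr ?_ heq
    refine (continuousOn_const.mul (ContinuousOn.log (by fun_prop) fun E hE => ?_)).add
      continuousOn_const
    have : 0 ≤ E := hE
    linarith
  · refine ContDiffOn.congr ?_ (heq.mono Set.Ioi_subset_Ici_self)
    refine (contDiffOn_const.mul (ContDiffOn.log (by fun_prop) fun E hE => ?_)).add contDiffOn_const
    have : 0 < E := hE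
    linarith
  · have hE0 : 1 / 2 * ∑ i, ħ * ω i ≤ (E : ℝ) := by
      have h1 := (Hamiltonian.ofReal_groundEnergy_le ρ).trans hρ
      rw [← ENNReal.ofReal_coe_nnreal] at h1
      exact (hK.le_groundEnergy hRs hR (half_sum_le_oscLevel hc)).trans
        ((ENNReal.ofReal_le_ofReal_iff E.2).1 h1)
    have hEp : (0 : ℝ) < E := h0.trans_le hE0
    rw [hK.energy_eq hRs hR, ← ENNReal.ofReal_coe_nnreal] at hρ
    -- This s minimizes sE - ∑ log(s cᵢ).
    refine (entropy_le_of_oscLevel hc ρ (s := ℓ / E) (by positivity) hEp.le hρ).trans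
      (ENNReal.ofReal_le_ofReal ?_)
    rw [oscillatorEntropyBound_eq hℓ hc (by linarith)]
    have h2 : ∑ i, Real.log (ℓ / E * (ħ * ω i))
        = ℓ * Real.log ℓ - ℓ * Real.log E + ∑ i, Real.log (ħ * ω i) := by
      rw [Finset.sum_congr rfl fun i _ => Real.log_mul (by positivity) (hc i).ne',
        Finset.sum_add_distrib, Finset.sum_const, Finset.card_univ, Fintype.card_fin, nsmul_eq_mul,
        Real.log_div hℓ'.ne' hEp.ne']
      ring
    have h3 : Real.log E ≤ Real.log (E + 1 / 2 * ∑ i, ħ * ω i) :=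
      Real.log_le_log hEp (by linarith)
    have h4 : (ℓ : ℝ) / E * E = ℓ := by field_simp
    rw [h2, h4]
    nlinarith
  · rw [(hasDerivAt_oscillatorEntropyBound hℓ hc hE).deriv]
    have : 0 < E + 1 / 2 * ∑ i, ħ * ω i := by linarith
    positivity
  · have h1 : deriv (oscillatorEntropyBound ħ ω) =ᶠ[𝓝 E]
        fun E => ℓ * (E + 1 / 2 * ∑ i, ħ * ω i)⁻¹ := by
      filter_upwards [Ioi_mem_nhds hE] with x hx
      rw [(hasDerivAt_oscillatorEntropyBound hℓ hc hx).deriv, div_eq_mul_inv]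
    have hp : 0 < E + 1 / 2 * ∑ i, ħ * ω i := by linarith
    have h2 : HasDerivAt (fun E => ℓ * (E + 1 / 2 * ∑ i, ħ * ω i)⁻¹)
        (ℓ * (-1 / (E + 1 / 2 * ∑ i, ħ * ω i) ^ 2)) E :=
      (((hasDerivAt_id E).add_const (1 / 2 * ∑ i, ħ * ω i)).inv hp.ne').const_mul (ℓ : ℝ)
    rw [h1.deriv_eq, h2.deriv]
    have : (0 : ℝ) ≤ 1 / (E + 1 / 2 * ∑ i, ħ * ω i) ^ 2 := by positivity
    rw [neg_div]
    nlinarith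

end OscillatorEntropyBound

/-! ### The channel mixing the input with a fixed state -/

section MixChannel

variable {H : Type*} [NormedAddCommGroup H] [InnerProductSpace ℂ H] [CompleteSpace H]

/-- Complete positivity of T ↦ (Tr T) σ. Expanding the trace in a basis vector e and σ in an
eigenvector f, each term is an eigenvalue of σ times the block form of T at the vectors ⟨f, yⱼ⟩ e.
-/
theorem sum_trace_mul_inner_nonneg (σ : State H) {n : ℕ} {T : Fin n → Fin n → TraceClass H}
    (hT : ∀ x : Fin n → H, 0 ≤ ∑ i, ∑ j, ⟪x i, (T i j).toCLM (x j)⟫_ℂ) (y : Fin n → H) :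
    0 ≤ ∑ i, ∑ j, trace (T i j).toCLM * ⟪y i, σ.op (y j)⟫_ℂ := by
  obtain ⟨w, hw, hd⟩ := σ.exists_isDiag
  have hs := (TraceClass.summable_abs_of_isDiag (T := σ.toTC) hd).1
  have hσ : ∀ u v : H, HasSum (fun k : w => (((⟪(k : H), σ.op k⟫_ℂ).re : ℝ) : ℂ) *
      (⟪u, hw.basis k⟫_ℂ * ⟪hw.basis k, v⟫_ℂ)) ⟪u, σ.op v⟫_ℂ := by
    intro u v
    have := TraceClass.hasSum_inner_diag hw.basis hs u v
    rwa [← TraceClass.eq_diag (T := σ.toTC) hd] at this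
  have htr : HasSum (fun m => ∑ i, ∑ j, ⟪stdBasis H m, (T i j).toCLM (stdBasis H m)⟫_ℂ *
      ⟪y i, σ.op (y j)⟫_ℂ) (∑ i, ∑ j, trace (T i j).toCLM * ⟪y i, σ.op (y j)⟫_ℂ) :=
    hasSum_sum fun i _ => hasSum_sum fun j _ =>
      (TraceClass.hasSum_traceOn (stdBasis H) (T i j)).mul_right _
  refine htr.nonneg fun m => ?_
  have hin : HasSum (fun k : w => ∑ i, ∑ j, ⟪stdBasis H m, (T i j).toCLM (stdBasis H m)⟫_ℂ *
      ((((⟪(k : H), σ.op k⟫_ℂ).re : ℝ) : ℂ) * (⟪y i, hw.basis k⟫_ℂ * ⟪hw.basis k, y j⟫_ℂ)))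
      (∑ i, ∑ j, ⟪stdBasis H m, (T i j).toCLM (stdBasis H m)⟫_ℂ * ⟪y i, σ.op (y j)⟫_ℂ) :=
    hasSum_sum fun i _ => hasSum_sum fun j _ => (hσ _ _).mul_left _
  refine hin.nonneg fun k => ?_
  have h1 := hT fun j => ⟪hw.basis k, y j⟫_ℂ • stdBasis H m
  have h2 : (0 : ℂ) ≤ (((⟪(k : H), σ.op k⟫_ℂ).re : ℝ) : ℂ) := by
    exact_mod_cast σ.re_inner_nonneg (k : H)
  refine (mul_nonneg h2 h1).trans (le_of_eq ?_)
  simp_rw [Finset.mul_sum]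
  refine Finset.sum_congr rfl fun i _ => Finset.sum_congr rfl fun j _ => ?_
  rw [map_smul, inner_smul_left, inner_smul_right, inner_conj_symm]
  ring

/-- The channel `T ↦ (1 - ε) (Tr T) σ + ε T`. -/
def mixChannel (σ : State H) (ε : ℝ) (h0 : 0 ≤ ε) (h1 : ε ≤ 1) : Channel H H where
  map :=
    { toFun := fun T => (((1 - ε : ℝ) : ℂ) * trace T.toCLM) • σ.toTC + (ε : ℂ) • T
      map_add' := fun S T => by
        rw [TraceClass.trace_eq_traceOn, TraceClass.trace_eq_traceOn, TraceClass.trace_eq_traceOn,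
          map_add]
        module
      map_smul' := fun c T => by
        rw [TraceClass.trace_eq_traceOn, TraceClass.trace_eq_traceOn, map_smul, RingHom.id_apply,
          smul_eq_mul]
        module }
  completelyPositive := fun n T hT y => by
    have e : ∑ i, ∑ j, ⟪y i, ((((1 - ε : ℝ) : ℂ) * trace (T i j).toCLM) • σ.toTC
          + (ε : ℂ) • T i j).toCLM (y j)⟫_ℂ
        = ((1 - ε : ℝ) : ℂ) * (∑ i, ∑ j, trace (T i j).toCLM * ⟪y i, σ.op (y j)⟫_ℂ)
          + (ε : ℂ) * ∑ i, ∑ j, ⟪y i, (T i j).toCLM (y j)⟫_ℂ := by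
      simp_rw [Finset.mul_sum, ← Finset.sum_add_distrib]
      refine Finset.sum_congr rfl fun i _ => Finset.sum_congr rfl fun j _ => ?_
      rw [map_add, map_smul, map_smul, add_apply, smul_apply, smul_apply, inner_add_right,
        inner_smul_right, inner_smul_right, mul_assoc]
      rfl
    change 0 ≤ ∑ i, ∑ j, ⟪y i, ((((1 - ε : ℝ) : ℂ) * trace (T i j).toCLM) • σ.toTC
          + (ε : ℂ) • T i j).toCLM (y j)⟫_ℂ
    rw [e]
    have h2 : (0 : ℂ) ≤ ((1 - ε : ℝ) : ℂ) := by exact_mod_cast sub_nonneg.2 h1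
    have h3 : (0 : ℂ) ≤ (ε : ℂ) := by exact_mod_cast h0
    exact add_nonneg (mul_nonneg h2 (sum_trace_mul_inner_nonneg σ hT y)) (mul_nonneg h3 (hT y))
  tracePreserving := fun T => by
    change trace ((((1 - ε : ℝ) : ℂ) * trace T.toCLM) • σ.toTC + (ε : ℂ) • T).toCLM = _
    have h := σ.trace_op
    rw [← State.toCLM_toTC, TraceClass.trace_eq_traceOn] at h
    rw [TraceClass.trace_eq_traceOn, map_add, map_smul, map_smul, h, TraceClass.trace_eq_traceOn]
    simp only [smul_eq_mul]
    push_cast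
    ring

variable (σ : State H) {ε : ℝ} (h0 : 0 ≤ ε) (h1 : ε ≤ 1)

theorem mixChannel_onState_toTC (ρ : State H) :
    ((mixChannel σ ε h0 h1).onState ρ).toTC = ((1 - ε : ℝ) : ℂ) • σ.toTC + (ε : ℂ) • ρ.toTC := by
  change (((1 - ε : ℝ) : ℂ) * trace ρ.op) • σ.toTC + (ε : ℂ) • ρ.toTC = _
  rw [ρ.trace_op, mul_one]

theorem mixChannel_inner (ρ : State H) (x y : H) :
    ⟪x, ((mixChannel σ ε h0 h1).onState ρ).op y⟫_ℂ
      = ((1 - ε : ℝ) : ℂ) * ⟪x, σ.op y⟫_ℂ + (ε : ℂ) * ⟪x, ρ.op y⟫_ℂ := by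
  rw [State.op, mixChannel_onState_toTC, map_add, map_smul, map_smul, add_apply, smul_apply,
    smul_apply, inner_add_right, inner_smul_right, inner_smul_right]
  rfl

theorem mixChannel_re_inner (ρ : State H) (x : H) :
    (⟪x, ((mixChannel σ ε h0 h1).onState ρ).op x⟫_ℂ).re
      = (1 - ε) * (⟪x, σ.op x⟫_ℂ).re + ε * (⟪x, ρ.op x⟫_ℂ).re := by
  rw [mixChannel_inner, Complex.add_re, Complex.re_ofReal_mul, Complex.re_ofReal_mul]

theorem mixChannel_divergence {ι : Type*} [Infinite ι] (b : HilbertBasis ι ℂ H) :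
    (mixChannel σ ε h0 h1).divergence σ = ε := by
  have e : ∀ ρ : State H, ‖((mixChannel σ ε h0 h1).onState ρ).toTC - σ.toTC‖
      = ε * ‖ρ.toTC - σ.toTC‖ := by
    intro ρ
    rw [mixChannel_onState_toTC]
    have : ((1 - ε : ℝ) : ℂ) • σ.toTC + (ε : ℂ) • ρ.toTC - σ.toTC
        = (ε : ℂ) • (ρ.toTC - σ.toTC) := by push_cast; module
    rw [this, norm_smul, Complex.norm_real, Real.norm_of_nonneg h0]
  have hbd : ∀ ρ : State H, ‖ρ.toTC - σ.toTC‖ ≤ 2 := fun ρ =>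
    (norm_sub_le _ _).trans (by linarith [ρ.norm_toTC_le, σ.norm_toTC_le])
  refine le_antisymm ?_ (le_of_forall_pos_sub_le fun δ hδ => ?_)
  · have : Nonempty (State H) := ⟨σ⟩
    rw [Channel.divergence]
    have h2 : ⨆ ρ : State H, ‖((mixChannel σ ε h0 h1).onState ρ).toTC - σ.toTC‖ ≤ 2 * ε :=
      ciSup_le fun ρ => by rw [e]; nlinarith [hbd ρ]
    linarith
  -- The diagonal elements of σ tend to zero along an infinite basis, so some basis state is almost
  -- perfectly distinguishable from σ.
  · obtain ⟨n, hn⟩ := ((σ.hasSum_inner b).summable.tendsto_cofinite_zero.eventually_lt_const hδ).exists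
    have h3 := Channel.half_norm_le_divergence (mixChannel σ ε h0 h1) σ
      (State.pure (b n) (b.orthonormal.1 n))
    rw [e] at h3
    have h4 := sum_re_inner_sub_le (State.pure (b n) (b.orthonormal.1 n)) σ b.orthonormal {n}
    have h5 : ⟪b n, (State.pure (b n) (b.orthonormal.1 n)).op (b n)⟫_ℂ = 1 := by
      rw [State.pure_op, InnerProductSpace.rankOne_apply, inner_smul_right,
        inner_self_eq_norm_sq_to_K, b.orthonormal.1 n]
      simp
    rw [Finset.sum_singleton, h5, Complex.one_re] at h4
    have hσn := σ.re_inner_nonneg (b n)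
    have h6 := mul_le_mul_of_nonneg_left h4 h0
    have h7 : ε * (⟪b n, σ.op (b n)⟫_ℂ).re ≤ δ := by nlinarith
    linarith

theorem mixChannel_energy {ι : Type*} {K : Hamiltonian H} {b : HilbertBasis ι ℂ H} {l : ι → ℝ}
    (hK : K.IsDiagonal b l) {R : H →L[ℂ] H} (hRs : IsSelfAdjoint R)
    (hR : IsDiag R b fun n => (1 + l n)⁻¹) (ρ : State H) :
    K.energy ((mixChannel σ ε h0 h1).onState ρ).op
      = ENNReal.ofReal (1 - ε) * K.energy σ.op + ENNReal.ofReal ε * K.energy ρ.op := by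
  rw [hK.energy_eq hRs hR, hK.energy_eq hRs hR, hK.energy_eq hRs hR, ← ENNReal.tsum_mul_left,
    ← ENNReal.tsum_mul_left, ← ENNReal.tsum_add]
  refine tsum_congr fun n => ?_
  have h2 : 0 ≤ 1 - ε := sub_nonneg.2 h1
  rw [mixChannel_re_inner, ENNReal.ofReal_add (mul_nonneg h2 (σ.re_inner_nonneg _))
    (mul_nonneg h0 (ρ.re_inner_nonneg _)), ENNReal.ofReal_mul h2, ENNReal.ofReal_mul h0]
  ring

theorem mixChannel_maxOutputEnergy_le {ι : Type*} {K : Hamiltonian H} {b : HilbertBasis ι ℂ H}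
    {l : ι → ℝ} (hK : K.IsDiagonal b l) {R : H →L[ℂ] H} (hRs : IsSelfAdjoint R)
    (hR : IsDiag R b fun n => (1 + l n)⁻¹) (hσ : K.energy σ.op ≠ ⊤) (E : ℝ≥0) :
    (mixChannel σ ε h0 h1).maxOutputEnergy K K E
      ≤ ENNReal.ofReal ((K.energy σ.op).toReal + E) := by
  refine iSup₂_le fun ρ hρ => ?_
  rw [mixChannel_energy σ h0 h1 hK hRs hR, ENNReal.ofReal_add ENNReal.toReal_nonneg NNReal.zero_le_coe,
    ENNReal.ofReal_toReal hσ, ENNReal.ofReal_coe_nnreal]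
  have a1 : ENNReal.ofReal (1 - ε) ≤ 1 := ENNReal.ofReal_le_one.2 (by linarith)
  have a2 : ENNReal.ofReal ε ≤ 1 := ENNReal.ofReal_le_one.2 h1
  exact add_le_add (mul_le_of_le_one_left bot_le a1) ((mul_le_of_le_one_left bot_le a2).trans hρ)

end MixChannel

/-! ### A lower bound for the capacity from uniform ensembles -/

section LowerBound

variable {H : Type*} [NormedAddCommGroup H] [InnerProductSpace ℂ H] [CompleteSpace H]

theorem ofReal_neg_log_add_one_le {y q : ℝ} (hy : 0 ≤ y) (hq : 0 < q) :
    ENNReal.ofReal (-Real.log q + 1) ≤ negLog y + ENNReal.ofReal (y / q) := by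
  rw [negLog]
  split_ifs with h
  · simp
  · have hy' : 0 < y := lt_of_le_of_ne hy (Ne.symm h)
    refine le_trans (ENNReal.ofReal_le_ofReal ?_) ENNReal.ofReal_add_le
    have h1 := Real.log_le_sub_one_of_pos (div_pos hy' hq)
    rw [Real.log_div hy'.ne' hq.ne'] at h1
    linarith

/-- Jensen's inequality for -log under the spectral distribution of ω in the vector u, obtained by
integrating the tangent inequality of `ofReal_neg_log_add_one_le`. -/
theorem ofReal_neg_log_le_tsum {ω : State H} {ι : Type*} {e : HilbertBasis ι ℂ H} {y : ι → ℝ}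
    (h : IsDiag ω.op e y) {u : H} (hu : ‖u‖ = 1) (hq : 0 < (⟪u, ω.op u⟫_ℂ).re)
    (hq1 : (⟪u, ω.op u⟫_ℂ).re ≤ 1) :
    ENNReal.ofReal (-Real.log (⟪u, ω.op u⟫_ℂ).re) ≤ ∑' j, negLog (y j) * ‖⟪e j, u⟫_ℂ‖ₑ ^ 2 := by
  set q := (⟪u, ω.op u⟫_ℂ).re with hqd
  have hy0 := h.nonneg ω.isPositive
  have h1 : ∑' j, ‖⟪e j, u⟫_ℂ‖ₑ ^ 2 = 1 := by
    rw [tsum_enorm_inner_sq, ← ofReal_norm, hu]; simp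
  have h2 : ∑' j, ENNReal.ofReal (y j / q) * ‖⟪e j, u⟫_ℂ‖ₑ ^ 2 = 1 := by
    have h3 : ∀ j, ENNReal.ofReal (y j / q) * ‖⟪e j, u⟫_ℂ‖ₑ ^ 2
        = ENNReal.ofReal q⁻¹ * (ENNReal.ofReal (y j) * ‖⟪e j, u⟫_ℂ‖ₑ ^ 2) := fun j => by
      rw [div_eq_inv_mul, ENNReal.ofReal_mul (by positivity), mul_assoc]
    simp_rw [h3]
    rw [ENNReal.tsum_mul_left, ← h.ofReal_inner_apply ω.isPositive u, ← hqd,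
      ← ENNReal.ofReal_mul (by positivity), inv_mul_cancel₀ hq.ne', ENNReal.ofReal_one]
  have hl : 0 ≤ -Real.log q := by linarith [Real.log_nonpos hq.le hq1]
  have key : ENNReal.ofReal (-Real.log q) + 1
      ≤ (∑' j, negLog (y j) * ‖⟪e j, u⟫_ℂ‖ₑ ^ 2) + 1 := by
    calc ENNReal.ofReal (-Real.log q) + 1
        = ∑' j, ENNReal.ofReal (-Real.log q + 1) * ‖⟪e j, u⟫_ℂ‖ₑ ^ 2 := by
          rw [ENNReal.tsum_mul_left, h1, mul_one, ENNReal.ofReal_add hl zero_le_one,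
            ENNReal.ofReal_one]
      _ ≤ ∑' j, (negLog (y j) * ‖⟪e j, u⟫_ℂ‖ₑ ^ 2
          + ENNReal.ofReal (y j / q) * ‖⟪e j, u⟫_ℂ‖ₑ ^ 2) := by
          refine ENNReal.tsum_le_tsum fun j => ?_
          rw [← add_mul]
          gcongr
          exact ofReal_neg_log_add_one_le (hy0 j) hq
      _ = _ := by rw [ENNReal.tsum_add, h2]
  exact (ENNReal.add_le_add_iff_right ENNReal.one_ne_top).1 key

theorem le_relEntropy_add_entropy {ρ ω : State H} {c : ℝ≥0∞} (hS : entropy ρ.op ≠ ⊤)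
    (h : ∀ f, IsEigenbasis ω.op f → c ≤
      ∑' j : f, negLog (⟪(j : H), ω.op j⟫_ℂ).re * ENNReal.ofReal (⟪(j : H), ρ.op j⟫_ℂ).re) :
    c ≤ relEntropy ρ.op ω.op + entropy ρ.op := by
  rcases le_total c (entropy ρ.op) with hc | hc
  · exact hc.trans le_add_self
  · rw [← tsub_le_iff_right]
    refine le_relEntropy hS fun f hf => ?_
    rw [tsub_add_cancel_of_le hc]
    exact h f hf

variable {σ : State H} {ε : ℝ} (h0 : 0 ≤ ε) (h1 : ε ≤ 1) {ι : Type*} {b : HilbertBasis ι ℂ H}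

theorem pure_inner (b : HilbertBasis ι ℂ H) (m n : ι) [DecidableEq ι] :
    (⟪b m, (State.pure (b n) (b.orthonormal.1 n)).op (b m)⟫_ℂ).re = if m = n then 1 else 0 := by
  rw [State.pure_op, InnerProductSpace.rankOne_apply, inner_smul_right,
    orthonormal_iff_ite.1 b.orthonormal, orthonormal_iff_ite.1 b.orthonormal]
  by_cases h : m = n
  · simp [h]
  · simp [h]

/-- The point is that the bound does not depend on n. -/
theorem entropy_mixChannel_pure_le {l : ι → ℝ} (hl : ∀ n, 0 ≤ l n)
    (hsum : Summable fun n => Real.exp (-1 * l n)) (n : ι) :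
    entropy ((mixChannel σ ε h0 h1).onState (State.pure (b n) (b.orthonormal.1 n))).op
      ≤ (∑' m, ENNReal.ofReal (l m) * ENNReal.ofReal (⟪b m, σ.op (b m)⟫_ℂ).re)
        + ENNReal.ofReal (|Real.log (∑' m, Real.exp (-1 * l m))| + 2 * Real.log 2) := by
  classical
  set Z := ∑' m, Real.exp (-1 * l m) with hZ
  have hZ0 : 0 < Z := hsum.tsum_pos (fun n => (Real.exp_pos _).le) n (Real.exp_pos _)
  -- Comparison weights, half Gibbs and half concentrated at n: -log q is at most l + const
  -- everywhere, which pairs with the energy of σ, and at most log 2 at n.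
  set q : ι → ℝ := fun m => 1 / 2 * (Real.exp (-1 * l m) / Z) + 1 / 2 * (if m = n then 1 else 0)
    with hq
  have hg0 : ∀ m, 0 < Real.exp (-1 * l m) / Z := fun m => by positivity
  have hq0 : ∀ m, 0 < q m := fun m => by
    have : (0 : ℝ) ≤ if m = n then 1 else 0 := by split_ifs <;> norm_num
    have := hg0 m
    simp only [hq]; linarith
  have hq1 : HasSum q 1 := by
    have e1 : HasSum (fun m => Real.exp (-1 * l m) / Z) 1 := by
      have := hsum.hasSum.div_const Z
      rwa [← hZ, div_self hZ0.ne'] at this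
    have e2 : HasSum (fun m => if m = n then (1 : ℝ) else 0) 1 := hasSum_ite_eq n 1
    have := (e1.mul_left (1 / 2)).add (e2.mul_left (1 / 2))
    norm_num at this ⊢
    simpa [hq] using this
  have hd : IsDiag (State.diag b q (fun m => (hq0 m).le) hq1).op b q :=
    State.isDiag_diag b q _ hq1
  have hlog2 : 0 ≤ Real.log 2 := Real.log_nonneg (by norm_num)
  have hneg1 : ∀ m, negLog (q m)
      ≤ ENNReal.ofReal (l m) + ENNReal.ofReal (|Real.log Z| + Real.log 2) := fun m => by
    rw [negLog, if_neg (hq0 m).ne', ← ENNReal.ofReal_add (hl m) (by positivity)]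
    refine ENNReal.ofReal_le_ofReal ?_
    have h2 : 1 / 2 * (Real.exp (-1 * l m) / Z) ≤ q m := by
      simp only [hq]; split_ifs <;> linarith
    have h3 := Real.log_le_log (mul_pos (by norm_num) (hg0 m)) h2
    rw [Real.log_mul (by norm_num) (hg0 m).ne', Real.log_div (Real.exp_pos _).ne' hZ0.ne',
      Real.log_exp, one_div, Real.log_inv] at h3
    linarith [le_abs_self (Real.log Z)]
  have hneg2 : negLog (q n) ≤ ENNReal.ofReal (Real.log 2) := by
    rw [negLog, if_neg (hq0 n).ne']
    refine ENNReal.ofReal_le_ofReal ?_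
    have h2 : 1 / 2 ≤ q n := by
      have := hg0 n
      simp only [hq, if_true]; linarith
    have h3 := Real.log_le_log (by norm_num) h2
    rw [one_div, Real.log_inv] at h3
    linarith
  set ρ := (mixChannel σ ε h0 h1).onState (State.pure (b n) (b.orthonormal.1 n)) with hρ
  have hρm : ∀ m, ENNReal.ofReal (⟪b m, ρ.op (b m)⟫_ℂ).re
      ≤ ENNReal.ofReal (⟪b m, σ.op (b m)⟫_ℂ).re + if m = n then 1 else 0 := fun m => by
    have e1 : (if m = n then (1 : ℝ≥0∞) else 0) = ENNReal.ofReal (if m = n then 1 else 0) := by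
      split_ifs <;> simp
    have e2 : (0 : ℝ) ≤ if m = n then 1 else 0 := by split_ifs <;> norm_num
    rw [e1, ← ENNReal.ofReal_add (σ.re_inner_nonneg _) e2]
    refine ENNReal.ofReal_le_ofReal ?_
    rw [hρ, mixChannel_re_inner, pure_inner]
    have := σ.re_inner_nonneg (b m)
    nlinarith
  calc entropy ρ.op ≤ relEntropy ρ.op (State.diag b q (fun m => (hq0 m).le) hq1).op
        + entropy ρ.op := le_add_self
    _ ≤ ∑' m, negLog (q m) * ENNReal.ofReal (⟪b m, ρ.op (b m)⟫_ℂ).re :=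
        relEntropy_add_entropy_le_of_isDiag hd
    _ ≤ ∑' m, ((ENNReal.ofReal (l m) * ENNReal.ofReal (⟪b m, σ.op (b m)⟫_ℂ).re
        + ENNReal.ofReal (|Real.log Z| + Real.log 2) * ENNReal.ofReal (⟪b m, σ.op (b m)⟫_ℂ).re)
        + if m = n then ENNReal.ofReal (Real.log 2) else 0) := by
        refine ENNReal.tsum_le_tsum fun m => ?_
        refine (mul_le_mul_right (hρm m) _).trans ?_
        rw [mul_add, ← add_mul]
        refine add_le_add (mul_le_mul_left (hneg1 m) _) ?_
        split_ifs with hmn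
        · rw [mul_one, hmn]; exact hneg2
        · simp
    _ = _ := by
        rw [ENNReal.tsum_add, ENNReal.tsum_add, ENNReal.tsum_mul_left, σ.tsum_ofReal_inner b,
          tsum_ite_eq, mul_one, add_assoc, ← ENNReal.ofReal_add (by positivity) hlog2]
        congr 2; ring

variable [TopologicalSpace.SeparableSpace H]

/-- The uniform ensemble of the pure states `b n`, `n ∈ B`. -/
def uniformEnsemble (b : HilbertBasis ι ℂ H) (B : Finset ι) : Measure (State H) :=
  (B.card : ℝ≥0∞)⁻¹ • ∑ n ∈ B, Measure.dirac (State.pure (b n) (b.orthonormal.1 n))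

theorem lintegral_uniformEnsemble (B : Finset ι) (f : State H → ℝ≥0∞) :
    ∫⁻ ρ, f ρ ∂uniformEnsemble b B
      = (B.card : ℝ≥0∞)⁻¹ * ∑ n ∈ B, f (State.pure (b n) (b.orthonormal.1 n)) := by
  rw [uniformEnsemble, lintegral_smul_measure, lintegral_finsetSum_measure, smul_eq_mul]
  congr 1
  exact Finset.sum_congr rfl fun n _ => lintegral_dirac _ _

/-- The image ensemble is again a finite sum of point masses, so its integral is a finite sum for
arbitrary, not necessarily measurable f. -/
theorem lintegral_map_uniformEnsemble (B : Finset ι) {Φ : State H → State H} (hΦ : Measurable Φ)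
    (f : State H → ℝ≥0∞) : ∫⁻ ρ, f ρ ∂(uniformEnsemble b B).map Φ
      = (B.card : ℝ≥0∞)⁻¹ * ∑ n ∈ B, f (Φ (State.pure (b n) (b.orthonormal.1 n))) := by
  have e : (uniformEnsemble b B).map Φ = (B.card : ℝ≥0∞)⁻¹ •
      ∑ n ∈ B, Measure.dirac (Φ (State.pure (b n) (b.orthonormal.1 n))) := by
    rw [uniformEnsemble, Measure.map_smul, ← Measure.mapₗ_apply_of_measurable hΦ, map_sum]
    congr 1
    refine Finset.sum_congr rfl fun n _ => ?_
    rw [Measure.mapₗ_apply_of_measurable hΦ]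
    exact Measure.map_dirac' hΦ _
  rw [e, lintegral_smul_measure, lintegral_finsetSum_measure, smul_eq_mul]
  congr 1
  exact Finset.sum_congr rfl fun n _ => lintegral_dirac _ _

theorem isProbabilityMeasure_uniformEnsemble {B : Finset ι} (hB : B.Nonempty) :
    IsProbabilityMeasure (uniformEnsemble b B) := by
  refine ⟨?_⟩
  rw [← lintegral_one, lintegral_uniformEnsemble, Finset.sum_const, nsmul_eq_mul, mul_one]
  exact ENNReal.inv_mul_cancel (by exact_mod_cast hB.card_pos.ne') (ENNReal.natCast_ne_top _)

theorem le_capacity_mixChannel {K : Hamiltonian H} {l : ι → ℝ} (hK : K.IsDiagonal b l)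
    {R : H →L[ℂ] H} (hRs : IsSelfAdjoint R) (hR : IsDiag R b fun n => (1 + l n)⁻¹)
    (hsum : Summable fun n => Real.exp (-1 * l n)) (hσ : K.energy σ.op ≠ ⊤) (hε : 0 < ε)
    {B : Finset ι} (hB : B.Nonempty) {E : ℝ≥0} (hE : ∀ n ∈ B, l n ≤ E) :
    ENNReal.ofReal (ε * Real.log B.card) ≤ (mixChannel σ ε h0 h1).capacity K E
      + (K.energy σ.op
        + ENNReal.ofReal (|Real.log (∑' m, Real.exp (-1 * l m))| + 2 * Real.log 2)) := by
  classical
  set μ := uniformEnsemble b B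
  have hμ : IsProbabilityMeasure μ := isProbabilityMeasure_uniformEnsemble hB
  set Φ := mixChannel σ ε h0 h1 with hΦ
  have hcard : (0 : ℝ) < B.card := by exact_mod_cast hB.card_pos
  have hcinv : (B.card : ℝ≥0∞)⁻¹ = ENNReal.ofReal (B.card : ℝ)⁻¹ := by
    rw [ENNReal.ofReal_inv_of_pos hcard, ENNReal.ofReal_natCast]
  set τ := State.mean μ id measurable_id with hτ
  have hτm : ∀ m, ENNReal.ofReal (⟪b m, τ.op (b m)⟫_ℂ).re
      = if m ∈ B then ENNReal.ofReal (B.card : ℝ)⁻¹ else 0 := fun m => by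
    rw [hτ, ← State.lintegral_ofReal_inner μ measurable_id]
    simp only [id]
    rw [lintegral_uniformEnsemble, hcinv]
    simp_rw [pure_inner]
    have : ∀ n, ENNReal.ofReal (if m = n then (1 : ℝ) else 0) = if m = n then 1 else 0 :=
      fun n => by split_ifs <;> simp
    simp_rw [this]
    rw [Finset.sum_ite_eq]
    split_ifs <;> simp
  have hEτ : K.energy (averageState μ).toCLM ≤ E := by
    change K.energy τ.op ≤ E
    rw [hK.energy_eq hRs hR, tsum_eq_sum (s := B) fun m hm => by rw [hτm, if_neg hm, mul_zero]]
    calc _ ≤ ∑ n ∈ B, (E : ℝ≥0∞) * ENNReal.ofReal (B.card : ℝ)⁻¹ := by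
          refine Finset.sum_le_sum fun n hn => ?_
          rw [hτm, if_pos hn]
          gcongr
          rw [← ENNReal.ofReal_coe_nnreal]
          exact ENNReal.ofReal_le_ofReal (hE n hn)
      _ = E := by
          rw [Finset.sum_const, nsmul_eq_mul, mul_left_comm, ← hcinv,
            ENNReal.mul_inv_cancel (by exact_mod_cast hB.card_pos.ne') (ENNReal.natCast_ne_top _),
            mul_one]
  set ω := State.mean μ Φ.onState Φ.continuous_onState.measurable with hω
  have hω' : ω = Φ.onState τ := Φ.mean_onState μ
  have hav : (averageState (μ.map Φ.onState)).toCLM = ω.op := by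
    rw [Channel.averageState_map]; rfl
  set q : ι → ℝ := fun n => (⟪b n, ω.op (b n)⟫_ℂ).re with hqdef
  have hqs : HasSum q 1 := ω.hasSum_inner b
  have hq0 : ∀ n, 0 ≤ q n := fun n => ω.re_inner_nonneg _
  have hq1 : ∀ n, q n ≤ 1 := fun n => le_hasSum hqs n fun j _ => hq0 j
  have hqpos : ∀ n ∈ B, 0 < q n := fun n hn => by
    have h2 : (⟪b n, τ.op (b n)⟫_ℂ).re = (B.card : ℝ)⁻¹ := by
      have := hτm n
      rw [if_pos hn] at this
      exact (ENNReal.ofReal_eq_ofReal_iff (τ.re_inner_nonneg _) (by positivity)).1 this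
    simp only [hqdef]
    rw [hω', hΦ, mixChannel_re_inner, h2]
    have := σ.re_inner_nonneg (b n)
    have h3 : 0 < ε * (B.card : ℝ)⁻¹ := by positivity
    have h4 : 0 ≤ (1 - ε) * (⟪b n, σ.op (b n)⟫_ℂ).re := mul_nonneg (by linarith) this
    linarith
  set C := K.energy σ.op
    + ENNReal.ofReal (|Real.log (∑' m, Real.exp (-1 * l m))| + 2 * Real.log 2) with hC
  have hCtop : C ≠ ⊤ := ENNReal.add_ne_top.2 ⟨hσ, ENNReal.ofReal_ne_top⟩
  have hS : ∀ n, entropy (Φ.onState (State.pure (b n) (b.orthonormal.1 n))).op ≤ C := fun n => by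
    rw [hC, hK.energy_eq hRs hR]
    exact entropy_mixChannel_pure_le h0 h1 hK.nonneg hsum n
  -- The output dominates ε |bₙ⟩⟨bₙ|, so its cross entropy with ω is at least ε⟨bₙ, -log ω bₙ⟩, to
  -- which Jensen's inequality applies.
  have hD : ∀ n ∈ B, ENNReal.ofReal (ε * -Real.log (q n))
      ≤ relEntropy (Φ.onState (State.pure (b n) (b.orthonormal.1 n))).op ω.op + C := fun n hn => by
    refine le_trans (le_relEntropy_add_entropy (ne_top_of_le_ne_top hCtop (hS n)) fun f hf => ?_)
      (add_le_add_right (hS n) _)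
    have hdf := hf.isDiag ω.isPositive.isSymmetric
    have hj := ofReal_neg_log_le_tsum hdf (b.orthonormal.1 n) (hqpos n hn) (hq1 n)
    rw [ENNReal.ofReal_mul h0]
    refine (mul_le_mul_right hj _).trans ?_
    rw [← ENNReal.tsum_mul_left]
    refine ENNReal.tsum_le_tsum fun j => ?_
    rw [mul_left_comm]
    gcongr
    rw [← ofReal_norm, ← ENNReal.ofReal_pow (norm_nonneg _), ← ENNReal.ofReal_mul h0]
    refine ENNReal.ofReal_le_ofReal ?_
    rw [hΦ, mixChannel_re_inner]
    have h2 := mul_nonneg (sub_nonneg.2 h1) (σ.re_inner_nonneg (j : H))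
    have h3 : (⟪(j : H), (State.pure (b n) (b.orthonormal.1 n)).op j⟫_ℂ).re
        = ‖⟪hf.basis j, b n⟫_ℂ‖ ^ 2 := by
      rw [State.pure_op, InnerProductSpace.rankOne_apply, inner_smul_right, inner_mul_inner_swap,
        Complex.ofReal_re, hf.basis_apply]
    rw [h3]
    linarith
  have hχ : holevoQuantity (μ.map Φ.onState) ≤ Φ.capacity K E :=
    le_iSup_of_le μ <| le_iSup₂_of_le hμ hEτ le_rfl
  refine le_trans ?_ (add_le_add_left hχ C)
  rw [holevoQuantity, hav, lintegral_map_uniformEnsemble B Φ.continuous_onState.measurable]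
  have hCavg : C = (B.card : ℝ≥0∞)⁻¹ * ∑ n ∈ B, C := by
    rw [Finset.sum_const, nsmul_eq_mul, ← mul_assoc,
      ENNReal.inv_mul_cancel (by exact_mod_cast hB.card_pos.ne') (ENNReal.natCast_ne_top _),
      one_mul]
  -- The tangent inequality at |B| qₙ, averaged over B; the diagonal elements qₙ of ω sum to at most
  -- 1.
  have hfin : ENNReal.ofReal (ε * Real.log B.card)
      ≤ (B.card : ℝ≥0∞)⁻¹ * ∑ n ∈ B, ENNReal.ofReal (ε * -Real.log (q n)) := by
    rw [← ENNReal.ofReal_sum_of_nonneg fun n _ => mul_nonneg h0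
      (by linarith [Real.log_nonpos (hq0 n) (hq1 n)]), hcinv,
      ← ENNReal.ofReal_mul (by positivity)]
    refine ENNReal.ofReal_le_ofReal ?_
    rw [← Finset.mul_sum, mul_left_comm]
    refine mul_le_mul_of_nonneg_left ?_ h0
    have h2 : ∀ n ∈ B, Real.log B.card + 1 - B.card * q n ≤ -Real.log (q n) := fun n hn => by
      have := Real.log_le_sub_one_of_pos (mul_pos hcard (hqpos n hn))
      rw [Real.log_mul hcard.ne' (hqpos n hn).ne'] at this
      linarith
    have h3 := Finset.sum_le_sum h2
    rw [Finset.sum_sub_distrib, Finset.sum_const, nsmul_eq_mul, ← Finset.mul_sum] at h3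
    have h4 : ∑ n ∈ B, q n ≤ 1 := sum_le_hasSum B (fun i _ => hq0 i) hqs
    rw [inv_mul_eq_div, le_div_iff₀ hcard]
    nlinarith
  refine hfin.trans ?_
  conv_rhs => rw [hCavg]
  rw [← mul_add, ← Finset.sum_add_distrib]
  gcongr with n hn
  exact hD n hn

end LowerBound

/-! ### Asymptotic tightness for the oscillator -/

section Asymptotics

variable {H : Type*} [NormedAddCommGroup H] [InnerProductSpace ℂ H] [CompleteSpace H]
  {K : Hamiltonian H} {F : ℝ → ℝ}

/-- Used to replace κ by a constant independent of E and E_* by a simpler upper bound. -/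
theorem Hamiltonian.IsEntropyBound.boundAt_mono (hF : K.IsEntropyBound F) {ε κ κ' Es Es' t : ℝ}
    (hε : 0 < ε) (hκ : 0 ≤ κ) (hκ' : κ ≤ κ') (hE : 0 < Es) (hE' : Es ≤ Es')
    (ht : t ∈ Set.Ioc 0 (1 / (2 * ε))) : boundAt F ε κ Es t ≤ boundAt F ε κ' Es' t := by
  obtain ⟨h1, h2, -, h4⟩ := one_le_coeff hε hκ ht
  have ht0 := ht.1
  have h5 := mul_pos hε ht0
  have hFE := hF.pos _ (div_pos hE h5)
  have h6 : F (Es / (ε * t)) ≤ F (Es' / (ε * t)) :=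
    hF.monotoneOn (div_pos hE h5).le (div_pos (hE.trans_le hE') h5).le (by gcongr)
  have h7 : (1 + κ * t) / (1 - ε * t) ≤ (1 + κ' * t) / (1 - ε * t) := by gcongr
  have h8 : gFun ((1 + κ * t) / (1 - ε * t) * ε) ≤ gFun ((1 + κ' * t) / (1 - ε * t) * ε) :=
    gFun_monotoneOn (Set.mem_Ici.2 (by positivity))
      (Set.mem_Ici.2 (mul_nonneg (by linarith) hε.le)) (by gcongr)
  unfold boundAt
  gcongr
  exact mul_nonneg hε.le (by linarith)

/-- The coefficient of εF tends to 1 as t → 0. -/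
theorem exists_coeff_lt {ε κ a : ℝ} (hε : 0 < ε) (ha : a < 1) :
    ∃ t ∈ Set.Ioc 0 (1 / (2 * ε)), a * ((1 + κ * t) / (1 - ε * t) + t) < 1 := by
  have hc : ContinuousAt (fun t : ℝ => a * ((1 + κ * t) / (1 - ε * t) + t)) 0 := by
    refine continuousAt_const.mul (ContinuousAt.add (ContinuousAt.div (by fun_prop) (by fun_prop)
      (by simp)) continuousAt_id)
  have h0 : a * ((1 + κ * 0) / (1 - ε * 0) + 0) < 1 := by simpa using ha
  have h1 := (hc.eventually_lt_const h0).filter_mono (nhdsWithin_le_nhds (s := Set.Ioi 0))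
  have h2 : Set.Ioc 0 (1 / (2 * ε)) ∈ 𝓝[>] (0 : ℝ) := Ioc_mem_nhdsGT (by positivity)
  obtain ⟨t, ht, ht'⟩ := (h1.and (eventually_mem_set.2 h2)).exists
  exact ⟨t, ht', ht⟩

variable {ℓ : ℕ} {ħ : ℝ} {ω : Fin ℓ → ℝ}

theorem boundAt_oscillator_le (hℓ : 0 < ℓ) (hc : ∀ i, 0 < ħ * ω i) {ε κ S t : ℝ} (hε : 0 < ε)
    (hκ : 0 ≤ κ) (hS : 0 ≤ S) (ht : t ∈ Set.Ioc 0 (1 / (2 * ε))) :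
    ∃ D, ∀ E : ℝ, 1 ≤ E → boundAt (oscillatorEntropyBound ħ ω) ε κ (S + E) t
      ≤ (ε * ((1 + κ * t) / (1 - ε * t) + t)) * (ℓ * Real.log E) + D := by
  obtain ⟨-, -, -, h4⟩ := one_le_coeff hε hκ ht
  have h5 := mul_pos hε ht.1
  have hE0 : 0 ≤ 1 / 2 * ∑ i, ħ * ω i :=
    mul_nonneg (by norm_num) (Finset.sum_nonneg fun i _ => (hc i).le)
  set k := ε * ((1 + κ * t) / (1 - ε * t) + t) with hk
  have hk0 : 0 ≤ k := mul_nonneg hε.le (by linarith [ht.1])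
  set M := (S + 1) / (ε * t) + 1 / 2 * ∑ i, ħ * ω i with hM
  have hM0 : 0 < M := add_pos_of_pos_of_nonneg (by positivity) hE0
  refine ⟨k * (ℓ * Real.log M + (ℓ - ℓ * Real.log ℓ - ∑ i, Real.log (ħ * ω i)))
    + Real.binEntropy (ε * t) + gFun ((1 + κ * t) / (1 - ε * t) * ε), fun E hE => ?_⟩
  have hpos : 0 < (S + E) / (ε * t) + 1 / 2 * ∑ i, ħ * ω i :=
    add_pos_of_pos_of_nonneg (by positivity) hE0
  have hle : (S + E) / (ε * t) + 1 / 2 * ∑ i, ħ * ω i ≤ E * M := by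
    rw [hM, mul_add, ← mul_div_assoc]
    exact add_le_add (div_le_div_of_nonneg_right (by nlinarith) h5.le)
      (le_mul_of_one_le_left hE0 hE)
  have hlog := Real.log_le_log hpos hle
  rw [Real.log_mul (by linarith) hM0.ne'] at hlog
  unfold boundAt
  rw [oscillatorEntropyBound_eq hℓ hc hpos, ← hk]
  have h6 : (ℓ : ℝ) * Real.log ((S + E) / (ε * t) + 1 / 2 * ∑ i, ħ * ω i)
      ≤ ℓ * (Real.log E + Real.log M) := by gcongr
  have h7 := mul_le_mul_of_nonneg_left h6 hk0
  linarith

variable {b : HilbertBasis (Fin ℓ → ℕ) ℂ H}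

theorem log_le_capacity_mixChannel [TopologicalSpace.SeparableSpace H] (hℓ : 0 < ℓ)
    (hc : ∀ i, 0 < ħ * ω i) (hK : K.IsDiagonal b (oscLevel fun i => ħ * ω i))
    {R : H →L[ℂ] H} (hRs : IsSelfAdjoint R)
    (hR : IsDiag R b fun n => (1 + oscLevel (fun i => ħ * ω i) n)⁻¹) {σ : State H}
    (hσ : K.energy σ.op ≠ ⊤) {ε : ℝ} (hε : 0 < ε) (h1 : ε ≤ 1) :
    ∃ A E₂ : ℝ, ∀ E : ℝ≥0, E₂ ≤ E → (mixChannel σ ε hε.le h1).capacity K E ≠ ⊤ →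
      ε * (ℓ * Real.log E) - A ≤ ((mixChannel σ ε hε.le h1).capacity K E).toReal := by
  have hne : (Finset.univ : Finset (Fin ℓ)).Nonempty := ⟨⟨0, hℓ⟩, Finset.mem_univ _⟩
  set s := ∑ i, ħ * ω i with hs
  have hs0 : 0 < s := Finset.sum_pos (fun i _ => hc i) hne
  have hsum := summable_exp_oscLevel hc one_pos
  set C := K.energy σ.op + ENNReal.ofReal
    (|Real.log (∑' m, Real.exp (-1 * oscLevel (fun i => ħ * ω i) m))| + 2 * Real.log 2) with hC
  have hCtop : C ≠ ⊤ := ENNReal.add_ne_top.2 ⟨hσ, ENNReal.ofReal_ne_top⟩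
  refine ⟨C.toReal + ε * (ℓ * Real.log (2 * s)), 2 * s, fun E hE hfin => ?_⟩
  -- The box {0, …, N-1}^ℓ has levels at most sN ≤ E, since n + 1/2 ≤ N. The condition E ≥ 2s
  -- ensures N ≥ E/(2s).
  set N := ⌊(E : ℝ) / s⌋₊ with hN
  have hE0 : (0 : ℝ) < E := by linarith
  have h2 : 2 ≤ (E : ℝ) / s := (le_div_iff₀ hs0).2 hE
  have hNle : (N : ℝ) ≤ E / s := Nat.floor_le (by positivity)
  have hNge : (E : ℝ) / (2 * s) ≤ N := by
    have h3 := Nat.lt_floor_add_one ((E : ℝ) / s)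
    have h4 : (E : ℝ) / (2 * s) = E / s / 2 := by rw [div_div, mul_comm]
    rw [h4, hN]; linarith
  have hN0 : 0 < N := by
    have : (0 : ℝ) < N := lt_of_lt_of_le (by positivity) hNge
    exact_mod_cast this
  set B : Finset (Fin ℓ → ℕ) := Fintype.piFinset fun _ => Finset.range N with hB
  have hBcard : B.card = N ^ ℓ := by simp [hB]
  have hBne : B.Nonempty := Finset.card_pos.1 (by rw [hBcard]; positivity)
  have hBE : ∀ n ∈ B, oscLevel (fun i => ħ * ω i) n ≤ E := by
    intro n hn
    rw [hB, Fintype.mem_piFinset] at hn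
    calc oscLevel (fun i => ħ * ω i) n ≤ ∑ i, ħ * ω i * N := by
          refine Finset.sum_le_sum fun i _ => mul_le_mul_of_nonneg_left ?_ (hc i).le
          have : n i + 1 ≤ N := Finset.mem_range.1 (hn i)
          have : (n i : ℝ) + 1 ≤ N := by exact_mod_cast this
          linarith
      _ = s * N := by rw [← Finset.sum_mul]
      _ ≤ s * (E / s) := by gcongr
      _ = E := by field_simp
  have key := le_capacity_mixChannel hε.le h1 hK hRs hR hsum hσ hε hBne hBE
  rw [← hC] at key
  have hlog0 : 0 ≤ Real.log B.card := Real.log_natCast_nonneg _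
  have key2 := (ENNReal.toReal_le_toReal ENNReal.ofReal_ne_top
    (ENNReal.add_ne_top.2 ⟨hfin, hCtop⟩)).2 key
  rw [ENNReal.toReal_ofReal (by positivity), ENNReal.toReal_add hfin hCtop, hBcard, Nat.cast_pow,
    Real.log_pow] at key2
  have h3 := Real.log_le_log (by positivity) hNge
  rw [Real.log_div hE0.ne' (by positivity)] at h3
  have h4 : ε * (ℓ * (Real.log E - Real.log (2 * s))) ≤ ε * (ℓ * Real.log N) := by gcongr
  linarith

theorem exists_tight_channel [TopologicalSpace.SeparableSpace H] (hℓ : 0 < ℓ)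
    (hc : ∀ i, 0 < ħ * ω i) (hK : K.IsDiagonal b (oscLevel fun i => ħ * ω i))
    {R : H →L[ℂ] H} (hRs : IsSelfAdjoint R)
    (hR : IsDiag R b fun n => (1 + oscLevel (fun i => ħ * ω i) n)⁻¹) {σ : State H}
    (hσ : K.energy σ.op ≠ ⊤) {ε : ℝ} (hε : 0 < ε) (h1 : ε ≤ 1) :
    ∃ Φ : Channel H H, Φ.divergence σ = ε ∧ (∀ E : ℝ≥0, Φ.maxOutputEnergy K K E ≠ ⊤) ∧
      Tendsto (fun E : ℝ≥0 => (Φ.capacity K E).toReal /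
        Φ.capacityBound K K (oscillatorEntropyBound ħ ω) σ E) atTop (𝓝 1) ∧
      ∀ E₁ : ℝ≥0, K.groundEnergy ≤ E₁ →
        IsTightOn (Set.Ici E₁) (fun E => (Φ.capacity K E).toReal)
          (fun E => Φ.optimalCapacityBound K K (oscillatorEntropyBound ħ ω) E) := by
  have : Nonempty (Fin ℓ) := ⟨⟨0, hℓ⟩⟩
  have hF := isEntropyBound_oscillator hℓ hc hK hRs hR
  have hinv := hK.isInvOneAdd hRs hR
  obtain ⟨A, E₂, hlow⟩ := log_le_capacity_mixChannel hℓ hc hK hRs hR hσ hε h1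
  set Φ := mixChannel σ ε hε.le h1 with hΦ
  set F := oscillatorEntropyBound ħ ω
  have hdiv : Φ.divergence σ = ε := mixChannel_divergence σ hε.le h1 b
  have hmax := mixChannel_maxOutputEnergy_le σ hε.le h1 hK hRs hR hσ
  have htop : ∀ E : ℝ≥0, Φ.maxOutputEnergy K K E ≠ ⊤ := fun E =>
    ne_top_of_le_ne_top ENNReal.ofReal_ne_top (hmax E)
  set g := 1 / 2 * ∑ i, ħ * ω i with hg
  have hg0 : 0 < g := mul_pos (by norm_num) (Finset.sum_pos (fun i _ => hc i) Finset.univ_nonempty)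
  have hgK : g ≤ K.groundEnergy := hK.le_groundEnergy hRs hR (half_sum_le_oscLevel hc)
  -- The vacuum is an admissible input as soon as E ≥ g, and every output has at least the ground
  -- energy. Hence E_* is bounded away from zero.
  have hmin : ∀ E : ℝ≥0, g ≤ E → ENNReal.ofReal g ≤ Φ.maxOutputEnergy K K E := by
    intro E hE
    have hvac : K.energy (State.pure (b 0) (b.orthonormal.1 0)).op ≤ E := by
      rw [hK.energy_eq hRs hR, tsum_eq_single 0 fun m hm => by
        rw [pure_inner, if_neg hm]; simp]
      rw [pure_inner, if_pos rfl, ENNReal.ofReal_one, mul_one, ← ENNReal.ofReal_coe_nnreal]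
      refine ENNReal.ofReal_le_ofReal (le_trans (le_of_eq ?_) hE)
      rw [oscLevel, hg, Finset.mul_sum]
      exact Finset.sum_congr rfl fun i _ => by simp; ring
    refine le_trans ?_ (le_iSup₂_of_le (f := fun (ρ : State H) (_ : K.energy ρ.op ≤ E) =>
      K.energy (Φ.onState ρ).op) _ hvac le_rfl)
    exact (ENNReal.ofReal_le_ofReal hgK).trans (Hamiltonian.ofReal_groundEnergy_le _)
  have hne0 : ∀ E : ℝ≥0, g ≤ E → Φ.maxOutputEnergy K K E ≠ 0 := fun E hE h => by
    have := hmin E hE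
    rw [h, nonpos_iff_eq_zero, ENNReal.ofReal_eq_zero] at this
    linarith
  have hbound0 : ∀ (σ' : State H) (E : ℝ≥0), g ≤ E → 0 < Φ.divergence σ' →
      ∀ x ∈ Φ.capacityBoundAt K K F σ' E '' Set.Ioc 0 (1 / (2 * Φ.divergence σ')), 0 ≤ x := by
    rintro σ' E hE hd _ ⟨t, ht, rfl⟩
    have hp := ENNReal.toReal_pos (hne0 E hE) (htop E)
    exact le_trans (mul_nonneg hd.le (hF.pos _ (div_pos hp (mul_pos hd ht.1))).le)
      (hF.mul_le_boundAt hd (by positivity) hp ht)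
  have hcapb : ∀ (σ' : State H) (E : ℝ≥0), g ≤ E → 0 < Φ.divergence σ' →
      Φ.capacity K E ≤ ENNReal.ofReal (Φ.capacityBound K K F σ' E) := fun σ' E hE hd =>
    Φ.capacity_le_capacityBound hinv hF hd (htop E) (hne0 E hE)
  have hcap : ∀ (σ' : State H) (E : ℝ≥0), g ≤ E → 0 < Φ.divergence σ' →
      (Φ.capacity K E).toReal ≤ Φ.capacityBound K K F σ' E := fun σ' E hE hd =>
    ENNReal.toReal_le_of_le_ofReal (Real.sInf_nonneg (hbound0 σ' E hE hd)) (hcapb σ' E hE hd)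
  have hσd : 0 < Φ.divergence σ := hdiv.symm ▸ hε
  have hfin : ∀ E : ℝ≥0, g ≤ E → Φ.capacity K E ≠ ⊤ := fun E hE =>
    ne_top_of_le_ne_top ENNReal.ofReal_ne_top (hcapb σ E hE hσd)
  have hlogtop : Tendsto (fun E : ℝ≥0 => Real.log E) atTop atTop :=
    Real.tendsto_log_atTop.comp (NNReal.tendsto_coe_atTop.2 tendsto_id)
  have hEv : ∀ x : ℝ, ∀ᶠ E : ℝ≥0 in atTop, x ≤ E := fun x =>
    (NNReal.tendsto_coe_atTop.2 tendsto_id).eventually_ge_atTop x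
  have hℓ' : (0 : ℝ) < ℓ := by exact_mod_cast hℓ
  have hev : ∀ a : ℝ, 0 < a → a < 1 → ∀ᶠ E : ℝ≥0 in atTop,
      a * Φ.capacityBound K K F σ E < (Φ.capacity K E).toReal := by
    intro a ha0 ha1
    -- Since E_* ≥ g, this dominates the true κ for all E, so t can be chosen independently of E.
    set κ := 1 / 2 * (1 + (K.energy σ.op).toReal / g) with hκ
    have hκ0 : 0 ≤ κ := by have := ENNReal.toReal_nonneg (a := K.energy σ.op); positivity
    obtain ⟨t, ht, hat⟩ := exists_coeff_lt (κ := κ) hε ha1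
    obtain ⟨D, hD⟩ := boundAt_oscillator_le hℓ hc hε hκ0
      (ENNReal.toReal_nonneg (a := K.energy σ.op)) ht
    have hpos : 0 < ε * ℓ * (1 - a * ((1 + κ * t) / (1 - ε * t) + t)) := by
      have := sub_pos.2 hat
      positivity
    filter_upwards [hEv 1, hEv g, hEv E₂,
      (hlogtop.const_mul_atTop hpos).eventually_gt_atTop (A + a * D)] with E h1E hgE h2E hlE
    have hp := ENNReal.toReal_pos (hne0 E hgE) (htop E)
    have hgle : g ≤ (Φ.maxOutputEnergy K K E).toReal := by
      have := (ENNReal.toReal_le_toReal ENNReal.ofReal_ne_top (htop E)).2 (hmin E hgE)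
      rwa [ENNReal.toReal_ofReal hg0.le] at this
    have hEle : (Φ.maxOutputEnergy K K E).toReal ≤ (K.energy σ.op).toReal + E :=
      ENNReal.toReal_le_of_le_ofReal (by positivity) (hmax E)
    have hU : Φ.capacityBound K K F σ E ≤ ε * ((1 + κ * t) / (1 - ε * t) + t)
        * (ℓ * Real.log E) + D := by
      refine le_trans (csInf_le ⟨0, hbound0 σ E hgE hσd⟩ ⟨t, by rw [hdiv]; exact ht, rfl⟩) ?_
      refine le_trans ?_ (hD E h1E)
      rw [Channel.capacityBoundAt, hdiv]
      refine hF.boundAt_mono hε (by positivity) ?_ hp hEle ht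
      rw [hκ]
      gcongr
    have hL := hlow E h2E (hfin E hgE)
    have := mul_le_mul_of_nonneg_left hU ha0.le
    refine lt_of_le_of_lt this (lt_of_lt_of_le ?_ hL)
    nlinarith
  have hUpos : ∀ᶠ E : ℝ≥0 in atTop, 0 < (Φ.capacity K E).toReal ∧ g ≤ E := by
    filter_upwards [hev (1 / 2) (by norm_num) (by norm_num), hEv g] with E hE hgE
    refine ⟨lt_of_le_of_lt ?_ hE, hgE⟩
    exact mul_nonneg (by norm_num) (Real.sInf_nonneg (hbound0 σ E hgE hσd))
  have htend : Tendsto (fun E : ℝ≥0 => (Φ.capacity K E).toReal /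
        Φ.capacityBound K K F σ E) atTop (𝓝 1) := by
    refine tendsto_order.2 ⟨fun a ha => ?_, fun a ha => ?_⟩
    · have hm : max a (1 / 2) < 1 := max_lt ha (by norm_num)
      filter_upwards [hev _ (lt_of_lt_of_le (by norm_num) (le_max_right a (1 / 2))) hm, hUpos]
        with E hE hpE
      have hU := hpE.1.trans_le (hcap σ E hpE.2 hσd)
      refine lt_of_le_of_lt (le_max_left a (1 / 2)) ?_
      rwa [lt_div_iff₀ hU]
    · filter_upwards [hUpos] with E hpE
      exact lt_of_le_of_lt (div_le_one_of_le₀ (hcap σ E hpE.2 hσd)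
        (hpE.1.le.trans (hcap σ E hpE.2 hσd))) ha
  refine ⟨Φ, hdiv, htop, htend, fun E₁ hE₁ => ?_⟩
  have hopt : ∀ E : ℝ≥0, g ≤ E →
      (Φ.capacity K E).toReal ≤ Φ.optimalCapacityBound K K F E := fun E hE => by
    refine le_csInf ⟨_, σ, ⟨hσ, hσd⟩, rfl⟩ ?_
    rintro _ ⟨σ', hσ', rfl⟩
    exact hcap σ' E hE hσ'.2
  have hoptle : ∀ E : ℝ≥0, g ≤ E →
      Φ.optimalCapacityBound K K F E ≤ Φ.capacityBound K K F σ E := fun E hE => by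
    refine csInf_le ⟨0, ?_⟩ ⟨σ, ⟨hσ, hσd⟩, rfl⟩
    rintro _ ⟨σ', hσ', rfl⟩
    exact Real.sInf_nonneg (hbound0 σ' E hE hσ'.2)
  have hgE : ∀ E ∈ Set.Ici E₁, g ≤ (E : ℝ) := fun E hE =>
    (hgK.trans hE₁).trans (by exact_mod_cast hE)
  refine ⟨fun E hE => ⟨ENNReal.toReal_nonneg, hopt E (hgE E hE)⟩, ?_, fun u hu => ?_⟩
  · rintro _ ⟨E, hE, rfl⟩
    exact div_le_one_of_le₀ (hopt E (hgE E hE))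
      (ENNReal.toReal_nonneg.trans (hopt E (hgE E hE)))
  -- The optimized bound is at most the bound for σ, so any upper bound u of its ratios eventually
  -- dominates ratios that tend to 1.
  · refine le_of_tendsto htend ?_
    filter_upwards [hUpos, eventually_ge_atTop E₁] with E hpE hE
    refine le_trans ?_ (hu ⟨E, hE, rfl⟩)
    have := hpE.1.trans_le (hopt E hpE.2)
    dsimp only
    gcongr
    exact hoptle E hpE.2

end Asymptotics

end HolevoBound

end

/-! ### Assembly of the upper bound and the oscillator case -/

theorem proposition4 {HB : Type*} [NormedAddCommGroup HB] [InnerProductSpace ℂ HB]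
    [CompleteSpace HB] [TopologicalSpace.SeparableSpace HB] (KB : Hamiltonian HB) :
    -- the upper bound
    (KB.GibbsCondition →
      ∀ (HA : Type*) [NormedAddCommGroup HA] [InnerProductSpace ℂ HA] [CompleteSpace HA]
        [TopologicalSpace.SeparableSpace HA] (KA : Hamiltonian HA) (Φ : Channel HA HB)
        (σ : State HB) (E : ℝ≥0) (F : ℝ → ℝ),
        KB.energy σ.op ≠ ⊤ → KB.IsEntropyBound F → 0 < Φ.divergence σ →
        Φ.maxOutputEnergy KA KB E ≠ ⊤ → Φ.maxOutputEnergy KA KB E ≠ 0 →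
        Φ.capacity KA E ≤ ENNReal.ofReal (Φ.capacityBound KA KB F σ E) ∧
        (¬ FiniteDimensional ℂ HB →
          ∃ t ∈ Set.Ioc 0 (1 / (2 * Φ.divergence σ)),
            Φ.capacityBound KA KB F σ E = Φ.capacityBoundAt KA KB F σ E t)) ∧
    -- tightness for the oscillator
    (∀ (ℓ : ℕ) (ħ : ℝ) (ω : Fin ℓ → ℝ), 0 < ℓ → 0 < ħ → (∀ i, 0 < ω i) → KB.IsOscillator ħ ω →
      KB.GibbsCondition ∧ KB.IsEntropyBound (oscillatorEntropyBound ħ ω) ∧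
      ∀ σ : State HB, KB.energy σ.op ≠ ⊤ → ∀ ε ∈ Set.Ioc (0 : ℝ) 1,
        ∃ Φ : Channel HB HB, Φ.divergence σ = ε ∧
          (∀ E : ℝ≥0, Φ.maxOutputEnergy KB KB E ≠ ⊤) ∧
          Tendsto (fun E : ℝ≥0 => (Φ.capacity KB E).toReal /
            Φ.capacityBound KB KB (oscillatorEntropyBound ħ ω) σ E) atTop (𝓝 1) ∧
          ∀ E₁ : ℝ≥0, KB.groundEnergy ≤ E₁ →
            IsTightOn (Set.Ici E₁) (fun E => (Φ.capacity KB E).toReal)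
              (fun E => Φ.optimalCapacityBound KB KB (oscillatorEntropyBound ħ ω) E)) := by
  refine ⟨?_, ?_⟩
  · rintro ⟨s, hs, R, hR, -⟩ HA _ _ _ _ KA Φ σ E F hσ hF hε htop h0
    exact ⟨Φ.capacity_le_capacityBound hR hF hε htop h0, fun hinf =>
      hF.exists_boundAt_min (hF.unbounded hinf) hε (by positivity) (ENNReal.toReal_pos h0 htop)⟩
  · intro ℓ ħ ω hℓ hħ hω hosc
    have hc := fun i => mul_pos hħ (hω i)
    obtain ⟨b, hK⟩ := hosc.exists_isDiagonal
    have hsum := summable_exp_oscLevel hc one_pos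
    obtain ⟨R, hRs, hR⟩ := hK.exists_isInvOneAdd one_pos hsum
    exact ⟨hK.gibbsCondition one_pos hsum, isEntropyBound_oscillator hℓ hc hK hRs hR,
      fun σ hσ ε hε => exists_tight_channel hℓ hc hK hRs hR hσ hε.1 hε.2⟩
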